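/- **Setting.** Let $V_1,\dots,V_n$ be complete real-analytic vector fields on $\mathbb{R}^D$ with flows $\varphi^{(j)}$. Put $$\Phi(x,t)=\varphi^{(n)}_{t_n}\circ\cdots\circ\varphi^{(1)}_{t_1}(x)\quad(t\in\mathbb{R}^n),\qquad \Phi^m(x,t)=\varphi^{(n)}_{t_{mn}}\circ\cdots\circ\varphi^{(1)}_{t_1}(x)\quad(t\in\mathbb{R}^{mn}),$$ where in $\Phi^m$ the superscripts cycle in order through $1,\dots,n$. Let $\mathcal{X}=\{\Phi^m(x_0,t):m\ge 0,\ t\in\mathbb{R}^{mn}\}$ be the orbit of a point $x_0$. It carries the orbit topology, i.e. the finest topology for which all maps $t\mapsto\Phi^m(x_0,t)$ from $\mathbb{R}^{mn}$ to $\mathcal{X}$ are continuous (the topology of $\mathcal{X}$ as an immersed analytic submanifold of $\mathbb{R}^D$). Its tangent space $T_x\mathcal{X}\subseteq\mathbb{R}^D$ is spanned by the velocities at $x$ of the $C^1$ curves in $\mathcal{X}$ through $x$. Let $d$ be the dimension of $\mathcal{X}$, let $\mathrm{vol}$ be its Riemannian volume ($d$-dimensional Hausdorff measure $\mathcal H^d$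 on $\mathcal X$); all Hausdorff measures are normalized to agree with Lebesgue measure on Euclidean space. Let $\mathrm{Lie}(\mathcal{V})$ be the Lie algebra of vector fields generated by $V_1,\dots,V_n$; the Lie bracket condition holds at $x\in\mathcal{X}$ if $\{X(x):X\in \mathrm{Lie}(\mathcal{V})\}=T_x\mathcal{X}$. For a probability density $\rho$ on $\mathbb{R}$, let $\tau_1,\dots,\tau_n$ be independent with density $\rho$; for $h>0$ and bounded Borel $f:\mathcal{X}\to\mathbb{R}$ put $P_hf(x)=\mathbb{E}f(\Phi(x,h\tau))$, and let $P_h^m$ be the $m$-th power of $P_h$. **Proposition.** Suppose the Lie bracket condition holds at a point $x_*\in\mathcal{X}$. Then there are $m\ge 1$ with $mn\ge d$ and an open neighbourhood $U$ of $x_*$ in $\mathcal{X}$ such that: 1. For every $x\in U$ and $h>0$, the map $t\mapsto\Phi^m(x,ht)$ from $\mathbb{R}^{mn}$ to $\mathcal{X}$ is a submersion at $t$ (its derivative exists and maps $\mathbb{R}^{mn}$ onto the tangent space of $\mathcal{X}$ at $\Phi^m(x,ht)$) for almost every $t\in\mathbb{R}^{mn}$, in particular for almost every $t\in(0,\infty)^{mn}$.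 2. For every probability density $\rho$ and every $h>0$, $P_h^m$ is strong Feller on $U$: for every bounded Borel $f:\mathcal{X}\to\mathbb{R}$ the function $P_h^mf$ is bounded and continuous on $U$. 3. For every such $\rho$ and $h$, the kernel $P_h^m$ has a transition density on $U$: for $x\in U$ and $y\in\mathcal{X}$ let $$p_{m,h}(x,y)=\int_{\{t\in\mathbb{R}^{mn}:\,\Phi^m(x,ht)=y\}}\frac{\rho(t_1)\cdots\rho(t_{mn})}{\sqrt{\det M_h(x,t)}}\,\mathcal{H}^{mn-d}(dt)$$ if this integral is finite and $p_{m,h}(x,y)=0$ otherwise, where $M_h(x,t)=AA^*$ and $A:\mathbb{R}^{mn}\to T_{\Phi^m(x,ht)}\mathcal{X}$ is the derivative at $t$ of $t\mapsto\Phi^m(x,ht)$. Then for every $x\in U$ the integral is finite for $\mathrm{vol}$-almost every $y$, the function $p_{m,h}(x,\cdot)$ is $\mathrm{vol}$-integrable, and $$P_h^mf(x)=\int_{\mathcal{X}}f(y)\,p_{m,h}(x,y)\,\mathrm{vol}(dy)$$ for every bounded Borel $f:\mathcal{X}\to\mathbb{R}$. -/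

import Mathlib

open MeasureTheory Set
open scoped NNReal ENNReal

noncomputable section

namespace RandomSplitting

/-- A vector field on `ℝ^D` is complete if its integral curve from any point exists for all time. -/
def IsComplete {D : ℕ} (V : EuclideanSpace ℝ (Fin D) → EuclideanSpace ℝ (Fin D)) : Prop :=
  ∀ x, ∃ γ : ℝ → EuclideanSpace ℝ (Fin D), γ 0 = x ∧ IsIntegralCurve γ (fun _ => V)

open Classical in
/-- The flow `φ_t(x)` of `V`: the value at time `t` of the integral curve of `V` that starts at `x`
(unique for a locally Lipschitz field). The value `x` is a default for incomplete fields. -/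
def flow {D : ℕ} (V : EuclideanSpace ℝ (Fin D) → EuclideanSpace ℝ (Fin D))
    (t : ℝ) (x : EuclideanSpace ℝ (Fin D)) : EuclideanSpace ℝ (Fin D) :=
  if h : ∃ γ : ℝ → EuclideanSpace ℝ (Fin D), γ 0 = x ∧ IsIntegralCurve γ (fun _ => V)
  then h.choose t else x

variable {D n : ℕ} (V : Fin n → EuclideanSpace ℝ (Fin D) → EuclideanSpace ℝ (Fin D))

/-- One step `Φ(x, s) = φ^{(n)}_{s_n} ∘ ⋯ ∘ φ^{(1)}_{s_1} (x)`. -/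
def step (x : EuclideanSpace ℝ (Fin D)) (s : Fin n → ℝ) : EuclideanSpace ℝ (Fin D) :=
  (List.finRange n).foldl (fun y j => flow (V j) (s j) y) x

/-- `Φ^m(x, t)` for `t ∈ ℝ^{mn}`: `m` successive steps, the `i`-th of which (`i = 0, …, m - 1`) uses
the times with (zero-based) indices `n * i, …, n * i + n - 1`. -/
def steps (m : ℕ) (x : EuclideanSpace ℝ (Fin D)) (t : Fin (m * n) → ℝ) :
    EuclideanSpace ℝ (Fin D) :=
  (List.finRange m).foldl (fun y i => step V y (fun j => t (finProdFinEquiv (i, j)))) x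

/-- The orbit `{Φ^m(x₀, t) : m ≥ 0, t ∈ ℝ^{mn}}`, with all real times, as a set. -/
def orbitSet (x₀ : EuclideanSpace ℝ (Fin D)) : Set (EuclideanSpace ℝ (Fin D)) :=
  {y | ∃ (m : ℕ) (t : Fin (m * n) → ℝ), steps V m x₀ t = y}

/-- The orbit as a space of its own. It carries the orbit topology (below), which in general is
finer than the one induced from `ℝ^D`. -/
@[ext]
structure Orbit (x₀ : EuclideanSpace ℝ (Fin D)) : Type where
  val : EuclideanSpace ℝ (Fin D)
  mem : val ∈ orbitSet V x₀

theorem step_mem_orbitSet (x₀ : EuclideanSpace ℝ (Fin D)) {y : EuclideanSpace ℝ (Fin D)}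
    (hy : y ∈ orbitSet V x₀) (s : Fin n → ℝ) : step V y s ∈ orbitSet V x₀ := by
  obtain ⟨m, t, rfl⟩ := hy
  refine ⟨m + 1, fun k => if h : (k : ℕ) < m * n then t ⟨k, h⟩ else s k.modNat, ?_⟩
  have h1 : ∀ (i : Fin m) (j : Fin n),
      (finProdFinEquiv (Fin.castSucc i, j) : Fin ((m + 1) * n)).1
        = (finProdFinEquiv (i, j) : Fin (m * n)).1 := fun i j => rfl
  have h2 : ∀ j : Fin n,
      ¬ ((finProdFinEquiv (Fin.last m, j) : Fin ((m + 1) * n)).1 < m * n) := by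
    intro j
    simp [finProdFinEquiv, Nat.mul_comm]
  have h3 : ∀ j : Fin n, (finProdFinEquiv (Fin.last m, j) : Fin ((m + 1) * n)).modNat = j :=
    fun j => congrArg Prod.snd (finProdFinEquiv.symm_apply_apply (Fin.last m, j))
  unfold steps
  rw [List.finRange_succ_last, List.foldl_append, List.foldl_map]
  simp only [List.foldl_cons, List.foldl_nil, h2, dite_false, h3, h1, Fin.is_lt, dite_true, Fin.eta]

theorem steps_mem_orbitSet (x₀ : EuclideanSpace ℝ (Fin D)) (m : ℕ) {y : EuclideanSpace ℝ (Fin D)}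
    (hy : y ∈ orbitSet V x₀) (t : Fin (m * n) → ℝ) : steps V m y t ∈ orbitSet V x₀ := by
  have key : ∀ (l : List (Fin m)) (z : EuclideanSpace ℝ (Fin D)), z ∈ orbitSet V x₀ →
      l.foldl (fun y i => step V y (fun j => t (finProdFinEquiv (i, j)))) z ∈ orbitSet V x₀ := by
    intro l
    induction l with
    | nil => exact fun z hz => hz
    | cons i l ih => exact fun z hz => ih _ (step_mem_orbitSet V x₀ hz _)
  exact key _ y hy

variable {V} {x₀ : EuclideanSpace ℝ (Fin D)}

/-- `Φ` as a self-map of the orbit. -/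
def Orbit.step (x : Orbit V x₀) (s : Fin n → ℝ) : Orbit V x₀ :=
  ⟨RandomSplitting.step V x.1 s, step_mem_orbitSet V x₀ x.2 s⟩

/-- `Φ^m` as a self-map of the orbit. -/
def Orbit.steps (m : ℕ) (x : Orbit V x₀) (t : Fin (m * n) → ℝ) : Orbit V x₀ :=
  ⟨RandomSplitting.steps V m x.1 t, steps_mem_orbitSet V x₀ m x.2 t⟩

/-- The orbit topology: the finest topology for which all the maps `t ↦ Φ^m(x₀, t)` from `ℝ^{mn}`
to the orbit are continuous. -/
instance : TopologicalSpace (Orbit V x₀) :=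
  ⨆ m : ℕ, TopologicalSpace.coinduced
    (fun t : Fin (m * n) → ℝ => (⟨RandomSplitting.steps V m x₀ t, m, t, rfl⟩ : Orbit V x₀))
    inferInstance

instance : MeasurableSpace (Orbit V x₀) := borel _

instance : BorelSpace (Orbit V x₀) := ⟨rfl⟩

/-- The tangent space of the orbit at `y`, as a subspace of `ℝ^D`: the velocities at time `0` of the
`C^1` curves in the orbit through `y`. (A curve in an immersed submanifold is `C^1` iff it is
continuous for the topology of the submanifold and `C^1` as a curve in the ambient space.) -/
def tangentSpace (y : Orbit V x₀) : Submodule ℝ (EuclideanSpace ℝ (Fin D)) :=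
  Submodule.span ℝ {v | ∃ γ : ℝ → Orbit V x₀, Continuous γ ∧
    ContDiff ℝ 1 (fun s => (γ s).1) ∧ γ 0 = y ∧ deriv (fun s => (γ s).1) 0 = v}

/-- The volume of a `d`-dimensional orbit induced by the Euclidean structure of `ℝ^D`: Hausdorff
measure, normalized to agree with Lebesgue measure on `ℝ^d`. -/
def orbitVolume (V : Fin n → EuclideanSpace ℝ (Fin D) → EuclideanSpace ℝ (Fin D))
    (x₀ : EuclideanSpace ℝ (Fin D)) (d : ℕ) : Measure (Orbit V x₀) :=
  (Measure.euclideanHausdorffMeasure d : Measure (EuclideanSpace ℝ (Fin D))).comap (fun y => y.1)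

/-- The Lie algebra generated by the fields `V_j`: the smallest space of vector fields that contains
them and is closed under the Lie bracket. -/
def lieAlgebra (V : Fin n → EuclideanSpace ℝ (Fin D) → EuclideanSpace ℝ (Fin D)) :
    Submodule ℝ (EuclideanSpace ℝ (Fin D) → EuclideanSpace ℝ (Fin D)) :=
  sInf {L | (∀ j, V j ∈ L) ∧ ∀ X ∈ L, ∀ Y ∈ L, VectorField.lieBracket ℝ X Y ∈ L}

/-- The subspace `{X(x) : X ∈ Lie(V)}`. -/
def lieAt (V : Fin n → EuclideanSpace ℝ (Fin D) → EuclideanSpace ℝ (Fin D))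
    (x : EuclideanSpace ℝ (Fin D)) : Submodule ℝ (EuclideanSpace ℝ (Fin D)) :=
  (lieAlgebra V).map (LinearMap.proj x)

/-- The Lie bracket condition at a point of the orbit. -/
def LieBracketCondition (x : Orbit V x₀) : Prop :=
  lieAt V x.1 = tangentSpace x

/-- The map `t ↦ Φ^m(x, h t)` from `ℝ^{mn}` to the orbit. -/
def Orbit.timeMap (m : ℕ) (h : ℝ) (x : Orbit V x₀) (t : EuclideanSpace ℝ (Fin (m * n))) :
    Orbit V x₀ :=
  x.steps m (fun k => h * t k)

/-- The derivative at `t` of `t ↦ Φ^m(x, h t)`, with values in `ℝ^D`. -/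
def timeDeriv (m : ℕ) (h : ℝ) (x : Orbit V x₀) (t : EuclideanSpace ℝ (Fin (m * n))) :
    EuclideanSpace ℝ (Fin (m * n)) →L[ℝ] EuclideanSpace ℝ (Fin D) :=
  fderiv ℝ (fun u => (x.timeMap m h u).1) t

/-- `t ↦ Φ^m(x, h t)` is a submersion at `t`: its derivative maps `ℝ^{mn}` onto the tangent space
of the orbit at the image point. -/
def IsSubmersionAt (m : ℕ) (h : ℝ) (x : Orbit V x₀) (t : EuclideanSpace ℝ (Fin (m * n))) : Prop :=
  DifferentiableAt ℝ (fun u => (x.timeMap m h u).1) t ∧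
    LinearMap.range (timeDeriv m h x t).toLinearMap = tangentSpace (x.timeMap m h t)

/-- The derivative of `t ↦ Φ^m(x, h t)` as a map to the tangent space `T` of the orbit at the image
point. As its values lie in `T`, composing with the orthogonal projection to `T` only changes the
codomain. -/
def timeDerivTangent (m : ℕ) (h : ℝ) (x : Orbit V x₀) (t : EuclideanSpace ℝ (Fin (m * n))) :
    EuclideanSpace ℝ (Fin (m * n)) →L[ℝ] tangentSpace (x.timeMap m h t) :=
  (tangentSpace (x.timeMap m h t)).orthogonalProjectionOnto ∘L timeDeriv m h x t

/-- `M = A A^*` for `A` the derivative of `t ↦ Φ^m(x, h t)`, an endomorphism of the tangent space. -/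
def gram (m : ℕ) (h : ℝ) (x : Orbit V x₀) (t : EuclideanSpace ℝ (Fin (m * n))) :
    tangentSpace (x.timeMap m h t) →L[ℝ] tangentSpace (x.timeMap m h t) :=
  timeDerivTangent m h x t ∘L ContinuousLinearMap.adjoint (timeDerivTangent m h x t)

/-- `ρ` is a probability density on `ℝ`. -/
def IsProbDensity (ρ : ℝ → ℝ≥0) : Prop :=
  Measurable ρ ∧ ∫⁻ s, (ρ s : ℝ≥0∞) = 1

/-- The law of `n` independent times with density `ρ`. -/
def timesLaw (n : ℕ) (ρ : ℝ → ℝ≥0) : Measure (Fin n → ℝ) :=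
  Measure.pi fun _ => volume.withDensity fun s => (ρ s : ℝ≥0∞)

/-- The transition operator `P_h f (x) = 𝔼 f(Φ(x, h τ))` on functions on the orbit. -/
def transition (ρ : ℝ → ℝ≥0) (h : ℝ) (f : Orbit V x₀ → ℝ) (x : Orbit V x₀) : ℝ :=
  ∫ s, f (x.step (fun j => h * s j)) ∂timesLaw n ρ

/-- Bounded measurable functions. -/
def IsBddMeasurable {X : Type*} [MeasurableSpace X] (f : X → ℝ) : Prop :=
  Measurable f ∧ ∃ C : ℝ, ∀ y, |f y| ≤ C

/-- `P` maps bounded measurable functions to functions that are bounded and continuous on `U`. -/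
def StrongFellerOn {X : Type*} [TopologicalSpace X] [MeasurableSpace X]
    (P : (X → ℝ) → X → ℝ) (U : Set X) : Prop :=
  ∀ f, IsBddMeasurable f → ContinuousOn (P f) U ∧ ∃ C : ℝ, ∀ x ∈ U, |P f x| ≤ C

/-- The fibre integral of `ρ(t) / √(det M)`, with `ρ(t) = ∏ ρ(t_k)`, over `{t : Φ^m(x, h t) = y}`
with respect to `(mn - d)`-dimensional Hausdorff measure, as a value in `[0, ∞]`. -/
def coareaIntegral (d m : ℕ) (ρ : ℝ → ℝ≥0) (h : ℝ) (x y : Orbit V x₀) : ℝ≥0∞ :=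
  ∫⁻ t in {t : EuclideanSpace ℝ (Fin (m * n)) | x.timeMap m h t = y},
    (∏ k, (ρ (t k) : ℝ≥0∞)) / ENNReal.ofReal (Real.sqrt (gram m h x t).det)
    ∂(Measure.euclideanHausdorffMeasure (m * n - d))

/-- The density `p_{m,h}(x, y)`: the fibre integral where it is finite, and `0` otherwise. -/
def transitionDensity (d m : ℕ) (ρ : ℝ → ℝ≥0) (h : ℝ) (x y : Orbit V x₀) : ℝ≥0 :=
  (coareaIntegral d m ρ h x y).toNNReal

end RandomSplitting

end

/-! Solving the integral equation with the implicit function theorem in `C([0,1], ℝ^D)` shows that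
the flows are analytic in time and space. Points of the orbit are handled through `IsReach`
families: families reached from `x₀` in a fixed number of steps with analytic times. Their
velocities are tangent to the orbit. Flows transport tangent spaces isomorphically, so these all
have dimension `d`.

The bracket condition enters through a maximal rank argument (`exists_le_finrank_range_timeDeriv`).
Let `r` be the largest rank of `t ↦ Φ^m(x_*, t)` over all `m ≥ 1` and all `t`, attained for some
`m`. Appending a flow of `V_j` cannot raise the rank, so at times of rank `r` each `V_j` is tangent
to the image (`mem_range_fderiv_of_maximal`). On an immersed `r`-dimensional slice, tangency passes
to brackets, hence to all of `Lie(V)`. Times of rank `r` are dense, because a minor is analytic, so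
they occur near `t = 0`, where the image point is near `x_*` and fields that are independent at
`x_*` still are. Hence `d = dim Lie(V)(x_*) ≤ r`.

This gives the first claim. Let `U` be the set of `x` from which rank `d` is attained at some time;
it is open, and on it a nonvanishing analytic minor is nonzero almost everywhere. Since no family
has rank above `d`, the constant rank theorem (`eventually_exists_slice`) yields charts through
which all families factor locally (`exists_chart`).

For the strong Feller property, `exists_lintegral_comp_le` bounds the densities of the images of
Lebesgue measure under nearby submersions by one constant. One may then approximate `f` in a chart
by continuous functions in `L¹`, and `ρ` by compactly supported ones.

The transition density is the coarea formula (`coarea_timeMap`). Near submersion points it follows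
from Fubini and the area formula in straightening coordinates. The remaining null set of times is
negligible on almost every fibre, by a covering argument
(`LipschitzOnWith.ae_hausdorffMeasure_fibre_eq_zero`). The fibre integral has total mass one, hence
is finite almost everywhere. -/

noncomputable section

open Filter Metric
open scoped Topology ContDiff unitInterval

namespace RandomSplitting

/-! ### Analyticity of the flows in time and initial value. -/

section Nemytskii

variable {K E F : Type*} [TopologicalSpace K] [CompactSpace K]
  [NormedAddCommGroup E] [NormedSpace ℝ E] [NormedAddCommGroup F] [NormedSpace ℝ F]

/-- A continuous multilinear map acts pointwise on continuous functions. -/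
def pointwiseMultilinear {k : ℕ} (p : E [×k]→L[ℝ] F) : C(K, E) [×k]→L[ℝ] C(K, F) :=
  MultilinearMap.mkContinuous
    { toFun := fun γ => ⟨fun s => p (fun i => γ i s), by fun_prop⟩
      map_update_add' := by
        intro _ γ i a b
        ext s
        have h (c : C(K, E)) : (fun j => (Function.update γ i c) j s)
            = Function.update (fun j => γ j s) i (c s) := by
          ext j
          by_cases hj : j = i
          · subst hj; simp
          · simp [hj]
        simp [h]
      map_update_smul' := by
        intro _ γ i a b
        ext s
        have h (c : C(K, E)) : (fun j => (Function.update γ i c) j s)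
            = Function.update (fun j => γ j s) i (c s) := by
          ext j
          by_cases hj : j = i
          · subst hj; simp
          · simp [hj]
        simp [h] } ‖p‖ (by
    intro γ
    rw [ContinuousMap.norm_le _ (by positivity)]
    intro s
    refine (p.le_opNorm _).trans ?_
    gcongr with i
    exact (γ i).norm_coe_le_norm s)

theorem norm_pointwiseMultilinear_le {k : ℕ} (p : E [×k]→L[ℝ] F) :
    ‖(pointwiseMultilinear p : C(K, E) [×k]→L[ℝ] C(K, F))‖ ≤ ‖p‖ :=
  MultilinearMap.mkContinuous_norm_le _ (norm_nonneg _) _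

variable [CompleteSpace F]

/-- Composition with an analytic map is analytic on continuous functions, near constants. -/
theorem analyticAt_comp_const {V : C(E, F)} {x : E} (hV : AnalyticAt ℝ V x) :
    AnalyticAt ℝ (fun γ : C(K, E) => V.comp γ) (ContinuousMap.const K x) := by
  obtain ⟨p, r, hp⟩ := hV
  -- The Taylor series of `V` at `x`, applied pointwise in `s`. This does not increase norms, so the
  -- radius is at least as large; evaluation at `s` identifies the sum.
  let q : FormalMultilinearSeries ℝ C(K, E) C(K, F) := fun k => pointwiseMultilinear (p k)
  have hq : p.radius ≤ q.radius :=
    FormalMultilinearSeries.radius_le_of_le fun k => norm_pointwiseMultilinear_le (p k)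
  refine ⟨q, r, hp.r_le.trans hq, hp.r_pos, ?_⟩
  intro γ hγ
  have hsum := q.hasSum (Metric.eball_subset_eball (hp.r_le.trans hq) hγ)
  convert hsum using 1
  ext s
  have h1 := hsum.mapL (ContinuousMap.evalCLM ℝ s)
  have h2 : HasSum (fun k => p k fun _ => γ s) (V (x + γ s)) := by
    apply hp.hasSum
    simp only [Metric.mem_eball, edist_zero_right] at hγ ⊢
    refine lt_of_le_of_lt ?_ hγ
    rw [← ofReal_norm, ← ofReal_norm]
    exact ENNReal.ofReal_le_ofReal (γ.norm_coe_le_norm s)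
  exact h2.unique h1

end Nemytskii

section Primitive

variable {E : Type*} [NormedAddCommGroup E] [NormedSpace ℝ E]

/-- The primitive of a continuous function on the unit interval that vanishes at `0`. -/
def primitive : C(I, E) →L[ℝ] C(I, E) :=
  LinearMap.mkContinuous
    { toFun := fun γ => ⟨fun s => ∫ r in (0 : ℝ)..s, γ (projIcc 0 1 zero_le_one r), by
        have h : Continuous fun r => γ (projIcc 0 1 zero_le_one r) :=
          γ.continuous.comp continuous_projIcc
        exact (intervalIntegral.continuous_primitive
          (fun a b => h.intervalIntegrable a b) 0).comp continuous_subtype_val⟩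
      map_add' := by
        intro γ δ
        ext s
        have h (γ : C(I, E)) : Continuous fun r => γ (projIcc 0 1 zero_le_one r) :=
          γ.continuous.comp continuous_projIcc
        exact intervalIntegral.integral_add ((h γ).intervalIntegrable _ _)
          ((h δ).intervalIntegrable _ _)
      map_smul' := by
        intro c γ
        ext s
        exact intervalIntegral.integral_smul c _ } 1 (by
    intro γ
    rw [ContinuousMap.norm_le _ (by positivity)]
    intro s
    refine (intervalIntegral.norm_integral_le_of_norm_le_const
      (C := ‖γ‖) (fun r _ => γ.norm_coe_le_norm _)).trans ?_
    have h0 := s.2.1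
    have h1 := s.2.2
    rw [sub_zero, abs_of_nonneg h0, one_mul]
    exact mul_le_of_le_one_right (norm_nonneg _) h1)

theorem primitive_apply (γ : C(I, E)) (s : I) :
    primitive γ s = ∫ r in (0 : ℝ)..s, γ (projIcc 0 1 zero_le_one r) := rfl

end Primitive

section Flow

variable {E : Type*} [NormedAddCommGroup E] [NormedSpace ℝ E]

/-- Uniqueness of solutions on the unit interval of an autonomous equation with `C^1` field. -/
theorem eqOn_unitInterval_of_hasDerivWithinAt {V : E → E} (hV : ContDiff ℝ 1 V) {f g : ℝ → E}
    (hf : ContinuousOn f (Icc 0 1)) (hf' : ∀ t ∈ Ico (0 : ℝ) 1, HasDerivWithinAt f (V (f t)) (Ici t) t)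
    (hg : ContinuousOn g (Icc 0 1)) (hg' : ∀ t ∈ Ico (0 : ℝ) 1, HasDerivWithinAt g (V (g t)) (Ici t) t)
    (h0 : f 0 = g 0) : EqOn f g (Icc 0 1) := by
  -- The field is only locally Lipschitz, so a Lipschitz constant is taken on the compact union of
  -- the two trajectories.
  have hc : IsCompact (f '' Icc 0 1 ∪ g '' Icc 0 1) :=
    (isCompact_Icc.image_of_continuousOn hf).union (isCompact_Icc.image_of_continuousOn hg)
  obtain ⟨K, hK⟩ := LocallyLipschitzOn.exists_lipschitzOnWith_of_compact hc
    (hV.locallyLipschitz.locallyLipschitzOn)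
  exact ODE_solution_unique_of_mem_Icc_right (v := fun _ => V) (s := fun _ => _)
    (fun _ _ => hK) hf hf' (fun t ht => Or.inl ⟨t, Ico_subset_Icc_self ht, rfl⟩)
    hg hg' (fun t ht => Or.inr ⟨t, Ico_subset_Icc_self ht, rfl⟩) h0

/-- Rescaling time turns the value at time `t`, of either sign, into the value at time `1` for the
field `t • V`. This reduces everything to the unit interval. -/
theorem hasDerivAt_integralCurve_comp_mul {V : E → E} {f : ℝ → E}
    (hf : IsIntegralCurve f (fun _ => V)) (t s : ℝ) :
    HasDerivAt (fun s => f (t * s)) (t • V (f (t * s))) s := by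
  have h1 : HasDerivAt (fun s => t * s) t s := by simpa using (hasDerivAt_id s).const_mul t
  exact HasDerivAt.scomp s (hf (t * s)) h1

theorem isIntegralCurve_unique {V : E → E} (hV : ContDiff ℝ 1 V) {f g : ℝ → E}
    (hf : IsIntegralCurve f (fun _ => V)) (hg : IsIntegralCurve g (fun _ => V))
    (h0 : f 0 = g 0) : f = g := by
  ext t
  have key (f : ℝ → E) (hf : IsIntegralCurve f (fun _ => V)) (s : ℝ) :=
    hasDerivAt_integralCurve_comp_mul hf t s
  have := eqOn_unitInterval_of_hasDerivWithinAt (V := fun x => t • V x) (hV.const_smul t)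
    (f := fun s => f (t * s)) (g := fun s => g (t * s))
    (fun s _ => (key f hf s).continuousAt.continuousWithinAt)
    (fun s _ => (key f hf s).hasDerivWithinAt)
    (fun s _ => (key g hg s).continuousAt.continuousWithinAt)
    (fun s _ => (key g hg s).hasDerivWithinAt) (by simpa using h0)
    (right_mem_Icc.2 zero_le_one)
  simpa using this

variable [CompleteSpace E]

/-- Near time `0`, the solutions of an analytic equation depend analytically on time and the
initial value. -/
theorem exists_contDiffAt_solution {V : E → E} (hV : AnalyticOnNhd ℝ V univ) (x₀ : E) :
    ∃ ψ : ℝ × E → C(I, E), ContDiffAt ℝ ω ψ (0, x₀) ∧ ∀ᶠ u in 𝓝 ((0 : ℝ), x₀), ∀ s : I,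
      ψ u s = u.2 + u.1 • ∫ r in (0 : ℝ)..s, V (ψ u (projIcc 0 1 zero_le_one r)) := by
  let W : C(E, E) := ⟨V, continuousOn_univ.1 hV.continuousOn⟩
  let cst : E →L[ℝ] C(I, E) := ContinuousLinearMap.const ℝ I
  -- Zeros of `Ψ` are the solutions of the integral equation for the field `t • V` on the unit
  -- interval. At `t = 0` the integral term drops out, so the derivative in the curve is the
  -- identity and the implicit function theorem applies.
  let Ψ : (ℝ × E) × C(I, E) → C(I, E) := fun u => u.2 - cst u.1.2 - u.1.1 • primitive (W.comp u.2)
  let u₀ : (ℝ × E) × C(I, E) := ((0, x₀), ContinuousMap.const I x₀)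
  have hN : ContDiffAt ℝ ω (fun γ : C(I, E) => W.comp γ) (ContinuousMap.const I x₀) :=
    (analyticAt_comp_const (V := W) (hV x₀ (mem_univ _))).contDiffAt
  have hN' : ContDiffAt ℝ ω (fun u : (ℝ × E) × C(I, E) => W.comp u.2) u₀ :=
    hN.comp u₀ contDiffAt_snd
  have hΨ : ContDiffAt ℝ ω Ψ u₀ := by
    have h1 : ContDiffAt ℝ ω (fun u : (ℝ × E) × C(I, E) => cst u.1.2) u₀ :=
      cst.contDiff.contDiffAt.comp u₀ (contDiffAt_snd.comp u₀ contDiffAt_fst)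
    have h2 : ContDiffAt ℝ ω (fun u : (ℝ × E) × C(I, E) => u.1.1) u₀ :=
      contDiffAt_fst.comp u₀ contDiffAt_fst
    have h3 : ContDiffAt ℝ ω (fun u : (ℝ × E) × C(I, E) => primitive (W.comp u.2)) u₀ :=
      ContDiffAt.comp u₀ (primitive (E := E)).contDiff.contDiffAt hN'
    exact (contDiffAt_snd.sub h1).sub (h2.smul h3)
  have hd : fderiv ℝ Ψ u₀ ∘L .inr ℝ (ℝ × E) C(I, E) = .id ℝ _ := by
    have h1 : HasFDerivAt (fun γ : C(I, E) => Ψ (u₀.1, γ))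
        (fderiv ℝ Ψ u₀ ∘L .inr ℝ (ℝ × E) C(I, E)) u₀.2 := by
      refine HasFDerivAt.comp u₀.2 (g := Ψ) (f := fun γ => (u₀.1, γ)) ?_
        (hasFDerivAt_prodMk_right u₀.1 u₀.2)
      exact (hΨ.differentiableAt (by simp)).hasFDerivAt
    have h2 : HasFDerivAt (fun γ : C(I, E) => Ψ (u₀.1, γ)) (.id ℝ _) u₀.2 := by
      have : (fun γ : C(I, E) => Ψ (u₀.1, γ)) = fun γ => γ - cst x₀ := by
        ext γ s; simp [Ψ, u₀]
      rw [this]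
      exact (hasFDerivAt_id _).sub_const _
    exact h1.unique h2
  have hi : (fderiv ℝ Ψ u₀ ∘L .inr ℝ (ℝ × E) C(I, E)).IsInvertible := by
    rw [hd]; exact ⟨.refl ℝ _, rfl⟩
  refine ⟨hΨ.implicitFunction (by simp) hi, hΨ.contDiffAt_implicitFunction (by simp) hi, ?_⟩
  filter_upwards [hΨ.eventually_apply_implicitFunction (by simp) hi] with u hu s
  have h0 : Ψ u₀ = 0 := by
    ext s; simp [Ψ, u₀, cst]
  rw [h0] at hu
  have := congrArg (fun γ : C(I, E) => γ s) hu
  simp only [Ψ, ContinuousMap.sub_apply, ContinuousMap.smul_apply, primitive_apply,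
    ContinuousMap.zero_apply] at this
  rw [sub_sub, sub_eq_zero] at this
  exact this

end Flow

section

variable {D : ℕ} {V : EuclideanSpace ℝ (Fin D) → EuclideanSpace ℝ (Fin D)}

theorem flow_spec (hc : IsComplete V) (x : EuclideanSpace ℝ (Fin D)) :
    flow V 0 x = x ∧ IsIntegralCurve (fun t => flow V t x) (fun _ => V) := by
  have h := hc x
  have : (fun t => flow V t x) = h.choose := by
    ext1 t; simp [flow, h]
  rw [this]
  refine ⟨?_, h.choose_spec.2⟩
  rw [show flow V 0 x = h.choose 0 from congrFun this 0]
  exact h.choose_spec.1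

theorem flow_zero (hc : IsComplete V) (x : EuclideanSpace ℝ (Fin D)) : flow V 0 x = x :=
  (flow_spec hc x).1

theorem hasDerivAt_flow (hc : IsComplete V) (x : EuclideanSpace ℝ (Fin D)) (t : ℝ) :
    HasDerivAt (fun t => flow V t x) (V (flow V t x)) t :=
  (flow_spec hc x).2 t

theorem flow_add (hV : ContDiff ℝ 1 V) (hc : IsComplete V) (s t : ℝ)
    (x : EuclideanSpace ℝ (Fin D)) : flow V (s + t) x = flow V s (flow V t x) := by
  have h := isIntegralCurve_unique hV ((flow_spec hc x).2.comp_add t)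
    (flow_spec hc (flow V t x)).2 (by simp [flow_zero hc])
  exact congrFun h s

theorem flow_neg_flow (hV : ContDiff ℝ 1 V) (hc : IsComplete V) (t : ℝ)
    (x : EuclideanSpace ℝ (Fin D)) : flow V (-t) (flow V t x) = x := by
  rw [← flow_add hV hc, neg_add_cancel, flow_zero hc]

theorem flow_flow_neg (hV : ContDiff ℝ 1 V) (hc : IsComplete V) (t : ℝ)
    (x : EuclideanSpace ℝ (Fin D)) : flow V t (flow V (-t) x) = x := by
  rw [← flow_add hV hc, add_neg_cancel, flow_zero hc]

/-- By uniqueness, the solution from the implicit function theorem is the rescaled flow line; its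
value at `1` is the flow at time `t`. -/
theorem contDiffAt_flow_zero (hV : AnalyticOnNhd ℝ V univ) (hc : IsComplete V)
    (x₀ : EuclideanSpace ℝ (Fin D)) :
    ContDiffAt ℝ ω (fun u : ℝ × EuclideanSpace ℝ (Fin D) => flow V u.1 u.2) (0, x₀) := by
  have hV1 : ContDiff ℝ 1 V := hV.contDiff
  obtain ⟨ψ, hψ, hs⟩ := exists_contDiffAt_solution hV x₀
  have hev : ContDiffAt ℝ ω (fun u => ψ u 1) ((0 : ℝ), x₀) :=
    ContDiffAt.comp (g := fun γ : C(I, EuclideanSpace ℝ (Fin D)) => γ 1) _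
      (ContinuousMap.evalCLM (M := EuclideanSpace ℝ (Fin D)) ℝ (1 : I)).contDiff.contDiffAt hψ
  refine hev.congr_of_eventuallyEq ?_
  filter_upwards [hs] with u hu
  have hcont : Continuous fun r => V (ψ u (projIcc 0 1 zero_le_one r)) :=
    hV1.continuous.comp ((ψ u).continuous.comp continuous_projIcc)
  have hcont' : Continuous fun r => ψ u (projIcc 0 1 zero_le_one r) :=
    (ψ u).continuous.comp continuous_projIcc
  have hfl := hasDerivAt_integralCurve_comp_mul (flow_spec hc u.2).2 u.1
  have := eqOn_unitInterval_of_hasDerivWithinAt (V := fun x => u.1 • V x) (hV1.const_smul u.1)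
    (f := fun s => flow V (u.1 * s) u.2) (g := fun r => ψ u (projIcc 0 1 zero_le_one r))
    (fun s _ => (hfl s).continuousAt.continuousWithinAt)
    (fun s _ => (hfl s).hasDerivWithinAt) hcont'.continuousOn ?_ ?_
    (right_mem_Icc.2 zero_le_one)
  · simpa [projIcc_right] using this
  · intro t ht
    have h1 : HasDerivAt (fun t => u.2 + u.1 • ∫ r in (0 : ℝ)..t,
        V (ψ u (projIcc 0 1 zero_le_one r))) (u.1 • V (ψ u (projIcc 0 1 zero_le_one t))) t :=
      ((hcont.integral_hasStrictDerivAt 0 t).hasDerivAt.const_smul u.1).const_add u.2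
    -- The integral equation holds only at points of `[0,1]`, where `projIcc` is the identity, so
    -- only right derivatives are compared.
    refine h1.hasDerivWithinAt.congr_of_eventuallyEq ?_ ?_
    · have : Ico t 1 ∈ 𝓝[≥] t := Ico_mem_nhdsGE ht.2
      filter_upwards [this] with r hr
      have hr' : r ∈ Icc (0 : ℝ) 1 := ⟨ht.1.trans hr.1, hr.2.le⟩
      rw [hu (projIcc 0 1 zero_le_one r), projIcc_of_mem _ hr']
    · rw [hu (projIcc 0 1 zero_le_one t), projIcc_of_mem _ (Ico_subset_Icc_self ht)]
  · simp only [mul_zero, flow_zero hc]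
    rw [hu, projIcc_left]
    simp

/-- The flow of a complete analytic field is analytic in time and space. -/
theorem contDiff_flow (hV : AnalyticOnNhd ℝ V univ) (hc : IsComplete V) :
    ContDiff ℝ ω (fun u : ℝ × EuclideanSpace ℝ (Fin D) => flow V u.1 u.2) := by
  have hV1 : ContDiff ℝ 1 V := hV.contDiff
  rw [contDiff_iff_contDiffAt]
  rintro ⟨t₀, x⟩
  -- The group law `φ_{t'} = φ_{t'-t} ∘ φ_t` carries analyticity between nearby times, so `S` is
  -- open and closed in `ℝ`; it contains `0`.
  let S : Set ℝ := {t | ContDiffAt ℝ ω (fun u : ℝ × EuclideanSpace ℝ (Fin D) => flow V u.1 u.2) (t, x)}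
  -- an analyticity point at a nearby time gives one here, and conversely
  have key : ∀ a : ℝ, ∀ᶠ t in 𝓝 a, ∀ᶠ t' in 𝓝 a, t ∈ S → t' ∈ S := by
    intro a
    have h0 := (contDiffAt_flow_zero hV hc (flow V a x)).eventually (by simp)
    have hcx : Continuous fun t => flow V t x :=
      continuous_iff_continuousAt.2 fun t => (hasDerivAt_flow hc x t).continuousAt
    have h1 : Tendsto (fun p : ℝ × ℝ => (p.2 - p.1, flow V p.1 x)) (𝓝 (a, a))
        (𝓝 (0, flow V a x)) := by
      have : Continuous (fun p : ℝ × ℝ => (p.2 - p.1, flow V p.1 x)) := by fun_prop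
      simpa using this.tendsto (a, a)
    have h2 := h1.eventually h0
    rw [nhds_prod_eq] at h2
    filter_upwards [h2.curry] with t ht
    filter_upwards [ht] with t' ht' hS
    have hcomp : ContDiffAt ℝ ω (fun u : ℝ × EuclideanSpace ℝ (Fin D) =>
        flow V (u.1 - t) (flow V t u.2)) (t', x) := by
      have hin : ContDiffAt ℝ ω (fun u : ℝ × EuclideanSpace ℝ (Fin D) =>
          (u.1 - t, flow V t u.2)) (t', x) := by
        refine ContDiffAt.prodMk (contDiffAt_fst.sub contDiffAt_const) ?_
        have h3 : ContDiffAt ℝ ω (fun u : ℝ × EuclideanSpace ℝ (Fin D) => (t, u.2)) (t', x) :=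
          contDiffAt_const.prodMk contDiffAt_snd
        have hS' : ContDiffAt ℝ ω (fun u : ℝ × EuclideanSpace ℝ (Fin D) => flow V u.1 u.2) (t, x) :=
          hS
        exact ContDiffAt.comp (t', x)
          (g := fun u : ℝ × EuclideanSpace ℝ (Fin D) => flow V u.1 u.2) hS' h3
      exact ContDiffAt.comp (t', x)
        (g := fun u : ℝ × EuclideanSpace ℝ (Fin D) => flow V u.1 u.2) ht' hin
    have : (fun u : ℝ × EuclideanSpace ℝ (Fin D) => flow V (u.1 - t) (flow V t u.2))
        = fun u => flow V u.1 u.2 := by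
      ext1 u
      rw [← flow_add hV1 hc, sub_add_cancel]
    rw [this] at hcomp
    exact hcomp
  have hopen : IsOpen S := by
    rw [isOpen_iff_mem_nhds]
    intro a ha
    exact (key a).self_of_nhds.mono fun t' h => h ha
  have hclosed : IsClosed S := by
    rw [← isOpen_compl_iff, isOpen_iff_mem_nhds]
    intro a ha
    filter_upwards [key a] with t ht hS
    exact ha (ht.self_of_nhds hS)
  have huniv : S = univ :=
    IsClopen.eq_univ ⟨hclosed, hopen⟩ ⟨0, contDiffAt_flow_zero hV hc x⟩
  have h : t₀ ∈ S := huniv ▸ mem_univ t₀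
  exact h

end

end RandomSplitting

end

/-! ### Analytic families in the orbit, its topology and its tangent spaces. -/

noncomputable section

open Filter Metric
open scoped Topology ContDiff

namespace RandomSplitting

section Steps

variable {D n : ℕ} {V : Fin n → EuclideanSpace ℝ (Fin D) → EuclideanSpace ℝ (Fin D)}

theorem contDiff_foldl {ι E F : Type*} [NormedAddCommGroup E] [NormedSpace ℝ E]
    [NormedAddCommGroup F] [NormedSpace ℝ F] {f : F → ι → E → F}
    (hf : ∀ i, ∀ A : E → F, ContDiff ℝ ω A → ContDiff ℝ ω fun e => f (A e) i e)
    (l : List ι) : ∀ {A : E → F}, ContDiff ℝ ω A →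
      ContDiff ℝ ω fun e => l.foldl (fun y i => f y i e) (A e) := by
  induction l with
  | nil => exact fun hA => hA
  | cons i l ih => exact fun hA => ih (hf i _ hA)

theorem contDiff_step (hV : ∀ j, AnalyticOnNhd ℝ (V j) univ) (hc : ∀ j, IsComplete (V j))
    {E : Type*} [NormedAddCommGroup E] [NormedSpace ℝ E] {A : E → EuclideanSpace ℝ (Fin D)}
    {τ : E → Fin n → ℝ} (hA : ContDiff ℝ ω A) (hτ : ContDiff ℝ ω τ) :
    ContDiff ℝ ω fun e => step V (A e) (τ e) := by
  refine contDiff_foldl (f := fun y j e => flow (V j) (τ e j) y) (fun j B hB => ?_) _ hA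
  exact (contDiff_flow (hV j) (hc j)).comp (f := fun e => (τ e j, B e))
    ((contDiff_pi.1 hτ j).prodMk hB)

theorem contDiff_steps (hV : ∀ j, AnalyticOnNhd ℝ (V j) univ) (hc : ∀ j, IsComplete (V j))
    {E : Type*} [NormedAddCommGroup E] [NormedSpace ℝ E] {A : E → EuclideanSpace ℝ (Fin D)}
    {m : ℕ} {τ : E → Fin (m * n) → ℝ} (hA : ContDiff ℝ ω A) (hτ : ContDiff ℝ ω τ) :
    ContDiff ℝ ω fun e => steps V m (A e) (τ e) := by
  refine contDiff_foldl
    (f := fun y i e => step V y (fun j => τ e (finProdFinEquiv (i, j)))) (fun i B hB => ?_) _ hA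
  exact contDiff_step hV hc hB (contDiff_pi.2 fun j => contDiff_pi.1 hτ _)

/-- A step with a single nonzero time is a single flow. This makes each flow a self-map of the
orbit. -/
theorem step_single (hc : ∀ j, IsComplete (V j)) (x : EuclideanSpace ℝ (Fin D)) (j : Fin n)
    (s : ℝ) : step V x (Pi.single j s) = flow (V j) s x := by
  have key : ∀ (l : List (Fin n)) (y : EuclideanSpace ℝ (Fin D)), l.Nodup →
      l.foldl (fun y i => flow (V i) ((Pi.single j s : Fin n → ℝ) i) y) y
        = if j ∈ l then flow (V j) s y else y := by
    intro l
    induction l with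
    | nil => simp
    | cons i l ih =>
      intro y hl
      rw [List.nodup_cons] at hl
      rw [List.foldl_cons, ih _ hl.2]
      by_cases hij : i = j
      · subst hij
        simp [hl.1]
      · have : j ≠ i := fun h => hij h.symm
        simp [hij, this, flow_zero (hc i)]
  have := key (List.finRange n) x (List.nodup_finRange n)
  simpa [step] using this

theorem steps_succ (m : ℕ) (x : EuclideanSpace ℝ (Fin D)) (t : Fin ((m + 1) * n) → ℝ) :
    steps V (m + 1) x t = step V
      (steps V m x fun k => t (finProdFinEquiv (k.divNat.castSucc, k.modNat)))
      fun j => t (finProdFinEquiv (Fin.last m, j)) := by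
  have h (i : Fin m) (j : Fin n) :
      ((finProdFinEquiv (i, j)).divNat, (finProdFinEquiv (i, j)).modNat) = (i, j) :=
    finProdFinEquiv.symm_apply_apply (i, j)
  unfold steps
  rw [List.finRange_succ_last, List.foldl_append, List.foldl_map]
  simp only [List.foldl_cons, List.foldl_nil]
  congr! 7 with y i j
  · exact congrArg (fun p => finProdFinEquiv (p.1.castSucc, p.2)) (h i j).symm

/-- The times of `m` steps followed by one more. -/
def snocTimes {m : ℕ} (t : Fin (m * n) → ℝ) (s : Fin n → ℝ) : Fin ((m + 1) * n) → ℝ :=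
  fun k => Fin.lastCases (motive := fun _ => ℝ) (s k.modNat)
    (fun i => t (finProdFinEquiv (i, k.modNat))) k.divNat

theorem steps_snocTimes {m : ℕ} (x : EuclideanSpace ℝ (Fin D)) (t : Fin (m * n) → ℝ)
    (s : Fin n → ℝ) : steps V (m + 1) x (snocTimes t s) = step V (steps V m x t) s := by
  have h (i : Fin (m + 1)) (j : Fin n) :
      ((finProdFinEquiv (i, j)).divNat, (finProdFinEquiv (i, j)).modNat) = (i, j) :=
    finProdFinEquiv.symm_apply_apply (i, j)
  have h1 (i : Fin (m + 1)) (j : Fin n) : (finProdFinEquiv (i, j)).divNat = i :=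
    congrArg Prod.fst (h i j)
  have h2 (i : Fin (m + 1)) (j : Fin n) : (finProdFinEquiv (i, j)).modNat = j :=
    congrArg Prod.snd (h i j)
  have h3 (k : Fin (m * n)) : finProdFinEquiv (k.divNat, k.modNat) = k :=
    finProdFinEquiv.apply_symm_apply k
  rw [steps_succ]
  simp only [snocTimes, h1, h2, Fin.lastCases_last, Fin.lastCases_castSucc, h3]

theorem contDiff_snocTimes {E : Type*} [NormedAddCommGroup E] [NormedSpace ℝ E] {m : ℕ}
    {t : E → Fin (m * n) → ℝ} {s : E → Fin n → ℝ} (ht : ContDiff ℝ ω t) (hs : ContDiff ℝ ω s) :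
    ContDiff ℝ ω fun e => snocTimes (t e) (s e) := by
  refine contDiff_pi.2 fun k => ?_
  unfold snocTimes
  refine Fin.lastCases (motive := fun i => ContDiff ℝ ω fun e =>
    (Fin.lastCases (motive := fun _ => ℝ) (s e k.modNat)
      (fun i => t e (finProdFinEquiv (i, k.modNat))) i : ℝ)) ?_ (fun i => ?_) k.divNat
  · simpa using contDiff_pi.1 hs _
  · simpa using contDiff_pi.1 ht _

end Steps

section Reach

variable {D n : ℕ} {V : Fin n → EuclideanSpace ℝ (Fin D) → EuclideanSpace ℝ (Fin D)}
  {x₀ : EuclideanSpace ℝ (Fin D)}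

/-- An analytic family of points of the orbit, reached from `x₀` by a fixed number of steps with
times that depend analytically on the parameter. -/
def IsReach {E : Type*} [NormedAddCommGroup E] [NormedSpace ℝ E] (A : E → Orbit V x₀) : Prop :=
  ∃ (k : ℕ) (τ : E → Fin (k * n) → ℝ), ContDiff ℝ ω τ ∧ ∀ e, (A e).1 = steps V k x₀ (τ e)

theorem continuous_steps_base (k : ℕ) : Continuous
    (fun t : Fin (k * n) → ℝ => (⟨steps V k x₀ t, k, t, rfl⟩ : Orbit V x₀)) :=
  continuous_iSup_rng (i := k) continuous_coinduced_rng

theorem continuous_orbit_iff {Y : Type*} [TopologicalSpace Y] {f : Orbit V x₀ → Y} :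
    Continuous f ↔ ∀ k, Continuous
      fun t : Fin (k * n) → ℝ => f ⟨steps V k x₀ t, k, t, rfl⟩ := by
  rw [continuous_iSup_dom]
  exact forall_congr' fun k => continuous_coinduced_dom

theorem isOpen_orbit_iff {U : Set (Orbit V x₀)} :
    IsOpen U ↔ ∀ k, IsOpen
      {t : Fin (k * n) → ℝ | (⟨steps V k x₀ t, k, t, rfl⟩ : Orbit V x₀) ∈ U} := by
  rw [isOpen_iSup_iff]
  exact forall_congr' fun k => isOpen_coinduced

variable {E : Type*} [NormedAddCommGroup E] [NormedSpace ℝ E] {A : E → Orbit V x₀}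

theorem IsReach.continuous (hA : IsReach A) : Continuous A := by
  obtain ⟨k, τ, hτ, h⟩ := hA
  have : A = (fun t : Fin (k * n) → ℝ => (⟨steps V k x₀ t, k, t, rfl⟩ : Orbit V x₀)) ∘ τ := by
    ext1 e
    exact Orbit.ext (h e)
  rw [this]
  exact (continuous_steps_base k).comp hτ.continuous

theorem IsReach.comp {F : Type*} [NormedAddCommGroup F] [NormedSpace ℝ F] (hA : IsReach A)
    {g : F → E} (hg : ContDiff ℝ ω g) : IsReach fun e => A (g e) := by
  obtain ⟨k, τ, hτ, h⟩ := hA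
  exact ⟨k, fun e => τ (g e), hτ.comp hg, fun e => h (g e)⟩

theorem isReach_base (k : ℕ) :
    IsReach (fun t : Fin (k * n) → ℝ => (⟨steps V k x₀ t, k, t, rfl⟩ : Orbit V x₀)) :=
  ⟨k, id, contDiff_id, fun _ => rfl⟩

theorem isReach_const (y : Orbit V x₀) : IsReach fun _ : E => y := by
  obtain ⟨k, t, h⟩ := y.2
  exact ⟨k, fun _ => t, contDiff_const, fun _ => h.symm⟩

theorem IsReach.step {τ : E → Fin n → ℝ} (hA : IsReach A) (hτ : ContDiff ℝ ω τ) :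
    IsReach fun e => (A e).step (τ e) := by
  obtain ⟨k, σ, hσ, h⟩ := hA
  refine ⟨k + 1, fun e => snocTimes (σ e) (τ e), contDiff_snocTimes hσ hτ, fun e => ?_⟩
  rw [steps_snocTimes, ← h]
  rfl

theorem Orbit.steps_succ (m : ℕ) (x : Orbit V x₀) (t : Fin ((m + 1) * n) → ℝ) :
    x.steps (m + 1) t
      = (x.steps m fun k => t (finProdFinEquiv (k.divNat.castSucc, k.modNat))).step
      fun j => t (finProdFinEquiv (Fin.last m, j)) :=
  Orbit.ext (RandomSplitting.steps_succ m x.1 t)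

theorem IsReach.steps {m : ℕ} {τ : E → Fin (m * n) → ℝ} (hA : IsReach A) (hτ : ContDiff ℝ ω τ) :
    IsReach fun e => (A e).steps m (τ e) := by
  induction m with
  | zero => exact hA
  | succ m ih =>
    simp only [Orbit.steps_succ]
    exact (ih (contDiff_pi.2 fun k => contDiff_pi.1 hτ _)).step
      (contDiff_pi.2 fun k => contDiff_pi.1 hτ _)

/-- The flow of one of the fields, as a self-map of the orbit. -/
def Orbit.flow (j : Fin n) (s : ℝ) (x : Orbit V x₀) : Orbit V x₀ := x.step (Pi.single j s)

theorem IsReach.flow (hA : IsReach A) (j : Fin n) {s : E → ℝ} (hs : ContDiff ℝ ω s) :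
    IsReach fun e => (A e).flow j (s e) := by
  refine hA.step (contDiff_pi.2 fun i => ?_)
  by_cases h : i = j
  · subst h; simpa using hs
  · simpa [h] using contDiff_const

section

variable (hc : ∀ j, IsComplete (V j))
include hc

theorem Orbit.flow_val (j : Fin n) (s : ℝ) (x : Orbit V x₀) :
    (x.flow j s).1 = RandomSplitting.flow (V j) s x.1 := step_single hc x.1 j s

theorem Orbit.step_eq_foldl (x : Orbit V x₀) (s : Fin n → ℝ) :
    x.step s = (List.finRange n).foldl (fun y j => y.flow j (s j)) x := by
  refine Orbit.ext ?_
  have key : ∀ (l : List (Fin n)) (x : Orbit V x₀),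
      l.foldl (fun y j => RandomSplitting.flow (V j) (s j) y) x.1
        = (l.foldl (fun y j => y.flow j (s j)) x).1 := by
    intro l
    induction l with
    | nil => exact fun _ => rfl
    | cons j l ih =>
      intro x
      rw [List.foldl_cons, List.foldl_cons, ← ih, Orbit.flow_val hc]
  exact key _ x

/-- Induction along flows. -/
theorem Orbit.steps_induction {P : Orbit V x₀ → Prop}
    (hf : ∀ y j s, P y → P (y.flow j s)) (m : ℕ) (x : Orbit V x₀) (hx : P x)
    (t : Fin (m * n) → ℝ) : P (x.steps m t) := by
  have hstep : ∀ (x : Orbit V x₀) (s : Fin n → ℝ), P x → P (x.step s) := by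
    intro x s
    rw [Orbit.step_eq_foldl hc]
    generalize List.finRange n = l
    induction l generalizing x with
    | nil => exact fun h => h
    | cons j l ih => exact fun h => ih _ (hf _ _ _ h)
  induction m with
  | zero => exact hx
  | succ m ih =>
    rw [Orbit.steps_succ]
    exact hstep _ _ (ih _)

theorem Orbit.induction {P : Orbit V x₀ → Prop} (h0 : P ⟨x₀, 0, fun _ => 0, rfl⟩)
    (hf : ∀ y j s, P y → P (y.flow j s)) (y : Orbit V x₀) : P y := by
  obtain ⟨m, t, h⟩ := y.2
  have : y = Orbit.steps m ⟨x₀, 0, fun _ => 0, rfl⟩ t := Orbit.ext h.symm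
  rw [this]
  exact Orbit.steps_induction hc hf m _ h0 t

variable (hV : ∀ j, AnalyticOnNhd ℝ (V j) univ)
include hV

theorem IsReach.contDiff (hA : IsReach A) : ContDiff ℝ ω fun e => (A e).1 := by
  obtain ⟨k, τ, hτ, h⟩ := hA
  simp only [h]
  exact contDiff_steps hV hc contDiff_const hτ

theorem continuous_val : Continuous fun y : Orbit V x₀ => y.1 :=
  continuous_orbit_iff.2 fun k => ((isReach_base k).contDiff hc hV).continuous

omit hc hV in
theorem Orbit.continuous_flow (j : Fin n) (s : ℝ) :
    Continuous fun y : Orbit V x₀ => y.flow j s :=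
  continuous_orbit_iff.2 fun k => ((isReach_base k).flow j contDiff_const).continuous

theorem Orbit.flow_neg_flow (j : Fin n) (s : ℝ) (x : Orbit V x₀) :
    (x.flow j s).flow j (-s) = x := by
  refine Orbit.ext ?_
  rw [Orbit.flow_val hc, Orbit.flow_val hc, RandomSplitting.flow_neg_flow (hV j).contDiff (hc j)]

theorem Orbit.flow_flow_neg (j : Fin n) (s : ℝ) (x : Orbit V x₀) :
    (x.flow j (-s)).flow j s = x := by
  refine Orbit.ext ?_
  rw [Orbit.flow_val hc, Orbit.flow_val hc, RandomSplitting.flow_flow_neg (hV j).contDiff (hc j)]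

/-- The flows of the step are undone from the last to the first. Negative times are admissible, so
the preimages are again reached from `x₀`. -/
theorem IsReach.exists_step_eq (hA : IsReach A) (s : Fin n → ℝ) :
    ∃ B : E → Orbit V x₀, IsReach B ∧ ∀ e, (B e).step s = A e := by
  simp only [Orbit.step_eq_foldl hc]
  generalize List.finRange n = l
  induction l using List.reverseRecOn generalizing A with
  | nil => exact ⟨A, hA, fun _ => rfl⟩
  | append_singleton l j ih =>
    obtain ⟨B, hB, h⟩ := ih (hA.flow j (s := fun _ => -s j) contDiff_const)
    refine ⟨B, hB, fun e => ?_⟩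
    rw [List.foldl_append, List.foldl_cons, List.foldl_nil, h, Orbit.flow_flow_neg hc hV]

theorem IsReach.exists_steps_eq (hA : IsReach A) (m : ℕ) (t : Fin (m * n) → ℝ) :
    ∃ B : E → Orbit V x₀, IsReach B ∧ ∀ e, (B e).steps m t = A e := by
  induction m generalizing A with
  | zero => exact ⟨A, hA, fun _ => rfl⟩
  | succ m ih =>
    obtain ⟨B, hB, h⟩ := hA.exists_step_eq hc hV fun j => t (finProdFinEquiv (Fin.last m, j))
    obtain ⟨C, hC, h'⟩ := ih hB fun k => t (finProdFinEquiv (k.divNat.castSucc, k.modNat))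
    refine ⟨C, hC, fun e => ?_⟩
    rw [Orbit.steps_succ, h', h]

theorem Orbit.flow_injective (j : Fin n) (s : ℝ) :
    Function.Injective fun y : Orbit V x₀ => y.flow j s :=
  Function.LeftInverse.injective (Orbit.flow_neg_flow hc hV j s)

theorem Orbit.step_injective (s : Fin n → ℝ) :
    Function.Injective fun y : Orbit V x₀ => y.step s := by
  intro x y
  simp only [Orbit.step_eq_foldl hc]
  generalize List.finRange n = l
  induction l generalizing x y with
  | nil => exact fun h => h
  | cons j l ih => exact fun h => Orbit.flow_injective hc hV j (s j) (ih h)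

theorem Orbit.steps_injective (m : ℕ) (t : Fin (m * n) → ℝ) :
    Function.Injective fun y : Orbit V x₀ => y.steps m t := by
  induction m with
  | zero => exact fun x y h => h
  | succ m ih =>
    intro x y h
    simp only [Orbit.steps_succ] at h
    exact ih _ (Orbit.step_injective hc hV _ h)

/-- Two families that meet can be joined to a family on the product of the parameter spaces. -/
theorem IsReach.exists_join {F : Type*} [NormedAddCommGroup F] [NormedSpace ℝ F]
    (hA : IsReach A) {G : F → Orbit V x₀} (hG : IsReach G) {e₀ : E} {f₀ : F}
    (h : A e₀ = G f₀) :
    ∃ C : E × F → Orbit V x₀, IsReach C ∧ (∀ e, C (e, f₀) = A e) ∧ ∀ f, C (e₀, f) = G f := by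
  obtain ⟨k, τ, hτ, hk⟩ := hG
  have hk' : ∀ f, G f = Orbit.steps k ⟨x₀, 0, fun _ => 0, rfl⟩ (τ f) := fun f => Orbit.ext (hk f)
  -- `B` undoes from `A` the times `τ f₀` that lead from `x₀` to the meeting point, so `B e₀ = x₀`
  -- by injectivity. Applying the times `τ f` after `B e` gives both `A` (at `f₀`) and `G` (at
  -- `e₀`).
  obtain ⟨B, hB, hBA⟩ := hA.exists_steps_eq hc hV k (τ f₀)
  refine ⟨fun p => (B p.1).steps k (τ p.2),
    (hB.comp contDiff_fst).steps (hτ.comp contDiff_snd), hBA, fun f => ?_⟩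
  have : B e₀ = ⟨x₀, 0, fun _ => 0, rfl⟩ :=
    Orbit.steps_injective hc hV k (τ f₀) (by simp only [hBA, h, hk'])
  simp only [this, hk']

/-- Restricted to the line `e + s v`, the family is a `C^1` curve in the orbit with this velocity.
-/
theorem IsReach.fderiv_mem_tangentSpace (hA : IsReach A) (e v : E) :
    fderiv ℝ (fun e => (A e).1) e v ∈ tangentSpace (A e) := by
  have hl : ContDiff ℝ ω (fun s : ℝ => e + s • v) := by fun_prop
  have hB := hA.comp hl
  refine Submodule.subset_span ⟨_, hB.continuous, (hB.contDiff hc hV).of_le (by simp), by simp, ?_⟩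
  have h1 : HasFDerivAt (fun e => (A e).1) (fderiv ℝ (fun e => (A e).1) e) (e + (0 : ℝ) • v) := by
    simpa using (((hA.contDiff hc hV).differentiable (by simp)) e).hasFDerivAt
  have h2 : HasDerivAt (fun s : ℝ => e + s • v) v 0 := by
    simpa using ((hasDerivAt_id (0 : ℝ)).smul_const v).const_add e
  exact (h1.comp_hasDerivAt (0 : ℝ) h2).deriv

/-- The derivative of the flow is injective, as the flow has a smooth inverse, and it maps
velocities of curves in the orbit to velocities of the transported curves. -/
theorem finrank_tangentSpace_le_flow (j : Fin n) (s : ℝ) (y : Orbit V x₀) :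
    Module.finrank ℝ (tangentSpace y) ≤ Module.finrank ℝ (tangentSpace (y.flow j s)) := by
  have hφ (s : ℝ) : ContDiff ℝ ω (fun x => RandomSplitting.flow (V j) s x) :=
    (contDiff_flow (hV j) (hc j)).comp (f := fun x => (s, x)) (contDiff_const.prodMk contDiff_id)
  have hφd (s : ℝ) (x : EuclideanSpace ℝ (Fin D)) :=
    ((hφ s).differentiable (by simp) x).hasFDerivAt
  set L := fderiv ℝ (fun x => RandomSplitting.flow (V j) s x) y.1
  have hinj : Function.Injective L := by
    have h1 := (hφd (-s) (RandomSplitting.flow (V j) s y.1)).comp y.1 (hφd s y.1)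
    have h2 : (fun x => RandomSplitting.flow (V j) (-s) x) ∘
        (fun x => RandomSplitting.flow (V j) s x) = id := by
      ext1 x
      exact RandomSplitting.flow_neg_flow (hV j).contDiff (hc j) s x
    rw [h2] at h1
    have h3 := h1.unique (hasFDerivAt_id _)
    intro a b hab
    have := congrArg (fun M => M a) h3
    have h4 := congrArg (fun M => M b) h3
    simp only [ContinuousLinearMap.comp_apply, ContinuousLinearMap.id_apply] at this h4
    rw [← this, ← h4]
    exact congrArg _ hab
  have hle : (tangentSpace y).map L.toLinearMap ≤ tangentSpace (y.flow j s) := by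
    rw [tangentSpace, Submodule.map_span, Submodule.span_le]
    rintro _ ⟨_, ⟨γ, hγ, hγ1, rfl, rfl⟩, rfl⟩
    refine Submodule.subset_span ⟨fun r => (γ r).flow j s,
      (Orbit.continuous_flow j s).comp hγ, ?_, rfl, ?_⟩
    · simp only [Orbit.flow_val hc]
      exact ((hφ s).of_le (by simp)).comp hγ1
    · simp only [Orbit.flow_val hc]
      exact ((hφd s _).comp_hasDerivAt (0 : ℝ)
        (hγ1.differentiable (by simp) 0).hasDerivAt).deriv
  calc Module.finrank ℝ (tangentSpace y)
      = Module.finrank ℝ ((tangentSpace y).map L.toLinearMap) :=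
        ((Submodule.equivMapOfInjective L.toLinearMap hinj (tangentSpace y)).finrank_eq)
    _ ≤ _ := Submodule.finrank_mono hle

theorem finrank_tangentSpace_eq (y z : Orbit V x₀) :
    Module.finrank ℝ (tangentSpace y) = Module.finrank ℝ (tangentSpace z) := by
  have key : ∀ y : Orbit V x₀, Module.finrank ℝ (tangentSpace y)
      = Module.finrank ℝ (tangentSpace (⟨x₀, 0, fun _ => 0, rfl⟩ : Orbit V x₀)) := by
    refine Orbit.induction hc rfl fun y j s h => ?_
    rw [← h]
    refine le_antisymm ?_ (finrank_tangentSpace_le_flow hc hV j s y)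
    have := finrank_tangentSpace_le_flow hc hV j (-s) (y.flow j s)
    rwa [Orbit.flow_neg_flow hc hV] at this
  rw [key y, key z]

end

end Reach

end RandomSplitting

end

/-! ### Generic rank of analytic maps, and full rank from the Lie bracket condition. -/

noncomputable section

open Filter Metric
open scoped Topology ContDiff

namespace RandomSplitting

section AnalyticNull

/-- Induction on the dimension with Fubini. With the other coordinates frozen at those of `t₁`, the
zeros of the function of the first coordinate are isolated, hence null. For every other first
coordinate the induction hypothesis applies to the remaining ones. -/
theorem ae_ne_zero_of_contDiff_pi : ∀ (N : ℕ) {f : (Fin N → ℝ) → ℝ}, ContDiff ℝ ω f →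
    ∀ {t₁ : Fin N → ℝ}, f t₁ ≠ 0 → ∀ᵐ t, f t ≠ 0 := by
  intro N
  induction N with
  | zero =>
    intro f _ t₁ h
    exact Eventually.of_forall fun t => by rwa [Subsingleton.elim t t₁]
  | succ N ih =>
    intro f hf t₁ h
    let e := MeasurableEquiv.piFinSuccAbove (fun _ : Fin (N + 1) => ℝ) 0
    have hmp : MeasurePreserving e.symm :=
      (volume_preserving_piFinSuccAbove (fun _ : Fin (N + 1) => ℝ) 0).symm
    have he : ∀ p, e.symm p = Fin.cons p.1 p.2 := fun p => by
      simp [e, MeasurableEquiv.piFinSuccAbove, Fin.insertNthEquiv, Fin.insertNth_zero']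
    have hcons : ContDiff ℝ ω fun p : ℝ × (Fin N → ℝ) => f (Fin.cons p.1 p.2) := by
      refine hf.comp (contDiff_pi.2 fun i => ?_)
      refine Fin.cases ?_ (fun j => ?_) i
      · simpa using contDiff_fst
      · simpa using contDiff_pi.1 contDiff_snd j
    suffices hs : ∀ᵐ p : ℝ × (Fin N → ℝ), f (e.symm p) ≠ 0 by
      have h2 := (volume_preserving_piFinSuccAbove (fun _ : Fin (N + 1) => ℝ) 0)
      have h3 := h2.quasiMeasurePreserving.ae hs
      filter_upwards [h3] with t ht
      have ht' : f (e.symm (e t)) ≠ 0 := ht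
      rwa [e.symm_apply_apply] at ht'
    simp only [he]
    have hmeas : MeasurableSet {p : ℝ × (Fin N → ℝ) | f (Fin.cons p.1 p.2) ≠ 0} :=
      (isOpen_ne_fun hcons.continuous continuous_const).measurableSet
    rw [Measure.volume_eq_prod, Measure.ae_prod_iff_ae_ae hmeas]
    have h1 : ContDiff ℝ ω fun a : ℝ => f (Fin.cons a (Fin.tail t₁)) :=
      hcons.comp (contDiff_id.prodMk contDiff_const)
    have hne : ∀ᵐ a : ℝ, f (Fin.cons a (Fin.tail t₁)) ≠ 0 := by
      have han : AnalyticOnNhd ℝ (fun a : ℝ => f (Fin.cons a (Fin.tail t₁))) univ :=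
        fun a _ => h1.contDiffAt.analyticAt
      rcases han.eqOn_zero_or_eventually_ne_zero_of_preconnected isPreconnected_univ with h0 | h0
      · exact absurd (h0 (mem_univ (t₁ 0))) (by simpa using h)
      · have := ae_restrict_le_codiscreteWithin (μ := (volume : Measure ℝ)) MeasurableSet.univ h0
        rw [Measure.restrict_univ] at this
        exact this
    filter_upwards [hne] with a ha
    exact ih (f := fun b => f (Fin.cons a b)) (hcons.comp (contDiff_const.prodMk contDiff_id)) ha

/-- A real-analytic function that does not vanish identically is nonzero almost everywhere. -/
theorem ae_ne_zero_of_contDiff {N : ℕ} {f : EuclideanSpace ℝ (Fin N) → ℝ} (hf : ContDiff ℝ ω f)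
    {t₁ : EuclideanSpace ℝ (Fin N)} (h : f t₁ ≠ 0) : ∀ᵐ t, f t ≠ 0 := by
  have h1 : ∀ᵐ t : Fin N → ℝ, f (WithLp.toLp 2 t) ≠ 0 := by
    refine ae_ne_zero_of_contDiff_pi N (f := fun t => f (WithLp.toLp 2 t)) ?_
      (t₁ := WithLp.ofLp t₁) h
    exact hf.comp (PiLp.contDiff_toLp)
  have h2 := (PiLp.volume_preserving_ofLp (Fin N)).quasiMeasurePreserving.ae h1
  simpa using h2

end AnalyticNull

section Rank

variable {E F : Type*} [NormedAddCommGroup E] [NormedSpace ℝ E] [FiniteDimensional ℝ E]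
  [NormedAddCommGroup F] [NormedSpace ℝ F] [FiniteDimensional ℝ F]

omit [FiniteDimensional ℝ E] in
/-- A linear map of rank at least `r` has an invertible `r`-dimensional compression. -/
theorem exists_comp_comp_eq_id {r : ℕ} (L : E →L[ℝ] F)
    (hr : r ≤ Module.finrank ℝ (LinearMap.range L.toLinearMap)) :
    ∃ (ι : EuclideanSpace ℝ (Fin r) →L[ℝ] E) (π : F →L[ℝ] EuclideanSpace ℝ (Fin r)),
      π ∘L L ∘L ι = .id ℝ _ := by
  obtain ⟨v, hv⟩ := exists_linearIndependent_of_le_finrank hr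
  have hv' := hv.map' (LinearMap.range L.toLinearMap).subtype (Submodule.ker_subtype _)
  choose w hw using fun i => (v i).2
  let b := (EuclideanSpace.basisFun (Fin r) ℝ).toBasis
  let ι₀ : EuclideanSpace ℝ (Fin r) →ₗ[ℝ] E := b.constr ℝ w
  have hι : ∀ i, L (ι₀ (b i)) = v i := fun i => by
    rw [Module.Basis.constr_basis]; exact hw i
  have hinj : LinearMap.ker (L.toLinearMap ∘ₗ ι₀) = ⊥ := by
    have heq : L.toLinearMap ∘ₗ ι₀ = b.constr ℝ (fun i => (v i : F)) :=
      b.ext fun i => by rw [Module.Basis.constr_basis]; exact hι i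
    rw [heq, LinearMap.ker_eq_bot]
    exact b.injective_constr_of_linearIndependent hv'
  obtain ⟨π₀, hπ₀⟩ := (L.toLinearMap ∘ₗ ι₀).exists_leftInverse_of_injective hinj
  refine ⟨ι₀.toContinuousLinearMap, π₀.toContinuousLinearMap, ?_⟩
  ext1 x
  exact congrArg (fun M => M x) hπ₀

omit [FiniteDimensional ℝ F] in
theorem injective_of_det_comp_ne_zero {r : ℕ} {M : EuclideanSpace ℝ (Fin r) →L[ℝ] F}
    {π : F →L[ℝ] EuclideanSpace ℝ (Fin r)} (h : (π ∘L M).det ≠ 0) : Function.Injective M := by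
  have hu : IsUnit (LinearMap.det (π ∘L M).toLinearMap) := isUnit_iff_ne_zero.2 h
  have h2 := (LinearMap.equivOfDetNeZero _ h).injective
  intro a b hab
  apply h2
  change π (M a) = π (M b)
  rw [hab]

omit [FiniteDimensional ℝ F] in
theorem le_finrank_range_of_det_ne_zero {r : ℕ} {L : E →L[ℝ] F}
    {ι : EuclideanSpace ℝ (Fin r) →L[ℝ] E} {π : F →L[ℝ] EuclideanSpace ℝ (Fin r)}
    (h : (π ∘L L ∘L ι).det ≠ 0) : r ≤ Module.finrank ℝ (LinearMap.range L.toLinearMap) := by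
  have hinj : Function.Injective (L ∘L ι) := injective_of_det_comp_ne_zero h
  have h1 := LinearMap.finrank_range_of_inj (f := (L ∘L ι).toLinearMap) hinj
  have h2 : LinearMap.range (L ∘L ι).toLinearMap ≤ LinearMap.range L.toLinearMap := by
    rintro _ ⟨x, rfl⟩
    exact ⟨ι x, rfl⟩
  have h3 := Submodule.finrank_mono h2
  rw [h1, finrank_euclideanSpace_fin] at h3
  exact h3

omit [FiniteDimensional ℝ E] [FiniteDimensional ℝ F] in
theorem contDiff_det_comp {X : Type*} [NormedAddCommGroup X] [NormedSpace ℝ X] {r : ℕ}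
    {L : X → E →L[ℝ] F} (hL : ContDiff ℝ ω L)
    (ι : EuclideanSpace ℝ (Fin r) →L[ℝ] E) (π : F →L[ℝ] EuclideanSpace ℝ (Fin r)) :
    ContDiff ℝ ω fun x => (π ∘L L x ∘L ι).det := by
  let b := (EuclideanSpace.basisFun (Fin r) ℝ).toBasis
  have h (x : X) : (π ∘L L x ∘L ι).det
      = Matrix.det (Matrix.of fun i j => (π (L x (ι (b j)))) i) := by
    rw [ContinuousLinearMap.det, ← LinearMap.det_toMatrix b]
    congr 1
    ext i j
    simp [LinearMap.toMatrix_apply, b]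
  simp only [h, Matrix.det_apply]
  refine ContDiff.sum fun σ _ => ContDiff.const_smul _ (contDiff_prod fun i _ => ?_)
  have h1 : ContDiff ℝ ω fun x => π (L x (ι (b i))) :=
    π.contDiff.comp (hL.clm_apply contDiff_const)
  exact (EuclideanSpace.proj (𝕜 := ℝ) (σ i)).contDiff.comp h1

/-- Rank at least `r` at `t₁` is witnessed by a minor that equals `1` there. The same minor is
analytic in `t`, so it is nonzero almost everywhere. -/
theorem ae_le_finrank_range_fderiv {N r : ℕ} {f : EuclideanSpace ℝ (Fin N) → F}
    (hf : ContDiff ℝ ω f) {t₁ : EuclideanSpace ℝ (Fin N)}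
    (h : r ≤ Module.finrank ℝ (LinearMap.range (fderiv ℝ f t₁).toLinearMap)) :
    ∀ᵐ t, r ≤ Module.finrank ℝ (LinearMap.range (fderiv ℝ f t).toLinearMap) := by
  obtain ⟨ι, π, hid⟩ := exists_comp_comp_eq_id _ h
  have hdet : ContDiff ℝ ω fun t => (π ∘L fderiv ℝ f t ∘L ι).det :=
    contDiff_det_comp (hf.fderiv_right (by simp)) ι π
  have h1 : (π ∘L fderiv ℝ f t₁ ∘L ι).det ≠ 0 := by
    rw [hid, ContinuousLinearMap.det, ContinuousLinearMap.coe_id, LinearMap.det_id]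
    exact one_ne_zero
  filter_upwards [ae_ne_zero_of_contDiff hdet h1] with t ht
  exact le_finrank_range_of_det_ne_zero ht

omit [FiniteDimensional ℝ F] in
/-- The rank of a continuous family of linear maps is lower semicontinuous. -/
theorem eventually_le_finrank_range {X : Type*} [TopologicalSpace X] {r : ℕ}
    {L : X → E →L[ℝ] F} {x : X} (hL : ContinuousAt L x)
    (h : r ≤ Module.finrank ℝ (LinearMap.range (L x).toLinearMap)) :
    ∀ᶠ y in 𝓝 x, r ≤ Module.finrank ℝ (LinearMap.range (L y).toLinearMap) := by
  have key (M : E →L[ℝ] F) : (r : Cardinal) ≤ (M : E →ₗ[ℝ] F).rank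
      ↔ r ≤ Module.finrank ℝ (LinearMap.range M.toLinearMap) := by
    rw [LinearMap.rank, ← Module.finrank_eq_rank]
    exact Nat.cast_le
  have ho := isOpen_setOfPred_nat_le_rank (𝕜 := ℝ) (E := E) (F := F) r
  have := hL.preimage_mem_nhds (ho.mem_nhds ((key _).2 h))
  filter_upwards [this] with y hy
  exact (key _).1 hy

end Rank

section Bracket

variable {E F : Type*} [NormedAddCommGroup E] [NormedSpace ℝ E] [FiniteDimensional ℝ E]
  [NormedAddCommGroup F] [NormedSpace ℝ F] [FiniteDimensional ℝ F] {G : E → F}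

/-- A field tangent to an immersion lifts to the parameter space. -/
theorem exists_lift_of_tangent (hG : ContDiff ℝ ω G) {u : E}
    (hu : Function.Injective (fderiv ℝ G u)) {X : F → F} (hX : ContDiff ℝ ω X)
    (h : ∀ᶠ v in 𝓝 u, X (G v) ∈ LinearMap.range (fderiv ℝ G v).toLinearMap) :
    ∃ a : E → E, DifferentiableAt ℝ a u ∧ ∀ᶠ v in 𝓝 u, fderiv ℝ G v (a v) = X (G v) := by
  obtain ⟨π₀, hπ₀⟩ := (fderiv ℝ G u).toLinearMap.exists_leftInverse_of_injective
    (LinearMap.ker_eq_bot.2 hu)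
  let π : F →L[ℝ] E := π₀.toContinuousLinearMap
  have hπ : π ∘L fderiv ℝ G u = ((ContinuousLinearEquiv.refl ℝ E : E ≃L[ℝ] E) : E →L[ℝ] E) := by
    ext1 x
    exact congrArg (fun M => M x) hπ₀
  have hDG : ContDiff ℝ ω (fderiv ℝ G) := hG.fderiv_right (by simp)
  have hM : ContDiff ℝ ω fun v => π ∘L fderiv ℝ G v := contDiff_const.clm_comp hDG
  have hinv : ∀ᶠ v in 𝓝 u, (π ∘L fderiv ℝ G v).IsInvertible := by
    have := (ContinuousLinearEquiv.nhds (ContinuousLinearEquiv.refl ℝ E : E ≃L[ℝ] E))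
    rw [← hπ] at this
    filter_upwards [hM.continuous.continuousAt.preimage_mem_nhds this] with v hv
    exact hv
  -- Near `u` the map `π ∘ DG` is invertible, so a preimage of `X (G v)` under `DG v` is recovered
  -- from its image under `π`. This formula is differentiable in `v`.
  refine ⟨fun v => (π ∘L fderiv ℝ G v).inverse (π (X (G v))), ?_, ?_⟩
  · have h1 : ContDiffAt ℝ ω (fun v => (π ∘L fderiv ℝ G v).inverse) u := by
      refine ContDiffAt.comp u (g := ContinuousLinearMap.inverse) ?_ hM.contDiffAt
      rw [hπ]
      exact contDiffAt_map_inverse _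
    have h2 : ContDiff ℝ ω fun v => π (X (G v)) := π.contDiff.comp (hX.comp hG)
    exact (h1.clm_apply h2.contDiffAt).differentiableAt (by simp)
  · filter_upwards [hinv, h] with v hv hr
    obtain ⟨w, hw⟩ := hr
    have hw' : fderiv ℝ G v w = X (G v) := hw
    have : (π ∘L fderiv ℝ G v).inverse (π (X (G v))) = w := by
      rw [← hw']
      obtain ⟨e, he⟩ := hv
      have : π (fderiv ℝ G v w) = e w := by rw [← ContinuousLinearMap.comp_apply, ← he]; rfl
      rw [← he, ContinuousLinearMap.inverse_equiv, this]
      simp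
    rw [this, hw']

/-- The Lie bracket of fields tangent to an immersion is tangent to it. -/
theorem lieBracket_mem_range_fderiv (hG : ContDiff ℝ ω G) {u : E}
    (hu : Function.Injective (fderiv ℝ G u)) {X Y : F → F} (hX : ContDiff ℝ ω X)
    (hY : ContDiff ℝ ω Y)
    (hXG : ∀ᶠ v in 𝓝 u, X (G v) ∈ LinearMap.range (fderiv ℝ G v).toLinearMap)
    (hYG : ∀ᶠ v in 𝓝 u, Y (G v) ∈ LinearMap.range (fderiv ℝ G v).toLinearMap) :
    VectorField.lieBracket ℝ X Y (G u) ∈ LinearMap.range (fderiv ℝ G u).toLinearMap := by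
  obtain ⟨a, ha, haX⟩ := exists_lift_of_tangent hG hu hX hXG
  obtain ⟨b, hb, hbY⟩ := exists_lift_of_tangent hG hu hY hYG
  refine ⟨VectorField.lieBracket ℝ a b u, ?_⟩
  -- Second derivatives of `G` cancel by symmetry, so `DG` maps the bracket of the lifts to the
  -- difference of the derivatives of `Y ∘ G` along `a` and of `X ∘ G` along `b`, which is `[X, Y]`
  -- at `G u`.
  have h := VectorField.fderiv_apply_lieBracket (n := ω) (f := G) (x := u) hG.contDiffAt
    (by simp) hb ha
  have key {Z : F → F} (hZ : ContDiff ℝ ω Z) {c : E → E}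
      (hc : ∀ᶠ v in 𝓝 u, fderiv ℝ G v (c v) = Z (G v)) (w : E) :
      fderiv ℝ (fun v => fderiv ℝ G v (c v)) u w = fderiv ℝ Z (G u) (fderiv ℝ G u w) := by
    rw [EventuallyEq.fderiv_eq (f₁ := fun v => fderiv ℝ G v (c v)) (f := fun v => Z (G v)) hc]
    have := fderiv_comp u (hZ.differentiable (by simp) (G u)) (hG.differentiable (by simp) u)
    change (fderiv ℝ (Z ∘ G) u) w = _
    rw [this]
    rfl
  rw [key hX haX, key hY hbY, haX.self_of_nhds, hbY.self_of_nhds] at h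
  rw [VectorField.lieBracket_eq]
  exact h

end Bracket

section

variable {D n : ℕ} {V : Fin n → EuclideanSpace ℝ (Fin D) → EuclideanSpace ℝ (Fin D)}
  {x₀ : EuclideanSpace ℝ (Fin D)}

theorem contDiff_of_mem_lieAlgebra (hV : ∀ j, AnalyticOnNhd ℝ (V j) univ)
    {X : EuclideanSpace ℝ (Fin D) → EuclideanSpace ℝ (Fin D)} (hX : X ∈ lieAlgebra V) :
    ContDiff ℝ ω X := by
  let L : Submodule ℝ (EuclideanSpace ℝ (Fin D) → EuclideanSpace ℝ (Fin D)) :=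
    { carrier := {X | ContDiff ℝ ω X}
      add_mem' := fun {X Y} (hX : ContDiff ℝ ω X) (hY : ContDiff ℝ ω Y) => hX.add hY
      zero_mem' := (contDiff_const : ContDiff ℝ ω fun _ => (0 : EuclideanSpace ℝ (Fin D)))
      smul_mem' := fun c X (hX : ContDiff ℝ ω X) => hX.const_smul c }
  have : lieAlgebra V ≤ L := by
    refine sInf_le ⟨fun j => ?_, fun X hX Y hY => ?_⟩
    · exact (show ContDiff ℝ ω (V j) from (hV j).contDiff)
    · exact (show ContDiff ℝ ω X from hX).lieBracket_vectorField
        (show ContDiff ℝ ω Y from hY) (m := ω) (by simp)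
  exact this hX

/-- If the generators are tangent to an immersion, so is the Lie algebra they generate. -/
theorem mem_range_of_mem_lieAlgebra (hV : ∀ j, AnalyticOnNhd ℝ (V j) univ)
    {E : Type*} [NormedAddCommGroup E] [NormedSpace ℝ E] [FiniteDimensional ℝ E]
    {G : E → EuclideanSpace ℝ (Fin D)} (hG : ContDiff ℝ ω G) {u : E}
    (hu : Function.Injective (fderiv ℝ G u))
    (h : ∀ j, ∀ᶠ v in 𝓝 u, V j (G v) ∈ LinearMap.range (fderiv ℝ G v).toLinearMap)
    {X : EuclideanSpace ℝ (Fin D) → EuclideanSpace ℝ (Fin D)} (hX : X ∈ lieAlgebra V) :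
    X (G u) ∈ LinearMap.range (fderiv ℝ G u).toLinearMap := by
  have hinj : ∀ᶠ v in 𝓝 u, Function.Injective (fderiv ℝ G v) :=
    (hG.continuous_fderiv (by simp)).continuousAt.eventually
      (ContinuousLinearMap.isOpen_injective.mem_nhds hu)
  -- Tangency has to be required on a neighbourhood, not only at `u`, because the bracket
  -- differentiates the fields. In this form the condition is stable under brackets.
  let L : Submodule ℝ (EuclideanSpace ℝ (Fin D) → EuclideanSpace ℝ (Fin D)) :=
    { carrier := {X | ContDiff ℝ ω X ∧
        ∀ᶠ v in 𝓝 u, X (G v) ∈ LinearMap.range (fderiv ℝ G v).toLinearMap}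
      add_mem' := fun ha hb => ⟨ContDiff.add ha.1 hb.1, by
        filter_upwards [ha.2, hb.2] with v h1 h2
        exact Submodule.add_mem _ h1 h2⟩
      zero_mem' := ⟨contDiff_const, Eventually.of_forall fun v => Submodule.zero_mem _⟩
      smul_mem' := fun c _ ha => ⟨ContDiff.const_smul c ha.1, by
        filter_upwards [ha.2] with v h1
        exact Submodule.smul_mem _ c h1⟩ }
  have : lieAlgebra V ≤ L := by
    refine sInf_le ⟨fun j => ⟨(hV j).contDiff, h j⟩, fun X hX Y hY => ⟨?_, ?_⟩⟩
    · exact ContDiff.lieBracket_vectorField (n := ω) (m := ω) hX.1 hY.1 (by simp)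
    · filter_upwards [hinj, hX.2.eventually_nhds, hY.2.eventually_nhds] with v h1 h2 h3
      exact lieBracket_mem_range_fderiv hG h1 hX.1 hY.1 h2 h3
  exact (this hX).2.self_of_nhds

theorem steps_zero_times (hc : ∀ j, IsComplete (V j)) (m : ℕ) (x : EuclideanSpace ℝ (Fin D)) :
    steps V m x (fun _ => 0) = x := by
  have h : ∀ x, step V x (fun _ => 0) = x := fun x =>
    List.foldl_fixed' (fun j => flow_zero (hc j) x) _
  exact List.foldl_fixed' (fun _ => h x) _

theorem isReach_timeMap (m : ℕ) (h : ℝ) (x : Orbit V x₀) : IsReach (x.timeMap m h) :=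
  (isReach_const x).steps (contDiff_pi.2 fun k => contDiff_const.mul
    ((EuclideanSpace.proj (𝕜 := ℝ) k).contDiff))

variable (hc : ∀ j, IsComplete (V j)) (hV : ∀ j, AnalyticOnNhd ℝ (V j) univ)
include hc hV

theorem contDiff_timeMap (m : ℕ) (h : ℝ) (x : Orbit V x₀) :
    ContDiff ℝ ω fun t => (x.timeMap m h t).1 :=
  (isReach_timeMap m h x).contDiff hc hV

theorem range_timeDeriv_le (m : ℕ) (h : ℝ) (x : Orbit V x₀) (t : EuclideanSpace ℝ (Fin (m * n))) :
    LinearMap.range (timeDeriv m h x t).toLinearMap ≤ tangentSpace (x.timeMap m h t) := by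
  rintro _ ⟨v, rfl⟩
  exact (isReach_timeMap m h x).fderiv_mem_tangentSpace hc hV t v

/-- At times where `t ↦ Φ^m(x, t)` has the largest rank among all `m`, the fields are tangent to
its image. -/
theorem mem_range_fderiv_of_maximal {r m : ℕ} (x : Orbit V x₀)
    (hmax : ∀ t : EuclideanSpace ℝ (Fin ((m + 1) * n)),
      Module.finrank ℝ (LinearMap.range (timeDeriv (m + 1) 1 x t).toLinearMap) ≤ r)
    {E : Type*} [NormedAddCommGroup E] [NormedSpace ℝ E] [FiniteDimensional ℝ E]
    {a : E → EuclideanSpace ℝ (Fin (m * n))} (ha : ContDiff ℝ ω a) (u : E)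
    (hr : r ≤ Module.finrank ℝ
      (LinearMap.range (fderiv ℝ (fun u => (x.timeMap m 1 (a u)).1) u).toLinearMap)) (j : Fin n) :
    V j (x.timeMap m 1 (a u)).1
      ∈ LinearMap.range (fderiv ℝ (fun u => (x.timeMap m 1 (a u)).1) u).toLinearMap := by
  set G : E → EuclideanSpace ℝ (Fin D) := fun u => (x.timeMap m 1 (a u)).1
  have hG : ContDiff ℝ ω G := (contDiff_timeMap hc hV m 1 x).comp ha
  -- `B` appends a flow of `V j` to `G`, so it factors through `m + 1` steps and has rank at most
  -- `r`. Its range contains that of `DG`, which has rank at least `r`; the two agree, and the time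
  -- derivative `V j (G u)` of `B` lies in them.
  let B : E × ℝ → EuclideanSpace ℝ (Fin D) := fun p => flow (V j) p.2 (G p.1)
  have hB : ContDiff ℝ ω B :=
    (contDiff_flow (hV j) (hc j)).comp (contDiff_snd.prodMk (hG.comp contDiff_fst))
  let b : E × ℝ → EuclideanSpace ℝ (Fin ((m + 1) * n)) := fun p =>
    WithLp.toLp 2 (snocTimes (WithLp.ofLp (a p.1)) (Pi.single j p.2))
  have hb : ContDiff ℝ ω b := by
    refine PiLp.contDiff_toLp.comp (contDiff_snocTimes ?_ ?_)
    · exact PiLp.contDiff_ofLp.comp (ha.comp contDiff_fst)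
    · refine contDiff_pi.2 fun i => ?_
      by_cases h : i = j
      · subst h; simpa using contDiff_snd
      · simpa [h] using contDiff_const
  have hBb : ∀ p, B p = (x.timeMap (m + 1) 1 (b p)).1 := fun p => by
    simp only [B, G, Orbit.timeMap, Orbit.steps, b, one_mul]
    rw [← step_single hc, ← steps_snocTimes]
  have hrange : LinearMap.range (fderiv ℝ B (u, 0)).toLinearMap
      ≤ LinearMap.range (timeDeriv (m + 1) 1 x (b (u, 0))).toLinearMap := by
    have h1 : HasFDerivAt B ((timeDeriv (m + 1) 1 x (b (u, 0))) ∘L fderiv ℝ b (u, 0)) (u, 0) := by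
      have h2 := ((contDiff_timeMap hc hV (m + 1) 1 x).differentiable (by simp)
        (b (u, 0))).hasFDerivAt
      have h3 := h2.comp (u, (0 : ℝ)) ((hb.differentiable (by simp)) (u, 0)).hasFDerivAt
      exact h3.congr_of_eventuallyEq (Eventually.of_forall hBb)
    rw [h1.fderiv]
    rintro _ ⟨v, rfl⟩
    exact ⟨_, rfl⟩
  have hle := (Submodule.finrank_mono hrange).trans (hmax _)
  have hBd : HasFDerivAt B (fderiv ℝ B (u, 0)) (u, 0) :=
    ((hB.differentiable (by simp)) (u, 0)).hasFDerivAt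
  have hGB : fderiv ℝ G u = fderiv ℝ B (u, 0) ∘L .inl ℝ E ℝ := by
    have h1 := HasFDerivAt.comp (g := B) u hBd (hasFDerivAt_prodMk_left (𝕜 := ℝ) u (0 : ℝ))
    have h2 : B ∘ (fun e => (e, (0 : ℝ))) = G := by
      ext1 e
      simp [B, flow_zero (hc j)]
    rw [h2] at h1
    exact h1.fderiv
  have hGr : LinearMap.range (fderiv ℝ G u).toLinearMap
      ≤ LinearMap.range (fderiv ℝ B (u, 0)).toLinearMap := by
    rw [hGB]
    rintro _ ⟨v, rfl⟩
    exact ⟨_, rfl⟩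
  have heq := Submodule.eq_of_le_of_finrank_le hGr (hle.trans hr)
  rw [heq]
  refine ⟨(0, 1), ?_⟩
  have h1 : HasDerivAt (fun s : ℝ => B (u, s)) (fderiv ℝ B (u, 0) (0, 1)) 0 := by
    have h2 : HasDerivAt (fun s : ℝ => (u, s)) ((0 : E), (1 : ℝ)) 0 :=
      (hasDerivAt_const (0 : ℝ) u).prodMk (hasDerivAt_id (0 : ℝ))
    exact hBd.comp_hasDerivAt (0 : ℝ) h2
  have h3 := hasDerivAt_flow (hc j) (G u) 0
  rw [flow_zero (hc j)] at h3
  exact h1.unique h3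

/-- Under the Lie bracket condition at `x`, some `t ↦ Φ^m(x, t)` has rank at least the dimension
of the orbit somewhere. -/
theorem exists_le_finrank_range_timeDeriv (x : Orbit V x₀) (hL : LieBracketCondition x) :
    ∃ (m : ℕ) (t : EuclideanSpace ℝ (Fin (m * n))), 0 < m ∧ Module.finrank ℝ (tangentSpace x) ≤
      Module.finrank ℝ (LinearMap.range (timeDeriv m 1 x t).toLinearMap) := by
  -- The ranks are bounded by `D`, so a largest one `r` is attained. Maximality over all `m`, and
  -- not just one, is what bounds the rank after an additional step.
  let S : Set ℕ := {r | ∃ (m : ℕ) (t : EuclideanSpace ℝ (Fin (m * n))), 0 < m ∧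
    Module.finrank ℝ (LinearMap.range (timeDeriv m 1 x t).toLinearMap) = r}
  have hSb : BddAbove S := by
    use D
    rintro _ ⟨m, t, -, rfl⟩
    exact (Submodule.finrank_le _).trans finrank_euclideanSpace_fin.le
  have hSn : S.Nonempty := ⟨_, 1, 0, one_pos, rfl⟩
  obtain ⟨r, ⟨m, t₁, hm, hr⟩, hrmax⟩ : ∃ r ∈ S, ∀ r' ∈ S, r' ≤ r :=
    ⟨sSup S, Nat.sSup_mem hSn hSb, fun r' h => le_csSup hSb h⟩
  suffices hle : Module.finrank ℝ (lieAt V x.1) ≤ r by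
    rw [hL] at hle
    exact ⟨m, t₁, hm, hle.trans hr.ge⟩
  have hmax : ∀ t : EuclideanSpace ℝ (Fin ((m + 1) * n)),
      Module.finrank ℝ (LinearMap.range (timeDeriv (m + 1) 1 x t).toLinearMap) ≤ r :=
    fun t => hrmax _ ⟨m + 1, t, m.succ_pos, rfl⟩
  -- independent fields near `x`
  obtain ⟨v, hv⟩ := exists_linearIndependent_of_le_finrank
    (le_refl (Module.finrank ℝ (lieAt V x.1)))
  have hv' := hv.map' (lieAt V x.1).subtype (Submodule.ker_subtype _)
  choose X hX hXv using fun i => (v i).2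
  have hXv' : (fun i => X i x.1) = fun i => (v i : EuclideanSpace ℝ (Fin D)) :=
    funext fun i => hXv i
  have hF : Continuous fun t => (x.timeMap m 1 t).1 := (contDiff_timeMap hc hV m 1 x).continuous
  have hF0 : (x.timeMap m 1 0).1 = x.1 := by
    simpa [Orbit.timeMap, Orbit.steps] using! steps_zero_times hc m x.1
  have hind : ∀ᶠ t in 𝓝 (0 : EuclideanSpace ℝ (Fin (m * n))),
      LinearIndependent ℝ fun i => X i (x.timeMap m 1 t).1 := by
    have hcont : Continuous fun t => fun i => X i (x.timeMap m 1 t).1 :=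
      continuous_pi fun i => (contDiff_of_mem_lieAlgebra hV (hX i)).continuous.comp hF
    have h0 : LinearIndependent ℝ fun i => X i (x.timeMap m 1 0).1 := by
      rw [hF0, hXv']
      exact hv'
    exact (hcont.tendsto 0).eventually (LinearIndependent.eventually h0)
  -- Almost every time, hence a dense set of times, has rank `r`. Such a time exists near `0`, where
  -- the chosen fields remain independent along `Φ^m(x, ·)`.
  have hdense := (ae_le_finrank_range_fderiv (contDiff_timeMap hc hV m 1 x) hr.ge)
  have hfreq : ∃ t, LinearIndependent ℝ (fun i => X i (x.timeMap m 1 t).1) ∧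
      r ≤ Module.finrank ℝ (LinearMap.range (timeDeriv m 1 x t).toLinearMap) := by
    obtain ⟨t, h1, h2⟩ := (Measure.dense_of_ae hdense).inter_nhds_nonempty hind
    exact ⟨t, h2, h1⟩
  obtain ⟨t₀, hind₀, hr₀⟩ := hfreq
  -- Restriction to an `r`-dimensional slice through `t₀` makes the map an immersion without loss of
  -- rank. All the independent fields are tangent to it, so there are at most `r` of them.
  obtain ⟨ι, π, hid⟩ := exists_comp_comp_eq_id _ hr₀
  let a : EuclideanSpace ℝ (Fin r) → EuclideanSpace ℝ (Fin (m * n)) := fun u => t₀ + ι u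
  have ha : ContDiff ℝ ω a := contDiff_const.add ι.contDiff
  let G : EuclideanSpace ℝ (Fin r) → EuclideanSpace ℝ (Fin D) := fun u => (x.timeMap m 1 (a u)).1
  have hG : ContDiff ℝ ω G := (contDiff_timeMap hc hV m 1 x).comp ha
  have ha0 : a 0 = t₀ := by simp [a]
  have hGd : fderiv ℝ G 0 = timeDeriv m 1 x t₀ ∘L ι := by
    have h1 : HasFDerivAt a ι 0 := ι.hasFDerivAt.const_add t₀
    have h2 := ((contDiff_timeMap hc hV m 1 x).differentiable (by simp) (a 0)).hasFDerivAt
    have h3 := (h2.comp (0 : EuclideanSpace ℝ (Fin r)) h1).fderiv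
    rw [ha0] at h3
    exact h3
  have hdet : (π ∘L fderiv ℝ G 0).det ≠ 0 := by
    rw [hGd, hid, ContinuousLinearMap.det, ContinuousLinearMap.coe_id, LinearMap.det_id]
    exact one_ne_zero
  have hinj : Function.Injective (fderiv ℝ G 0) := injective_of_det_comp_ne_zero hdet
  have hrG : r ≤ Module.finrank ℝ (LinearMap.range (fderiv ℝ G 0).toLinearMap) := by
    rw [LinearMap.finrank_range_of_inj hinj]; simp
  have hev := eventually_le_finrank_range (hG.continuous_fderiv (by simp)).continuousAt hrG
  have hmem : ∀ i, X i (G 0) ∈ LinearMap.range (fderiv ℝ G 0).toLinearMap := fun i =>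
    mem_range_of_mem_lieAlgebra hV hG hinj
      (fun j => hev.mono fun u hu => mem_range_fderiv_of_maximal hc hV x hmax ha u hu j) (hX i)
  have hind₁ : LinearIndependent ℝ fun i => X i (G 0) := by
    simpa only [G, ha0] using hind₀
  have hcard := (LinearIndependent.of_comp (LinearMap.range (fderiv ℝ G 0).toLinearMap).subtype
    (v := fun i => (⟨X i (G 0), hmem i⟩ : LinearMap.range (fderiv ℝ G 0).toLinearMap))
    hind₁).fintype_card_le_finrank
  rw [LinearMap.finrank_range_of_inj hinj] at hcard
  simp only [Fintype.card_fin, finrank_euclideanSpace_fin] at hcard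
  exact hcard

end

end RandomSplitting

end

/-! ### The constant rank theorem and charts of the orbit. -/

noncomputable section

open Filter Metric
open scoped Topology ContDiff

namespace RandomSplitting

section ConstantRank

variable {E F H : Type*} [NormedAddCommGroup E] [NormedSpace ℝ E] [FiniteDimensional ℝ E]
  [NormedAddCommGroup F] [NormedSpace ℝ F] [FiniteDimensional ℝ F]
  [NormedAddCommGroup H] [NormedSpace ℝ H] [FiniteDimensional ℝ H]

omit [FiniteDimensional ℝ E] [FiniteDimensional ℝ F] [FiniteDimensional ℝ H] in
theorem eventually_isInvertible [CompleteSpace F] {X : Type*} [TopologicalSpace X]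
    {L : X → F →L[ℝ] F} {x : X} (hL : ContinuousAt L x) (h : (L x).IsInvertible) :
    ∀ᶠ y in 𝓝 x, (L y).IsInvertible := by
  obtain ⟨e, he⟩ := h
  have := ContinuousLinearEquiv.nhds e
  rw [he] at this
  exact hL.eventually this

omit [FiniteDimensional ℝ E] in
/-- A map on a product whose rank is at most the dimension of the second factor, and which is an
immersion along that factor, locally has the same image as its restriction to a slice. -/
theorem eventually_exists_slice [CompleteSpace E] {C : E × F → H} (hC : ContDiff ℝ ω C)
    (π : H →L[ℝ] F) {e₀ : E} {f₀ : F}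
    (hinv : (π ∘L fderiv ℝ C (e₀, f₀) ∘L .inr ℝ E F).IsInvertible)
    (hrank : ∀ p, Module.finrank ℝ (LinearMap.range (fderiv ℝ C p).toLinearMap)
      ≤ Module.finrank ℝ F) {N : Set F} (hN : N ∈ 𝓝 f₀) :
    ∀ᶠ p in 𝓝 (e₀, f₀), ∃ f ∈ N, C p = C (e₀, f) := by
  -- The equation `g = 0` reads `π (C (e, f)) = p`. Its solution `f = υ (e, p)` replaces `f` by the
  -- coordinate `p`.
  let g : (E × F) × F → F := fun v => π (C (v.1.1, v.2)) - v.1.2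
  let p₀ : F := π (C (e₀, f₀))
  let u₀ : (E × F) × F := ((e₀, p₀), f₀)
  have hin : ContDiff ℝ ω fun v : (E × F) × F => C (v.1.1, v.2) :=
    hC.comp ((contDiff_fst.comp contDiff_fst).prodMk contDiff_snd)
  have hg : ContDiff ℝ ω g := (π.contDiff.comp hin).sub (contDiff_snd.comp contDiff_fst)
  have hCd (p : E × F) : HasFDerivAt C (fderiv ℝ C p) p :=
    (hC.differentiable (by simp) p).hasFDerivAt
  have hgi : (fderiv ℝ g u₀ ∘L .inr ℝ (E × F) F).IsInvertible := by
    have h1 : HasFDerivAt (fun f => g ((e₀, p₀), f)) (fderiv ℝ g u₀ ∘L .inr ℝ (E × F) F) f₀ :=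
      HasFDerivAt.comp (g := g) f₀ (hg.differentiable (by simp) u₀).hasFDerivAt
        (hasFDerivAt_prodMk_right (𝕜 := ℝ) (e₀, p₀) f₀)
    have h2 : HasFDerivAt (fun f => g ((e₀, p₀), f))
        (π ∘L fderiv ℝ C (e₀, f₀) ∘L .inr ℝ E F) f₀ := by
      have h3 := HasFDerivAt.comp (g := C) f₀ (hCd (e₀, f₀))
        (hasFDerivAt_prodMk_right (𝕜 := ℝ) e₀ f₀)
      exact (π.hasFDerivAt.comp f₀ h3).sub_const p₀
    rw [h1.unique h2]
    exact hinv
  have hgu : g u₀ = 0 := by simp [g, u₀, p₀]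
  let υ := hg.contDiffAt.implicitFunction (u := u₀) (by simp) hgi
  have hυ0 : υ (e₀, p₀) = f₀ := hg.contDiffAt.implicitFunction_apply_self (u := u₀) (by simp) hgi
  have hυc : ContDiffAt ℝ ω υ (e₀, p₀) :=
    hg.contDiffAt.contDiffAt_implicitFunction (u := u₀) (by simp) hgi
  have hυ1 : ∀ᶠ q in 𝓝 (e₀, p₀), π (C (q.1, υ q)) = q.2 := by
    have := hg.contDiffAt.eventually_apply_implicitFunction (u := u₀) (by simp) hgi
    rw [hgu] at this
    filter_upwards [this] with q hq
    exact sub_eq_zero.1 hq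
  have hυ2 : ∀ᶠ v in 𝓝 u₀, π (C (v.1.1, v.2)) = v.1.2 → υ v.1 = v.2 := by
    have := hg.contDiffAt.eventually_apply_eq_iff_implicitFunction (u := u₀) (by simp) hgi
    rw [hgu] at this
    filter_upwards [this] with v hv h
    exact hv.1 (sub_eq_zero.2 h)
  let c : E × F → H := fun q => C (q.1, υ q)
  -- the derivative of `c` along the first factor vanishes
  have hDC : ContinuousAt (fun p => π ∘L fderiv ℝ C p ∘L .inr ℝ E F) (e₀, f₀) :=
    (continuous_const.clm_comp ((hC.continuous_fderiv (by simp)).clm_comp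
      continuous_const)).continuousAt
  have hυt : Tendsto (fun q : E × F => (q.1, υ q)) (𝓝 (e₀, p₀)) (𝓝 (e₀, f₀)) := by
    have : ContinuousAt (fun q : E × F => (q.1, υ q)) (e₀, p₀) :=
      continuousAt_fst.prodMk hυc.continuousAt
    simpa only [ContinuousAt, hυ0] using this
  have hder : ∀ᶠ q in 𝓝 (e₀, p₀), DifferentiableAt ℝ c q ∧ fderiv ℝ c q ∘L .inl ℝ E F = 0 := by
    filter_upwards [hυc.eventually (by simp), hυ1.eventually_nhds,
      hυt.eventually (eventually_isInvertible hDC hinv)] with q h1 h2 h3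
    have hυd : HasFDerivAt υ (fderiv ℝ υ q) q := (h1.differentiableAt (by simp)).hasFDerivAt
    have hcd : HasFDerivAt c (fderiv ℝ C (q.1, υ q) ∘L
        ((ContinuousLinearMap.fst ℝ E F).prod (fderiv ℝ υ q))) q :=
      HasFDerivAt.comp (g := C) q (hCd _) (hasFDerivAt_fst.prodMk hυd)
    refine ⟨hcd.differentiableAt, ?_⟩
    have hπc : π ∘L fderiv ℝ c q = .snd ℝ E F := by
      have h4 := π.hasFDerivAt.comp q (hcd.differentiableAt.hasFDerivAt)
      exact (h4.congr_of_eventuallyEq (h2.mono fun q' hq' => hq'.symm)).unique hasFDerivAt_snd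
    ext1 w
    set R := LinearMap.range (fderiv ℝ C (q.1, υ q)).toLinearMap
    have hmem : fderiv ℝ c q (w, 0) ∈ R := by
      rw [hcd.fderiv]; exact ⟨_, rfl⟩
    -- `π` is injective on `R`
    have hinjR : Function.Injective (π.toLinearMap ∘ₗ R.subtype) := by
      have hsurj : Function.Surjective (π.toLinearMap ∘ₗ R.subtype) := by
        intro f
        obtain ⟨f', hf'⟩ := h3.surjective f
        exact ⟨⟨fderiv ℝ C (q.1, υ q) (0, f'), ⟨_, rfl⟩⟩, hf'⟩
      have hfr : Module.finrank ℝ R = Module.finrank ℝ F := by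
        refine le_antisymm (hrank _) ?_
        have := LinearMap.finrank_range_le (π.toLinearMap ∘ₗ R.subtype)
        rwa [LinearMap.range_eq_top.2 hsurj, finrank_top] at this
      exact (LinearMap.injective_iff_surjective_of_finrank_eq_finrank hfr).2 hsurj
    have h5 : π (fderiv ℝ c q (w, 0)) = 0 := by
      rw [← ContinuousLinearMap.comp_apply, hπc]; rfl
    have h6 : (⟨fderiv ℝ c q (w, 0), hmem⟩ : R) = 0 := by
      apply hinjR
      simpa using h5
    simpa using congrArg Subtype.val h6
  obtain ⟨δ, hδ, hball⟩ := Metric.eventually_nhds_iff_ball.1 hder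
  -- Balls are convex, so vanishing of the derivative in `e` makes `c` independent of `e`.
  have hconst : ∀ e ∈ ball e₀ δ, ∀ p ∈ ball p₀ δ, c (e, p) = c (e₀, p) := by
    intro e he p hp
    have hb : ∀ e' ∈ ball e₀ δ, (e', p) ∈ ball (e₀, p₀) δ := fun e' he' => by
      rw [← ball_prod_same]; exact ⟨he', hp⟩
    have hd : ∀ e' ∈ ball e₀ δ, HasFDerivAt (fun e' => c (e', p)) (0 : E →L[ℝ] H) e' := by
      intro e' he'
      obtain ⟨h1, h2⟩ := hball _ (hb e' he')
      have := HasFDerivAt.comp (g := c) e' h1.hasFDerivAt (hasFDerivAt_prodMk_left (𝕜 := ℝ) e' p)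
      rwa [h2] at this
    exact (convex_ball e₀ δ).is_const_of_fderivWithin_eq_zero (𝕜 := ℝ)
      (fun e' he' => (hd e' he').differentiableAt.differentiableWithinAt)
      (fun e' he' => by
        rw [fderivWithin_of_isOpen isOpen_ball he', (hd e' he').fderiv])
      he (mem_ball_self hδ)
  have hp : Tendsto (fun v : E × F => π (C v)) (𝓝 (e₀, f₀)) (𝓝 p₀) :=
    (π.continuous.comp hC.continuous).continuousAt
  have hq : Tendsto (fun v : E × F => ((v.1, π (C v)), v.2)) (𝓝 (e₀, f₀)) (𝓝 u₀) :=
    (continuousAt_fst.prodMk hp).prodMk continuousAt_snd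
  have hq0 : Tendsto (fun v : E × F => υ (e₀, π (C v))) (𝓝 (e₀, f₀)) (𝓝 f₀) := by
    have h1 : Tendsto (fun v : E × F => (e₀, π (C v))) (𝓝 (e₀, f₀)) (𝓝 (e₀, p₀)) :=
      tendsto_const_nhds.prodMk_nhds hp
    have h2 := hυc.continuousAt.tendsto.comp h1
    rwa [hυ0] at h2
  filter_upwards [hq.eventually hυ2, hp.eventually (ball_mem_nhds _ hδ), hq0.eventually hN,
    continuousAt_fst.eventually (ball_mem_nhds e₀ hδ)] with v h1 h2 h3 h4
  -- The witness is `υ (e₀, π (C v))`, the point of the slice over `e₀` with the same `π`-coordinate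
  -- as `C v`.
  refine ⟨_, h3, ?_⟩
  have h5 := hconst v.1 h4 _ h2
  simp only [c] at h5
  rw [h1 rfl] at h5
  exact h5

end ConstantRank

section Chart

variable {D n : ℕ} {V : Fin n → EuclideanSpace ℝ (Fin D) → EuclideanSpace ℝ (Fin D)}
  {x₀ : EuclideanSpace ℝ (Fin D)}

/-- A local parametrization `σ : O → X` of the orbit by an open set `O` of `ℝ^d`, inverse to a
linear map `π`, such that analytic families of points factor through it. -/
structure IsChart {d : ℕ} (π : EuclideanSpace ℝ (Fin D) →L[ℝ] EuclideanSpace ℝ (Fin d))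
    (O : Set (EuclideanSpace ℝ (Fin d))) (σ : EuclideanSpace ℝ (Fin d) → Orbit V x₀) : Prop where
  isOpen : IsOpen O
  continuousOn : ContinuousOn σ O
  contDiffOn : ContDiffOn ℝ 1 (fun p => (σ p).1) O
  leftInv : ∀ p ∈ O, π (σ p).1 = p
  eventually_factor : ∀ {E : Type} [NormedAddCommGroup E] [NormedSpace ℝ E]
    [FiniteDimensional ℝ E] {A : E → Orbit V x₀}, IsReach A → ∀ e, A e ∈ σ '' O →
      ∀ᶠ e' in 𝓝 e, π (A e').1 ∈ O ∧ A e' = σ (π (A e').1)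

/-- Openness in the orbit topology is tested on the families `t ↦ Φ^k(x₀, t)`, and these factor
through the chart near each time that is mapped into it. -/
theorem IsChart.isOpen_image {d : ℕ} {π : EuclideanSpace ℝ (Fin D) →L[ℝ] EuclideanSpace ℝ (Fin d)}
    {O : Set (EuclideanSpace ℝ (Fin d))} {σ : EuclideanSpace ℝ (Fin d) → Orbit V x₀}
    (h : IsChart π O σ) : IsOpen (σ '' O) := by
  refine isOpen_orbit_iff.2 fun k => isOpen_iff_mem_nhds.2 fun t ht => ?_
  filter_upwards [h.eventually_factor (isReach_base k) t ht] with t' ht'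
  exact ⟨_, ht'.1, ht'.2.symm⟩

variable (hc : ∀ j, IsComplete (V j)) (hV : ∀ j, AnalyticOnNhd ℝ (V j) univ)
include hc hV

/-- If the orbit has an immersed `d`-dimensional family at one point, it has one at each. -/
theorem exists_reach_immersion {d : ℕ} {G₁ : EuclideanSpace ℝ (Fin d) → Orbit V x₀}
    (hG₁ : IsReach G₁) (hi : Function.Injective (fderiv ℝ (fun u => (G₁ u).1) 0)) (y : Orbit V x₀) :
    ∃ G : EuclideanSpace ℝ (Fin d) → Orbit V x₀, IsReach G ∧ G 0 = y ∧
      Function.Injective (fderiv ℝ (fun u => (G u).1) 0) := by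
  let P : Orbit V x₀ → Prop := fun y => ∃ G : EuclideanSpace ℝ (Fin d) → Orbit V x₀,
    IsReach G ∧ G 0 = y ∧ Function.Injective (fderiv ℝ (fun u => (G u).1) 0)
  have hflow : ∀ y j s, P y → P (y.flow j s) := by
    rintro _ j s ⟨G, hG, rfl, hGi⟩
    refine ⟨fun u => (G u).flow j s, hG.flow j contDiff_const, rfl, ?_⟩
    have hG' := hG.flow j (s := fun _ => s) contDiff_const
    -- undo the flow
    have hback : ∀ u, (G u).1 = RandomSplitting.flow (V j) (-s) ((G u).flow j s).1 := fun u => by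
      rw [Orbit.flow_val hc, flow_neg_flow (hV j).contDiff (hc j)]
    have hφ : ContDiff ℝ ω (fun x => RandomSplitting.flow (V j) (-s) x) :=
      (contDiff_flow (hV j) (hc j)).comp (f := fun x => (-s, x)) (contDiff_const.prodMk contDiff_id)
    have h1 := (hφ.differentiable (by simp) ((G 0).flow j s).1).hasFDerivAt.comp
      (0 : EuclideanSpace ℝ (Fin d)) ((hG'.contDiff hc hV).differentiable (by simp) 0).hasFDerivAt
    have h2 : ((fun x => RandomSplitting.flow (V j) (-s) x) ∘ fun u => ((G u).flow j s).1)
        = fun u => (G u).1 := funext fun u => (hback u).symm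
    rw [h2] at h1
    rw [h1.fderiv] at hGi
    exact Function.Injective.of_comp hGi
  have hiff : ∀ y, P y ↔ P ⟨x₀, 0, fun _ => 0, rfl⟩ := by
    refine Orbit.induction hc Iff.rfl fun y j s h => ?_
    rw [← h]
    refine ⟨fun h' => ?_, hflow y j s⟩
    have := hflow _ j (-s) h'
    rwa [Orbit.flow_neg_flow hc hV] at this
  exact (hiff y).2 ((hiff (G₁ 0)).1 ⟨G₁, hG₁, rfl, hi⟩)

/-- With `π` a left inverse of `DG(0)`, the map `π ∘ G` is a local diffeomorphism at `0`, and `σ` is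
`G` composed with its inverse. The factorization of other families is the constant rank theorem, as
no family has rank above `d`. -/
theorem exists_chart {d : ℕ} (hd : ∀ y : Orbit V x₀, Module.finrank ℝ (tangentSpace y) = d)
    {G : EuclideanSpace ℝ (Fin d) → Orbit V x₀} (hG : IsReach G)
    (hi : Function.Injective (fderiv ℝ (fun u => (G u).1) 0)) :
    ∃ (π : EuclideanSpace ℝ (Fin D) →L[ℝ] EuclideanSpace ℝ (Fin d))
      (O : Set (EuclideanSpace ℝ (Fin d))) (σ : EuclideanSpace ℝ (Fin d) → Orbit V x₀),
      IsChart π O σ ∧ G 0 ∈ σ '' O := by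
  set g : EuclideanSpace ℝ (Fin d) → EuclideanSpace ℝ (Fin D) := fun u => (G u).1
  have hg : ContDiff ℝ ω g := hG.contDiff hc hV
  obtain ⟨π₀, hπ₀⟩ := (fderiv ℝ g 0).toLinearMap.exists_leftInverse_of_injective
    (LinearMap.ker_eq_bot.2 hi)
  let π : EuclideanSpace ℝ (Fin D) →L[ℝ] EuclideanSpace ℝ (Fin d) := π₀.toContinuousLinearMap
  have hπg : ContDiff ℝ ω fun u => π (g u) := π.contDiff.comp hg
  have hπd (u : EuclideanSpace ℝ (Fin d)) :
      HasFDerivAt (fun u => π (g u)) (π ∘L fderiv ℝ g u) u :=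
    π.hasFDerivAt.comp u (hg.differentiable (by simp) u).hasFDerivAt
  have hπ : π ∘L fderiv ℝ g 0 = .id ℝ _ := by
    ext1 x
    exact congrArg (fun M => M x) hπ₀
  have h0 : HasFDerivAt (fun u => π (g u))
      ((ContinuousLinearEquiv.refl ℝ (EuclideanSpace ℝ (Fin d)) :
        EuclideanSpace ℝ (Fin d) →L[ℝ] EuclideanSpace ℝ (Fin d))) 0 := by
    have := hπd 0
    rwa [hπ] at this
  have hinv0 : ∀ᶠ u in 𝓝 (0 : EuclideanSpace ℝ (Fin d)), (π ∘L fderiv ℝ g u).IsInvertible := by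
    refine eventually_isInvertible
      (continuous_const.clm_comp (hg.continuous_fderiv (by simp))).continuousAt ?_
    rw [hπ]
    exact ⟨.refl ℝ _, rfl⟩
  -- Shrinking to `N` keeps `π ∘ DG` invertible at every point of the source, which both the
  -- smoothness of the inverse and the factorization at arbitrary points need.
  obtain ⟨N, hNs, hNo, hN0⟩ := _root_.mem_nhds_iff.1 hinv0
  let e₁ := hπg.contDiffAt.toOpenPartialHomeomorph (fun u => π (g u)) h0 (by simp)
  have he₁ : (e₁ : EuclideanSpace ℝ (Fin d) → EuclideanSpace ℝ (Fin d)) = fun u => π (g u) :=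
    ContDiffAt.toOpenPartialHomeomorph_coe hπg.contDiffAt h0 (by simp)
  have hmem₁ : (0 : EuclideanSpace ℝ (Fin d)) ∈ e₁.source :=
    hπg.contDiffAt.mem_toOpenPartialHomeomorph_source h0 (by simp)
  let e := e₁.restrOpen N hNo
  have he (u) : e u = π (g u) := congrFun he₁ u
  have hes : e.source = e₁.source ∩ N := rfl
  have hmem : (0 : EuclideanSpace ℝ (Fin d)) ∈ e.source := ⟨hmem₁, hN0⟩
  have hsymm : ContDiffOn ℝ 1 e.symm e.target := by
    intro p hp
    have hps := e.map_target hp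
    have hiv : (π ∘L fderiv ℝ g (e.symm p)).IsInvertible := hNs (hes ▸ hps).2
    obtain ⟨L, hL⟩ := hiv
    have h1 : HasFDerivAt e (L : EuclideanSpace ℝ (Fin d) →L[ℝ] EuclideanSpace ℝ (Fin d))
        (e.symm p) := by
      rw [hL]
      exact (hπd (e.symm p)).congr_of_eventuallyEq (Eventually.of_forall he)
    have h2 : ContDiffAt ℝ 1 e (e.symm p) :=
      (hπg.of_le (by simp)).contDiffAt.congr_of_eventuallyEq (Eventually.of_forall he)
    exact (e.contDiffAt_symm hp h1 h2).contDiffWithinAt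
  refine ⟨π, e.target, fun p => G (e.symm p), ⟨e.open_target, ?_, ?_, ?_, ?_⟩, ?_⟩
  · exact hG.continuous.comp_continuousOn e.continuousOn_symm
  · exact (hg.of_le (by simp)).comp_contDiffOn hsymm
  · intro p hp
    change π (g (e.symm p)) = p
    rw [← he, e.right_inv hp]
  · intro E _ _ _ A hA t₀ ht₀
    obtain ⟨p, hp, hpA⟩ := ht₀
    set u₀ := e.symm p
    have hu₀ : u₀ ∈ e.source := e.map_target hp
    -- Joining `A` and `G` into one family on the product puts them into the setting of
    -- `eventually_exists_slice`: values of `A` near `t₀` are then values of `G` near `u₀`.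
    obtain ⟨C, hC, hCA, hCG⟩ := hA.exists_join hc hV hG (e₀ := t₀) (f₀ := u₀) hpA.symm
    have hCd := hC.contDiff hc hV
    have hfd : fderiv ℝ (fun q => (C q).1) (t₀, u₀) ∘L .inr ℝ E (EuclideanSpace ℝ (Fin d))
        = fderiv ℝ g u₀ := by
      have h1 := HasFDerivAt.comp (g := fun q => (C q).1) u₀
        (hCd.differentiable (by simp) (t₀, u₀)).hasFDerivAt
        (hasFDerivAt_prodMk_right (𝕜 := ℝ) t₀ u₀)
      have h2 : ((fun q => (C q).1) ∘ fun f => (t₀, f)) = g := funext fun f => by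
        simp only [Function.comp, hCG, g]
      rw [h2] at h1
      exact h1.fderiv.symm
    have hinv : (π ∘L fderiv ℝ (fun q => (C q).1) (t₀, u₀) ∘L
        .inr ℝ E (EuclideanSpace ℝ (Fin d))).IsInvertible := by
      rw [hfd]; exact hNs (hes ▸ hu₀).2
    have hrank : ∀ q, Module.finrank ℝ
        (LinearMap.range (fderiv ℝ (fun q => (C q).1) q).toLinearMap)
          ≤ Module.finrank ℝ (EuclideanSpace ℝ (Fin d)) := by
      intro q
      refine le_trans (Submodule.finrank_mono (t := tangentSpace (C q)) ?_)
        ((hd (C q)).trans finrank_euclideanSpace_fin.symm).le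
      rintro _ ⟨v, rfl⟩
      exact hC.fderiv_mem_tangentSpace hc hV q v
    have key := eventually_exists_slice hCd π hinv hrank (e.open_source.mem_nhds hu₀)
    have hsl : Tendsto (fun t : E => (t, u₀)) (𝓝 t₀) (𝓝 (t₀, u₀)) :=
      continuousAt_id.prodMk continuousAt_const
    filter_upwards [hsl.eventually key] with t ht
    obtain ⟨f, hf, hCf⟩ := ht
    have hAf : A t = G f := by
      rw [← hCA, ← hCG]; exact Orbit.ext hCf
    have hπA : π (A t).1 = e f := by rw [hAf, he]
    rw [hπA]
    exact ⟨e.map_source hf, by rw [e.left_inv hf, hAf]⟩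
  · exact ⟨e 0, e.map_source hmem, congrArg G (e.left_inv hmem)⟩

end Chart

end RandomSplitting

end

/-! ### The area formula for injective immersions. -/

noncomputable section

open Filter Metric
open scoped Topology ContDiff

namespace RandomSplitting

section AreaFormula

variable {E F : Type*} [NormedAddCommGroup E] [InnerProductSpace ℝ E] [FiniteDimensional ℝ E]
  [NormedAddCommGroup F] [InnerProductSpace ℝ F] [FiniteDimensional ℝ F]

/-- The Jacobian `√(det (L^* L))` of a linear map, as an extended nonnegative real. -/
def jacobian (L : E →L[ℝ] F) : ℝ≥0∞ := ENNReal.ofReal L.toLinearMap.normDet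

theorem normDet_eq_sqrt (L : E →L[ℝ] F) :
    L.toLinearMap.normDet = √((ContinuousLinearMap.adjoint L ∘L L).det) := by
  have h := ContinuousLinearMap.normDet_sq L
  rw [← h]
  exact (Real.sqrt_sq (LinearMap.normDet_nonneg _)).symm

theorem continuous_normDet : Continuous fun L : E →L[ℝ] F => L.toLinearMap.normDet := by
  simp_rw [normDet_eq_sqrt]
  refine Real.continuous_sqrt.comp (ContinuousLinearMap.continuous_det.comp ?_)
  exact (ContinuousLinearMap.adjoint.continuous).clm_comp continuous_id

theorem jacobian_ne_top (L : E →L[ℝ] F) : jacobian L ≠ ⊤ := ENNReal.ofReal_ne_top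

theorem normDet_pos {L : E →L[ℝ] F} (hL : Function.Injective L) :
    0 < L.toLinearMap.normDet :=
  lt_of_le_of_ne (LinearMap.normDet_nonneg _)
    (Ne.symm (((LinearMap.normDet_ne_zero_tfae L.toLinearMap).out 4 0).1 hL))

theorem jacobian_ne_zero {L : E →L[ℝ] F} (hL : Function.Injective L) : jacobian L ≠ 0 := by
  rw [jacobian, Ne, ENNReal.ofReal_eq_zero, not_le]
  exact normDet_pos hL

theorem continuous_jacobian : Continuous (jacobian : (E →L[ℝ] F) → ℝ≥0∞) :=
  ENNReal.continuous_ofReal.comp continuous_normDet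

section Comparison

variable [MeasurableSpace F] [BorelSpace F] {F' : Type*} [MetricSpace F'] [MeasurableSpace F']
  [BorelSpace F']

/-- The inequality forces `f` to be constant on the fibres of `g` in `s`, so `f ∘ g⁻¹` is well
defined on `g '' s` and `c`-Lipschitz there. -/
theorem euclideanHausdorffMeasure_image_le {X : Type*} {f : X → F} {g : X → F'} {s : Set X}
    {c : ℝ≥0} (k : ℕ) (h : ∀ x ∈ s, ∀ y ∈ s, dist (f x) (f y) ≤ c * dist (g x) (g y)) :
    (μHE[k] : Measure F) (f '' s) ≤ c ^ k * (μHE[k] : Measure F') (g '' s) := by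
  rcases s.eq_empty_or_nonempty with rfl | ⟨x₁, hx₁⟩
  · simp
  have : Nonempty X := ⟨x₁⟩
  let q : F' → F := fun z => f (Function.invFunOn g s z)
  have hmem (z) (hz : z ∈ g '' s) : Function.invFunOn g s z ∈ s ∧ g (Function.invFunOn g s z) = z :=
    ⟨Function.invFunOn_mem hz, Function.invFunOn_eq hz⟩
  have hlip : LipschitzOnWith c q (g '' s) := by
    refine LipschitzOnWith.of_dist_le_mul fun z hz w hw => ?_
    have := h _ (hmem z hz).1 _ (hmem w hw).1
    rwa [(hmem z hz).2, (hmem w hw).2] at this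
  have himg : f '' s = q '' (g '' s) := by
    rw [image_image]
    refine image_congr fun x hx => ?_
    have h1 := hmem (g x) (mem_image_of_mem g hx)
    have h2 := h x hx _ h1.1
    rw [h1.2, dist_self, mul_zero] at h2
    exact dist_le_zero.1 h2
  have := hlip.hausdorffMeasure_image_le (d := (k : ℝ)) (by positivity)
  rw [himg]
  simp only [Measure.euclideanHausdorffMeasure_def, Measure.smul_apply]
  rw [ENNReal.smul_def, ENNReal.smul_def, smul_eq_mul, smul_eq_mul, mul_left_comm]
  gcongr
  simpa using this

end Comparison

theorem exists_nhds_dist_le {g : E → F} {L : E →L[ℝ] F} {u₀ : E} (hg : HasStrictFDerivAt g L u₀)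
    (hL : Function.Injective L) {c : ℝ≥0} (hc : 1 < c) :
    ∃ W ∈ 𝓝 u₀, ∀ x ∈ W, ∀ y ∈ W, dist (g x) (g y) ≤ c * dist (L x) (L y) ∧
      dist (L x) (L y) ≤ c * dist (g x) (g y) := by
  obtain ⟨K, hK, hKL⟩ := L.toLinearMap.exists_antilipschitzWith (LinearMap.ker_eq_bot.2 hL)
  have hcr : (1 : ℝ) < c := hc
  -- If `g` differs from `L` by at most `δ ‖L x - L y‖`, the two distances compare with factors `1 +
  -- δ ≤ c` and `1 / (1 - δ) = c`. The bound `K` of the inverse of `L` converts `δ` into the error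
  -- `ε` of strict differentiability.
  let δ : ℝ := 1 - 1 / c
  have hδ : 0 < δ := by
    have : (1 : ℝ) / c < 1 := by rw [div_lt_one (by positivity)]; exact hcr
    simp only [δ]; linarith
  have hK' : (0 : ℝ) < K := hK
  obtain ⟨ε, hε, hεδ⟩ : ∃ ε : ℝ≥0, 0 < ε ∧ (ε : ℝ) * K = δ :=
    ⟨⟨δ / K, by positivity⟩, by show (0 : ℝ) < _; positivity,
      div_mul_cancel₀ _ hK'.ne'⟩
  obtain ⟨W, hW, happ⟩ := hg.approximates_deriv_on_nhds (c := ε) (Or.inr hε)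
  refine ⟨W, hW, fun x hx y hy => ?_⟩
  have h1 := happ x hx y hy
  have h2 : ‖x - y‖ ≤ K * ‖L x - L y‖ := by
    have := hKL.le_mul_dist x y
    simpa [dist_eq_norm] using this
  have h3 : ‖g x - g y - (L x - L y)‖ ≤ δ * ‖L x - L y‖ := by
    rw [← map_sub]
    refine h1.trans ?_
    rw [map_sub, ← hεδ, mul_assoc]
    gcongr
  rw [dist_eq_norm, dist_eq_norm]
  have h4 : ‖g x - g y‖ ≤ ‖L x - L y‖ + δ * ‖L x - L y‖ := by
    have := norm_add_le (L x - L y) (g x - g y - (L x - L y))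
    rw [add_sub_cancel] at this
    linarith
  have h5 : ‖L x - L y‖ ≤ ‖g x - g y‖ + δ * ‖L x - L y‖ := by
    have := norm_sub_le (g x - g y) (g x - g y - (L x - L y))
    rw [sub_sub_cancel] at this
    linarith
  have hpos : (0 : ℝ) < c := by positivity
  have hδc : δ * c = c - 1 := by simp only [δ]; field_simp
  constructor
  · have hδc' : 1 + δ ≤ c := by nlinarith
    calc _ ≤ (1 + δ) * ‖L x - L y‖ := by linarith
      _ ≤ _ := by gcongr
  · have : c * ‖L x - L y‖ ≤ c * ‖g x - g y‖ + (c - 1) * ‖L x - L y‖ := by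
      rw [← hδc]; nlinarith
    linarith

variable [MeasurableSpace E] [BorelSpace E] [MeasurableSpace F] [BorelSpace F]

theorem ContinuousOn.measurableSet_inter_preimage {X Y : Type*} [TopologicalSpace X]
    [MeasurableSpace X] [OpensMeasurableSpace X] [TopologicalSpace Y] [MeasurableSpace Y]
    [BorelSpace Y] {g : X → Y} {s : Set X} (hg : ContinuousOn g s) (hs : MeasurableSet s)
    {B : Set Y} (hB : MeasurableSet B) : MeasurableSet (s ∩ g ⁻¹' B) := by
  have h : MeasurableSet (s.domRestrict g ⁻¹' B) :=
    (continuousOn_iff_continuous_domRestrict.1 hg).measurable hB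
  have := hs.subtype_image h
  convert this using 1
  ext x
  simp [Set.domRestrict, and_comm]

/-- For the linear map `Dg(u₀)` the formula is exact. Comparing `g` with it costs `c` to the power
of the dimension, and the variation of the Jacobian near `u₀` costs one more factor `c`. -/
theorem exists_nhds_jacobian_bounds {g : E → F} {O : Set E} (hO : IsOpen O)
    (hg : ContDiffOn ℝ 1 g O) (hi : ∀ u ∈ O, Function.Injective (fderiv ℝ g u)) {u₀ : E}
    (hu₀ : u₀ ∈ O) {c : ℝ≥0} (hc : 1 < c) :
    ∃ W, IsOpen W ∧ u₀ ∈ W ∧ W ⊆ O ∧ ∀ s ⊆ W, MeasurableSet s →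
      μHE[Module.finrank ℝ E] (g '' s)
        ≤ c ^ (Module.finrank ℝ E + 1) * ∫⁻ u in s, jacobian (fderiv ℝ g u) ∧
      ∫⁻ u in s, jacobian (fderiv ℝ g u)
        ≤ c ^ (Module.finrank ℝ E + 1) * μHE[Module.finrank ℝ E] (g '' s) := by
  have hgu := hg.contDiffAt (hO.mem_nhds hu₀)
  have hstrict := hgu.hasStrictFDerivAt one_ne_zero
  obtain ⟨W₁, hW₁, hdist⟩ := exists_nhds_dist_le hstrict (hi u₀ hu₀) hc
  have hcont : ContinuousAt (fun u => jacobian (fderiv ℝ g u)) u₀ :=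
    continuous_jacobian.continuousAt.comp
      ((hg.continuousOn_fderiv_of_isOpen hO le_rfl).continuousAt (hO.mem_nhds hu₀))
  set J₀ := jacobian (fderiv ℝ g u₀) with hJ₀
  have hJ0 : J₀ ≠ 0 := jacobian_ne_zero (hi u₀ hu₀)
  have hJt : J₀ ≠ ⊤ := jacobian_ne_top _
  have hc' : (1 : ℝ≥0∞) < c := by exact_mod_cast hc
  have hup : ∀ᶠ u in 𝓝 u₀, jacobian (fderiv ℝ g u) < c * J₀ := by
    refine hcont.eventually_lt_const ?_
    calc jacobian (fderiv ℝ g u₀) = 1 * J₀ := (one_mul _).symm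
      _ < c * J₀ := ENNReal.mul_lt_mul_left hJ0 hJt hc'
  have hlow : ∀ᶠ u in 𝓝 u₀, J₀ < c * jacobian (fderiv ℝ g u) := by
    have : ContinuousAt (fun u => c * jacobian (fderiv ℝ g u)) u₀ :=
      ENNReal.Tendsto.const_mul hcont (Or.inr ENNReal.coe_ne_top)
    refine this.eventually_const_lt ?_
    calc J₀ = 1 * J₀ := (one_mul _).symm
      _ < c * J₀ := ENNReal.mul_lt_mul_left hJ0 hJt hc'
  obtain ⟨W, hWsub, hWo, hW0⟩ := _root_.mem_nhds_iff.1
    (inter_mem (inter_mem hW₁ (hO.mem_nhds hu₀)) (hup.and hlow))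
  refine ⟨W, hWo, hW0, fun u hu => (hWsub hu).1.2, fun s hs hsm => ?_⟩
  have himg : μHE[Module.finrank ℝ E] (fderiv ℝ g u₀ '' s) = J₀ * volume s :=
    LinearMap.euclideanHausdorffMeasure_image_eq_normDet_mul_volume (fderiv ℝ g u₀).toLinearMap s
  have hA := euclideanHausdorffMeasure_image_le (f := g) (g := fderiv ℝ g u₀) (s := s) (c := c)
    (Module.finrank ℝ E) fun x hx y hy =>
      (hdist x (hWsub (hs hx)).1.1 y (hWsub (hs hy)).1.1).1
  have hB := euclideanHausdorffMeasure_image_le (f := fderiv ℝ g u₀) (g := g) (s := s) (c := c)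
    (Module.finrank ℝ E) fun x hx y hy =>
      (hdist x (hWsub (hs hx)).1.1 y (hWsub (hs hy)).1.1).2
  rw [himg] at hA hB
  constructor
  · refine hA.trans ?_
    rw [pow_succ, mul_assoc]
    refine mul_le_mul_right ?_ _
    rw [← lintegral_const_mul' _ _ ENNReal.coe_ne_top, ← setLIntegral_const]
    exact setLIntegral_mono' hsm fun u hu => (hWsub (hs hu)).2.2.le
  · calc _ ≤ ∫⁻ u in s, c * J₀ := setLIntegral_mono' hsm fun u hu => (hWsub (hs hu)).2.1.le
      _ = c * (J₀ * volume s) := by rw [setLIntegral_const, mul_assoc]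
      _ ≤ c * (c ^ Module.finrank ℝ E * μHE[Module.finrank ℝ E] (g '' s)) := by gcongr
      _ = _ := by rw [pow_succ]; ring

/-- The area formula for the measure of the image under an injective `C^1` immersion. -/
theorem euclideanHausdorffMeasure_image_eq_lintegral {g : E → F} {O : Set E} (hO : IsOpen O)
    (hg : ContDiffOn ℝ 1 g O) (hinj : InjOn g O)
    (hi : ∀ u ∈ O, Function.Injective (fderiv ℝ g u)) {s : Set E} (hs : s ⊆ O)
    (hsm : MeasurableSet s) :
    μHE[Module.finrank ℝ E] (g '' s) = ∫⁻ u in s, jacobian (fderiv ℝ g u) := by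
  set k := Module.finrank ℝ E
  -- The local bounds are summed over countably many disjoint pieces. The constant does not depend
  -- on the piece, so letting `c` tend to `1` gives equality.
  have key (c : ℝ≥0) (hc : 1 < c) :
      μHE[k] (g '' s) ≤ c ^ (k + 1) * ∫⁻ u in s, jacobian (fderiv ℝ g u) ∧
      ∫⁻ u in s, jacobian (fderiv ℝ g u) ≤ c ^ (k + 1) * μHE[k] (g '' s) := by
    choose! W hWo hW0 hWO hW using
      fun (u : E) (hu : u ∈ O) => exists_nhds_jacobian_bounds hO hg hi hu hc
    obtain ⟨T, hTO, hT, hcov⟩ := TopologicalSpace.countable_cover_nhdsWithin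
      (s := O) (f := W) fun u hu => mem_nhdsWithin_of_mem_nhds ((hWo u hu).mem_nhds (hW0 u hu))
    rcases T.eq_empty_or_nonempty with rfl | hTne
    · have : s = ∅ := by
        have h := hs.trans hcov
        simpa [subset_empty_iff] using h
      simp [this]
    obtain ⟨a, rfl⟩ := hT.exists_eq_range hTne
    let A : ℕ → Set E := fun i => s ∩ disjointed (fun i => W (a i)) i
    have haO (i) : a i ∈ O := hTO (mem_range_self i)
    have hAm (i) : MeasurableSet (A i) :=
      hsm.inter (MeasurableSet.disjointed (fun i => (hWo _ (haO i)).measurableSet) i)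
    have hAW (i) : A i ⊆ W (a i) := fun u hu => disjointed_subset _ i hu.2
    have hAd : Pairwise (Function.onFun Disjoint A) := fun i j hij =>
      ((disjoint_disjointed (fun i => W (a i))) hij).mono inter_subset_right inter_subset_right
    have hAU : ⋃ i, A i = s := by
      rw [← inter_iUnion, iUnion_disjointed, inter_eq_left]
      refine hs.trans (hcov.trans ?_)
      rw [biUnion_range]
    have hAO (i) : A i ⊆ O := inter_subset_left.trans hs
    have hm : μHE[k] (g '' s) = ∑' i, μHE[k] (g '' A i) := by
      rw [← hAU, image_iUnion]
      refine measure_iUnion (fun i j hij => ?_) fun i =>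
        (hAm i).image_of_continuousOn_injOn (hg.continuousOn.mono (hAO i)) (hinj.mono (hAO i))
      rw [Function.onFun, Set.disjoint_left]
      rintro _ ⟨u, hu, rfl⟩ ⟨v, hv, huv⟩
      rw [hinj (hAO j hv) (hAO i hu) huv] at hv
      exact Set.disjoint_left.1 (hAd hij) hu hv
    have hI : ∫⁻ u in s, jacobian (fderiv ℝ g u) = ∑' i, ∫⁻ u in A i, jacobian (fderiv ℝ g u) := by
      rw [← lintegral_iUnion hAm hAd, hAU]
    rw [hm, hI, ← ENNReal.tsum_mul_left, ← ENNReal.tsum_mul_left]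
    exact ⟨ENNReal.tsum_le_tsum fun i => (hW _ (haO i) _ (hAW i) (hAm i)).1,
      ENNReal.tsum_le_tsum fun i => (hW _ (haO i) _ (hAW i) (hAm i)).2⟩
  have hlim (I : ℝ≥0∞) :
      Tendsto (fun c : ℝ≥0 => (c : ℝ≥0∞) ^ (k + 1) * I) (𝓝[>] 1) (𝓝 I) := by
    have h1 : Tendsto (fun c : ℝ≥0 => (c : ℝ≥0∞) ^ (k + 1)) (𝓝[>] 1) (𝓝 1) := by
      have : Continuous fun c : ℝ≥0 => ((c ^ (k + 1) : ℝ≥0) : ℝ≥0∞) := by fun_prop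
      have h := (this.tendsto 1).mono_left (nhdsWithin_le_nhds (s := Ioi 1))
      simpa using h
    have := ENNReal.Tendsto.mul_const (b := I) h1 (Or.inl one_ne_zero)
    simpa using this
  refine le_antisymm (ge_of_tendsto (hlim _) ?_) (ge_of_tendsto (hlim _) ?_)
  · filter_upwards [self_mem_nhdsWithin] with c hc using (key c hc).1
  · filter_upwards [self_mem_nhdsWithin] with c hc using (key c hc).2

/-- The area formula for integrals over the image of an injective `C^1` immersion. -/
theorem lintegral_image_euclideanHausdorffMeasure {g : E → F} {O : Set E} (hO : IsOpen O)
    (hg : ContDiffOn ℝ 1 g O) (hinj : InjOn g O)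
    (hi : ∀ u ∈ O, Function.Injective (fderiv ℝ g u)) {s : Set E} (hs : s ⊆ O)
    (hsm : MeasurableSet s) {φ : F → ℝ≥0∞} (hφ : Measurable φ) :
    ∫⁻ y in g '' s, φ y ∂μHE[Module.finrank ℝ E]
      = ∫⁻ u in s, jacobian (fderiv ℝ g u) * φ (g u) := by
  have hgs : AEMeasurable g (volume.restrict s) :=
    (hg.continuousOn.mono hs).aemeasurable hsm
  have hgs' : AEMeasurable g ((volume.restrict s).withDensity fun u => jacobian (fderiv ℝ g u)) :=
    hgs.mono_ac (withDensity_absolutelyContinuous _ _)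
  have hJ : AEMeasurable (fun u => jacobian (fderiv ℝ g u)) (volume.restrict s) := by
    refine ((continuous_jacobian.comp_continuousOn
      (hg.continuousOn_fderiv_of_isOpen hO le_rfl)).mono hs).aemeasurable hsm
  have hmeas : (μHE[Module.finrank ℝ E] : Measure F).restrict (g '' s)
      = ((volume.restrict s).withDensity fun u => jacobian (fderiv ℝ g u)).map g := by
    ext B hB
    have hsB := ContinuousOn.measurableSet_inter_preimage (hg.continuousOn.mono hs) hsm hB
    rw [Measure.restrict_apply hB, inter_comm, ← image_inter_preimage,
      euclideanHausdorffMeasure_image_eq_lintegral hO hg hinj hi (inter_subset_left.trans hs) hsB,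
      Measure.map_apply_of_aemeasurable hgs' hB]
    rw [← restrict_withDensity hsm, Measure.restrict_apply' hsm, inter_comm (g ⁻¹' B) s,
      withDensity_apply _ hsB]
  rw [hmeas, lintegral_map' hφ.aemeasurable hgs']
  exact lintegral_withDensity_eq_lintegral_mul₀ hJ (hφ.comp_aemeasurable hgs)

end AreaFormula

end RandomSplitting

end

/-! ### The coarea formula in straightening coordinates. -/

noncomputable section

open Filter Metric
open scoped Topology ContDiff

namespace RandomSplitting

section SubmersionJacobian

variable {E P K : Type*} [NormedAddCommGroup E] [InnerProductSpace ℝ E] [FiniteDimensional ℝ E]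
  [NormedAddCommGroup P] [InnerProductSpace ℝ P] [FiniteDimensional ℝ P]
  [NormedAddCommGroup K] [InnerProductSpace ℝ K] [FiniteDimensional ℝ K]

/-- The inclusion of the second factor into an `L²` product. -/
def inrL2 (P K : Type*) [NormedAddCommGroup P] [InnerProductSpace ℝ P] [NormedAddCommGroup K]
    [InnerProductSpace ℝ K] : K →L[ℝ] WithLp 2 (P × K) :=
  (WithLp.prodContinuousLinearEquiv 2 ℝ P K).symm.toContinuousLinearMap ∘L
    ContinuousLinearMap.inr ℝ P K

@[simp]
theorem inrL2_apply (k : K) : inrL2 P K k = WithLp.toLp 2 (0, k) := rfl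

/-- The matrix of `A` is block triangular with diagonal blocks `T` and the identity. -/
theorem det_eq_det_of_fst_eq {A : WithLp 2 (P × K) →ₗ[ℝ] WithLp 2 (P × K)} {T : P →ₗ[ℝ] P}
    (h₁ : ∀ z, (A z).fst = T z.fst) (h₂ : ∀ k, A (WithLp.toLp 2 (0, k)) = WithLp.toLp 2 (0, k)) :
    A.det = T.det := by
  let bP := stdOrthonormalBasis ℝ P
  let bK := stdOrthonormalBasis ℝ K
  rw [← LinearMap.det_toMatrix (bP.prod bK).toBasis, ← LinearMap.det_toMatrix bP.toBasis]
  have : LinearMap.toMatrix (bP.prod bK).toBasis (bP.prod bK).toBasis A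
      = Matrix.fromBlocks (LinearMap.toMatrix bP.toBasis bP.toBasis T) 0
          (Matrix.of fun i j => inner ℝ (bK i) (A (WithLp.toLp 2 (bP j, 0))).snd) 1 := by
    ext i j
    rw [LinearMap.toMatrix_apply, OrthonormalBasis.coe_toBasis_repr_apply,
      OrthonormalBasis.repr_apply_apply, OrthonormalBasis.coe_toBasis]
    rcases i with i | i <;> rcases j with j | j
    · have := h₁ (WithLp.toLp 2 (bP j, 0))
      simp [LinearMap.toMatrix_apply, OrthonormalBasis.repr_apply_apply] at this ⊢
      rw [this]
    · simp [h₂]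
    · simp
    · simp [h₂, Matrix.one_apply, orthonormal_iff_ite.1 bK.orthonormal]
  rw [this, Matrix.det_fromBlocks_zero₁₂, Matrix.det_one, mul_one]

/-- If `L` straightens the fibres of `G`, its Jacobian along the fibres is the product of its full
Jacobian with the Jacobian of the submersion `G`. -/
theorem normDet_comp_inrL2 {L : WithLp 2 (P × K) ≃L[ℝ] E} {G : E →L[ℝ] P}
    (h : ∀ z, G (L z) = z.fst) :
    (L.toContinuousLinearMap ∘L inrL2 P K).toLinearMap.normDet
      = L.toContinuousLinearMap.toLinearMap.normDet
        * (ContinuousLinearMap.adjoint G).toLinearMap.normDet := by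
  set G' := ContinuousLinearMap.adjoint G with hG'
  set B := L.toContinuousLinearMap ∘L inrL2 P K with hB
  have hGB (k : K) : G (B k) = 0 := h _
  have hG'inj : Function.Injective G' := by
    rw [injective_iff_map_eq_zero]
    intro p hp
    have : inner ℝ p (G (L (WithLp.toLp 2 (p, 0)))) = 0 := by
      rw [← ContinuousLinearMap.adjoint_inner_left, ← hG', hp, inner_zero_left]
    rw [h] at this
    exact inner_self_eq_zero.1 this
  -- `normDet Q` is computed twice, where `G'` is the adjoint of `G` and `B` is `L` on the fibre.
  -- The ranges of `G'` and `B` are orthogonal, which gives `|G'| |B|`. Also `Q = L A` with `A`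
  -- block triangular of determinant `det (G G') = |G'|²`, which gives `|L| |G'|²`. Cancelling `|G'|
  -- > 0` proves the claim.
  let Q : WithLp 2 (P × K) →L[ℝ] E :=
    (G'.coprod B) ∘L (WithLp.prodContinuousLinearEquiv 2 ℝ P K).toContinuousLinearMap
  have hQ (z : WithLp 2 (P × K)) : Q z = G' z.fst + B z.snd := rfl
  let A : WithLp 2 (P × K) →L[ℝ] WithLp 2 (P × K) := L.symm.toContinuousLinearMap ∘L Q
  have hLA : L.toContinuousLinearMap.toLinearMap ∘ₗ A.toLinearMap = Q.toLinearMap := by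
    ext z; simp [A]
  have hA1 (z) : (A z).fst = (G ∘L G').toLinearMap z.fst := by
    rw [← h]
    simp [A, hQ, hGB]
  have hA2 (k : K) : A (WithLp.toLp 2 (0, k)) = WithLp.toLp 2 (0, k) := by
    simp only [A, ContinuousLinearMap.comp_apply, hQ]
    simp [hB]
  have hndA : A.toLinearMap.normDet = G'.toLinearMap.normDet ^ 2 := by
    rw [LinearMap.normDet_eq_abs_det, det_eq_det_of_fst_eq hA1 hA2]
    have := ContinuousLinearMap.normDet_sq G'
    rw [hG', ContinuousLinearMap.adjoint_adjoint, ← hG'] at this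
    change |(G ∘L G').det| = _
    rw [← this]
    exact abs_of_nonneg (sq_nonneg _)
  have hndQ : Q.toLinearMap.normDet = G'.toLinearMap.normDet * B.toLinearMap.normDet := by
    let bP := stdOrthonormalBasis ℝ P
    let bK := stdOrthonormalBasis ℝ K
    have h1 := LinearMap.normDet_sq_eq_det_gram Q.toLinearMap (bP.prod bK)
    have h2 := LinearMap.normDet_sq_eq_det_gram G'.toLinearMap bP
    have h3 := LinearMap.normDet_sq_eq_det_gram B.toLinearMap bK
    have horth (p : P) (k : K) : inner ℝ (G' p) (B k) = 0 := by
      rw [hG', ContinuousLinearMap.adjoint_inner_left, hGB, inner_zero_right]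
    have hblk : Matrix.gram ℝ (fun i => Q.toLinearMap ((bP.prod bK) i))
        = Matrix.fromBlocks (Matrix.gram ℝ fun i => G'.toLinearMap (bP i)) 0 0
            (Matrix.gram ℝ fun i => B.toLinearMap (bK i)) := by
      ext i j
      rcases i with i | i <;> rcases j with j | j
      · simp [Matrix.gram_apply, hQ]
      · simp [Matrix.gram_apply, hQ, horth]
      · have horth' (p : P) (k : K) : inner ℝ (B k) (G' p) = 0 := by
          rw [real_inner_comm]; exact horth p k
        simp [Matrix.gram_apply, hQ, horth']
      · simp [Matrix.gram_apply, hQ]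
    rw [hblk, Matrix.det_fromBlocks_zero₁₂, ← h2, ← h3] at h1
    have h4 : Q.toLinearMap.normDet ^ 2
        = (G'.toLinearMap.normDet * B.toLinearMap.normDet) ^ 2 := by
      rw [mul_pow]; exact h1
    exact (pow_left_inj₀ (LinearMap.normDet_nonneg _) (mul_nonneg (LinearMap.normDet_nonneg _)
      (LinearMap.normDet_nonneg _)) two_ne_zero).1 h4
  have hcomp := LinearMap.normDet_comp_of_finrank_eq A.toLinearMap
    L.toContinuousLinearMap.toLinearMap rfl
  rw [hLA, hndQ, hndA] at hcomp
  have hpos := normDet_pos hG'inj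
  have : G'.toLinearMap.normDet * B.toLinearMap.normDet
      = G'.toLinearMap.normDet * (L.toContinuousLinearMap.toLinearMap.normDet
        * G'.toLinearMap.normDet) := by rw [hcomp]; ring
  exact mul_left_cancel₀ hpos.ne' this

theorem jacobian_comp_inrL2 {L : WithLp 2 (P × K) ≃L[ℝ] E} {G : E →L[ℝ] P}
    (h : ∀ z, G (L z) = z.fst) :
    jacobian (L.toContinuousLinearMap ∘L inrL2 P K)
      = jacobian L.toContinuousLinearMap * jacobian (ContinuousLinearMap.adjoint G) := by
  rw [jacobian, normDet_comp_inrL2 h, ENNReal.ofReal_mul (LinearMap.normDet_nonneg _)]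
  rfl

end SubmersionJacobian

section LocalCoarea

variable {E P K : Type*} [NormedAddCommGroup E] [InnerProductSpace ℝ E] [FiniteDimensional ℝ E]
  [NormedAddCommGroup P] [InnerProductSpace ℝ P] [FiniteDimensional ℝ P]
  [NormedAddCommGroup K] [InnerProductSpace ℝ K] [FiniteDimensional ℝ K]

/-- `Θ` is a `C^1` diffeomorphism from the open set `S` to the open set `W` that maps the slices
of the product into the fibres of `g`. -/
structure Straightens (g : E → P) (W : Set E) (S : Set (WithLp 2 (P × K)))
    (Θ : WithLp 2 (P × K) → E) : Prop where
  isOpen_target : IsOpen W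
  isOpen_source : IsOpen S
  contDiffOn : ContDiffOn ℝ 1 Θ S
  injOn : InjOn Θ S
  image_eq : Θ '' S = W
  fst_eq : ∀ z ∈ S, g (Θ z) = z.fst
  hasFDerivAt : ∀ z ∈ S, ∃ L : WithLp 2 (P × K) ≃L[ℝ] E, HasFDerivAt Θ L.toContinuousLinearMap z

/-- A surjective linear map becomes a coordinate projection after completing it by the orthogonal
projection to its kernel. -/
theorem exists_equiv_prod_ker {G₀ : E →L[ℝ] P} (hsurj : Function.Surjective G₀) :
    ∃ M : E ≃L[ℝ] WithLp 2 (P × LinearMap.ker G₀.toLinearMap), ∀ t, M t = WithLp.toLp 2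
      (G₀ t, (LinearMap.ker G₀.toLinearMap).orthogonalProjectionOnto t) := by
  let K := LinearMap.ker G₀.toLinearMap
  let c := (WithLp.prodContinuousLinearEquiv 2 ℝ P K).symm.toContinuousLinearMap
  have hdim : Module.finrank ℝ E = Module.finrank ℝ (WithLp 2 (P × K)) := by
    have h1 := LinearMap.finrank_range_add_finrank_ker G₀.toLinearMap
    rw [LinearMap.range_eq_top.2 hsurj, finrank_top] at h1
    rw [(WithLp.prodContinuousLinearEquiv 2 ℝ P K).toLinearEquiv.finrank_eq, Module.finrank_prod]
    exact h1.symm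
  have hinj : Function.Injective (c ∘L (G₀.prod K.orthogonalProjectionOnto)).toLinearMap := by
    rw [injective_iff_map_eq_zero]
    intro t ht
    have h2 : ((G₀ t, K.orthogonalProjectionOnto t) : P × K) = 0 :=
      (WithLp.prodContinuousLinearEquiv 2 ℝ P K).symm.map_eq_zero_iff.1 ht
    have h3 : t ∈ K := (congrArg Prod.fst h2 : G₀ t = 0)
    have h4 : K.orthogonalProjectionOnto t = 0 := congrArg Prod.snd h2
    have h5 := K.orthogonalProjectionOnto_mem_subspace_eq_self ⟨t, h3⟩
    rw [h4] at h5
    exact (congrArg Subtype.val h5).symm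
  let M : E ≃L[ℝ] WithLp 2 (P × K) :=
    (LinearEquiv.ofInjectiveOfFinrankEq _ hinj hdim).toContinuousLinearEquiv
  exact ⟨M, fun t => rfl⟩

/-- Inverse function theorem for `g` completed by the orthogonal projection to the kernel of its
derivative at `t₀`; `Θ` is the local inverse. -/
theorem exists_straightens {g : E → P} (hg : ContDiff ℝ 1 g) {t₀ : E}
    (hsurj : Function.Surjective (fderiv ℝ g t₀)) :
    ∃ W S Θ, t₀ ∈ W ∧ Straightens (K := LinearMap.ker (fderiv ℝ g t₀).toLinearMap) g W S Θ := by
  set G₀ := fderiv ℝ g t₀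
  let K := LinearMap.ker G₀.toLinearMap
  let c := (WithLp.prodContinuousLinearEquiv 2 ℝ P K).symm.toContinuousLinearMap
  let Ψ : E → WithLp 2 (P × K) := fun t => c (g t, K.orthogonalProjectionOnto t)
  have hΨc : ContDiff ℝ 1 Ψ := c.contDiff.comp (hg.prodMk (ContinuousLinearMap.contDiff _))
  have hΨ0 : HasFDerivAt Ψ (c ∘L (G₀.prod K.orthogonalProjectionOnto)) t₀ :=
    c.hasFDerivAt.comp t₀ (((hg.differentiable one_ne_zero) t₀).hasFDerivAt.prodMk
      (ContinuousLinearMap.hasFDerivAt _))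
  obtain ⟨M, hM'⟩ := exists_equiv_prod_ker hsurj
  have hM : HasFDerivAt Ψ M.toContinuousLinearMap t₀ := by
    convert hΨ0 using 1
    ext1 t
    exact hM' t
  let e := hΨc.contDiffAt.toOpenPartialHomeomorph Ψ hM one_ne_zero
  have he : (e : E → WithLp 2 (P × K)) = Ψ :=
    hΨc.contDiffAt.toOpenPartialHomeomorph_coe hM one_ne_zero
  have hmem : t₀ ∈ e.source := hΨc.contDiffAt.mem_toOpenPartialHomeomorph_source hM one_ne_zero
  have hev : ∀ᶠ t in 𝓝 t₀, (fderiv ℝ Ψ t).IsInvertible := by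
    have h := ContinuousLinearEquiv.nhds M
    rw [← hM.fderiv] at h
    exact (hΨc.continuous_fderiv one_ne_zero).continuousAt.eventually h
  obtain ⟨N, hNs, hNo, hN0⟩ := _root_.mem_nhds_iff.1 hev
  have hW : IsOpen (e.source ∩ N) := e.open_source.inter hNo
  refine ⟨e.source ∩ N, e '' (e.source ∩ N), e.symm, ⟨hmem, hN0⟩, hW,
    e.isOpen_image_of_subset_source hW inter_subset_left, ?_, ?_, ?_, ?_, ?_⟩
  · rintro _ ⟨t, ht, rfl⟩
    obtain ⟨L, hL⟩ := hNs ht.2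
    refine (e.contDiffAt_symm (f₀' := L) (e.map_source ht.1) ?_ ?_).contDiffWithinAt
    · rw [e.left_inv ht.1, hL, he]
      exact (hΨc.differentiable one_ne_zero t).hasFDerivAt
    · rw [he]; exact hΨc.contDiffAt
  · exact e.symm.injOn.mono (by rintro _ ⟨t, ht, rfl⟩; exact e.map_source ht.1)
  · rw [image_image]
    refine (image_congr fun t ht => e.left_inv ht.1).trans (image_id' _)
  · rintro _ ⟨t, ht, rfl⟩
    rw [e.left_inv ht.1, he]
    rfl
  · rintro _ ⟨t, ht, rfl⟩
    obtain ⟨L, hL⟩ := hNs ht.2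
    refine ⟨L.symm, e.hasFDerivAt_symm (e.map_source ht.1) ?_⟩
    rw [e.left_inv ht.1, hL, he]
    exact (hΨc.differentiable one_ne_zero t).hasFDerivAt

variable [MeasurableSpace E] [BorelSpace E] [MeasurableSpace P] [BorelSpace P]

/-- The coarea formula for the submersion `g` and the integrand `φ` on the set `s`. -/
def CoareaOn (g : E → P) (s : Set E) (φ : E → ℝ≥0∞) : Prop :=
  AEMeasurable (fun p => ∫⁻ t in g ⁻¹' {p} ∩ s, φ t
      ∂μHE[Module.finrank ℝ E - Module.finrank ℝ P]) (volume : Measure P) ∧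
    ∫⁻ t in s, jacobian (ContinuousLinearMap.adjoint (fderiv ℝ g t)) * φ t
      = ∫⁻ p, ∫⁻ t in g ⁻¹' {p} ∩ s, φ t ∂μHE[Module.finrank ℝ E - Module.finrank ℝ P]

/-- Fubini in the coordinates `(p, k)`: the area formula for `Θ` rewrites the left side, and the one
for each slice `k ↦ Θ (p, k)` rewrites the fibre integrals. `jacobian_comp_inrL2` says that the two
integrands agree. -/
theorem Straightens.coareaOn [MeasurableSpace K] [BorelSpace K] {g : E → P} (hg : ContDiff ℝ 1 g)
    {W : Set E} {S : Set (WithLp 2 (P × K))} {Θ : WithLp 2 (P × K) → E} (h : Straightens g W S Θ)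
    {s : Set E} (hsW : s ⊆ W) (hs : MeasurableSet s) {φ : E → ℝ≥0∞} (hφ : Measurable φ) :
    CoareaOn g s φ := by
  rcases s.eq_empty_or_nonempty with rfl | ⟨t₁, ht₁⟩
  · simp [CoareaOn]
  have hfE : Module.finrank ℝ (WithLp 2 (P × K)) = Module.finrank ℝ E := by
    obtain ⟨z, hz, -⟩ := h.image_eq.symm.subset (hsW ht₁)
    obtain ⟨L, -⟩ := h.hasFDerivAt z hz
    exact L.toLinearEquiv.finrank_eq
  have hfK : Module.finrank ℝ E - Module.finrank ℝ P = Module.finrank ℝ K := by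
    rw [← hfE, (WithLp.prodContinuousLinearEquiv 2 ℝ P K).toLinearEquiv.finrank_eq,
      Module.finrank_prod, Nat.add_sub_cancel_left]
  set T := S ∩ Θ ⁻¹' s with hT
  have hTm : MeasurableSet T :=
    ContinuousOn.measurableSet_inter_preimage h.contDiffOn.continuousOn
      h.isOpen_source.measurableSet hs
  have hTs : Θ '' T = s := by
    rw [hT, image_inter_preimage, h.image_eq, inter_eq_right]
    exact hsW
  have hJ (z) (hz : z ∈ S) : jacobian (fderiv ℝ Θ z ∘L inrL2 P K)
      = jacobian (fderiv ℝ Θ z) * jacobian (ContinuousLinearMap.adjoint (fderiv ℝ g (Θ z))) := by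
    obtain ⟨L, hL⟩ := h.hasFDerivAt z hz
    rw [hL.fderiv]
    refine jacobian_comp_inrL2 fun w => ?_
    have h1 := ((hg.differentiable one_ne_zero) (Θ z)).hasFDerivAt.comp z hL
    have h2 : HasFDerivAt (g ∘ Θ) (WithLp.fstL 2 ℝ P K) z := by
      refine (WithLp.fstL 2 ℝ P K).hasFDerivAt.congr_of_eventuallyEq ?_
      filter_upwards [h.isOpen_source.mem_nhds hz] with z' hz' using h.fst_eq z' hz'
    exact congrArg (fun A => A w) (h1.unique h2)
  have hinjL (z) (hz : z ∈ S) : Function.Injective (fderiv ℝ Θ z) := by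
    obtain ⟨L, hL⟩ := h.hasFDerivAt z hz
    rw [hL.fderiv]
    exact L.injective
  have hDc : ContinuousOn (fderiv ℝ Θ) S :=
    h.contDiffOn.continuousOn_fderiv_of_isOpen h.isOpen_source le_rfl
  -- The common integrand of both sides, extended by zero off `T = Θ⁻¹(s)`.
  let H : WithLp 2 (P × K) → ℝ≥0∞ :=
    T.indicator fun z => jacobian (fderiv ℝ Θ z ∘L inrL2 P K) * φ (Θ z)
  have hH : AEMeasurable H := by
    rw [aemeasurable_indicator_iff hTm]
    refine AEMeasurable.mul ?_ (hφ.comp_aemeasurable ?_)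
    · refine ContinuousOn.aemeasurable ?_ hTm
      exact continuous_jacobian.comp_continuousOn
        ((hDc.mono inter_subset_left).clm_comp continuousOn_const)
    · exact (h.contDiffOn.continuousOn.mono inter_subset_left).aemeasurable hTm
  have hHp : AEMeasurable (fun q : P × K => H (WithLp.toLp 2 q)) :=
    hH.comp_quasiMeasurePreserving
      (WithLp.volume_preserving_toLp P K).quasiMeasurePreserving
  have hfib (p : P) : ∫⁻ t in g ⁻¹' {p} ∩ s, φ t ∂μHE[Module.finrank ℝ E - Module.finrank ℝ P]
      = ∫⁻ k, H (WithLp.toLp 2 (p, k)) := by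
    let j : K → WithLp 2 (P × K) := fun k => WithLp.toLp 2 (p, k)
    have hj (k : K) : HasFDerivAt j (inrL2 P K) k := by
      have h1 := (WithLp.prodContinuousLinearEquiv 2 ℝ P K).symm.toContinuousLinearMap.hasFDerivAt
        (x := (p, k))
      exact h1.comp k (hasFDerivAt_prodMk_right (𝕜 := ℝ) p k)
    have hjc : ContDiff ℝ 1 j :=
      (WithLp.prodContinuousLinearEquiv 2 ℝ P K).symm.contDiff.comp (contDiff_prodMk_right p)
    have hjm : Measurable j := hjc.continuous.measurable
    have hder (k) (hk : j k ∈ S) :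
        HasFDerivAt (fun k => Θ (j k)) (fderiv ℝ Θ (j k) ∘L inrL2 P K) k := by
      obtain ⟨L, hL⟩ := h.hasFDerivAt _ hk
      rw [hL.fderiv]
      exact hL.comp k (hj k)
    have himg : (fun k => Θ (j k)) '' (j ⁻¹' T) = g ⁻¹' {p} ∩ s := by
      ext t
      constructor
      · rintro ⟨k, hk, rfl⟩
        exact ⟨h.fst_eq _ hk.1, hk.2⟩
      · rintro ⟨htp, hts⟩
        obtain ⟨z, hz, rfl⟩ := hTs.symm.subset hts
        have : z = j z.snd := by
          have h1 : z.fst = p := (h.fst_eq z hz.1).symm.trans htp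
          change z = WithLp.toLp 2 (p, z.snd)
          rw [← h1]
          rfl
        exact ⟨z.snd, by rw [mem_preimage, ← this]; exact hz, congrArg Θ this.symm⟩
    rw [hfK, ← himg, lintegral_image_euclideanHausdorffMeasure (g := fun k => Θ (j k))
      (s := j ⁻¹' T) (h.isOpen_source.preimage hjc.continuous) (h.contDiffOn.comp hjc.contDiffOn fun k hk => hk)
      ?_ ?_ (preimage_mono inter_subset_left) (hjm hTm) hφ]
    · rw [← lintegral_indicator (hjm hTm)]
      refine lintegral_congr fun k => ?_
      by_cases hk : j k ∈ T
      · rw [indicator_of_mem (show k ∈ j ⁻¹' T from hk)]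
        change _ = H (j k)
        simp only [H]
        rw [indicator_of_mem hk, (hder k hk.1).fderiv]
      · rw [indicator_of_notMem (show k ∉ j ⁻¹' T from hk)]
        change _ = H (j k)
        simp only [H]
        rw [indicator_of_notMem hk]
    · intro k hk k' hk' hkk
      have := h.injOn hk hk' hkk
      exact congrArg WithLp.snd this
    · intro k hk
      rw [(hder k hk).fderiv]
      refine (hinjL _ hk).comp fun a b hab => ?_
      exact congrArg WithLp.snd hab
  constructor
  · simp_rw [hfib]
    exact hHp.lintegral_prod_right'
  · simp_rw [hfib]
    have hJm : Measurable fun t => jacobian (ContinuousLinearMap.adjoint (fderiv ℝ g t)) * φ t := by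
      refine Measurable.mul (Continuous.measurable ?_) hφ
      exact continuous_jacobian.comp (ContinuousLinearMap.adjoint.continuous.comp
        (hg.continuous_fderiv one_ne_zero))
    have harea := lintegral_image_euclideanHausdorffMeasure h.isOpen_source h.contDiffOn h.injOn
      hinjL inter_subset_left hTm hJm
    rw [hTs, hfE, InnerProductSpace.euclideanHausdorffMeasure_eq_volume] at harea
    rw [harea]
    have hprod := lintegral_prod (μ := (volume : Measure P)) (ν := (volume : Measure K)) _ hHp
    rw [← hprod, ← lintegral_indicator hTm]
    change _ = ∫⁻ q : P × K, H (WithLp.toLp 2 q)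
    rw [(WithLp.volume_preserving_toLp P K).lintegral_comp_emb
      (MeasurableEquiv.toLp 2 (P × K)).measurableEmbedding]
    refine lintegral_congr fun z => ?_
    by_cases hz : z ∈ T
    · simp only [H]
      rw [indicator_of_mem hz, indicator_of_mem hz, hJ z hz.1, mul_assoc]
    · simp only [H]
      rw [indicator_of_notMem hz, indicator_of_notMem hz]

end LocalCoarea

end RandomSplitting

end

/-! ### Null sets on fibres and the coarea formula in Euclidean space. -/

noncomputable section

open Filter Metric
open scoped Topology ContDiff

namespace RandomSplitting

section Coarea

variable {E P : Type*} [NormedAddCommGroup E] [InnerProductSpace ℝ E] [FiniteDimensional ℝ E]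
  [NormedAddCommGroup P] [InnerProductSpace ℝ P] [FiniteDimensional ℝ P]
  [MeasurableSpace E] [BorelSpace E] [MeasurableSpace P] [BorelSpace P]

/-- Almost every fibre of a Lipschitz map meets a given null set in a null set. -/
theorem LipschitzOnWith.ae_hausdorffMeasure_fibre_eq_zero
    (hdim : Module.finrank ℝ P ≤ Module.finrank ℝ E) {g : E → P} {s : Set E} {C : ℝ≥0}
    (hg : LipschitzOnWith C g s) (hs : volume s = 0) :
    ∀ᵐ p : P, μH[((Module.finrank ℝ E - Module.finrank ℝ P : ℕ) : ℝ)] (g ⁻¹' {p} ∩ s) = 0 := by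
  set N := Module.finrank ℝ E
  set d := Module.finrank ℝ P
  -- Cover the null set by balls of total volume at most `2⁻ʲ` with radii below `1 / (j + 1)`, as
  -- Hausdorff measure demands.
  have hcov (j : ℕ) := Besicovitch.exists_closedBall_covering_tsum_measure_le (volume : Measure E)
    (ε := (2⁻¹ : ℝ≥0∞) ^ j) (by simp) (fun _ => Ioo (0 : ℝ) (1 / (j + 1))) s (by
      intro x _ δ hδ
      refine ⟨min δ (1 / (j + 1)) / 2, ?_⟩
      have h1 : (0 : ℝ) < min δ (1 / (j + 1)) := lt_min hδ (by positivity)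
      have h2 := min_le_left δ (1 / ((j : ℝ) + 1))
      have h3 := min_le_right δ (1 / ((j : ℝ) + 1))
      exact ⟨⟨by linarith, by linarith⟩, ⟨by linarith, by linarith⟩⟩)
  choose T r hTc hTs hr hsub hsum using hcov
  have : ∀ j, Countable (T j) := fun j => (hTc j).to_subtype
  have hrpos (j) (x : T j) : 0 < r j x := (hr j x x.2).1
  let B (j : ℕ) (x : T j) : Set P := closedBall (g x) (C * r j x)
  -- `H j p` bounds the covering sum of the fibre over `p`: only balls whose image meets `p` count,
  -- each with its diameter to the power `N - d`. Integration over `p` contributes a further `(C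
  -- r)^d` for each ball, so the integral is at most a constant times the total volume. The
  -- integrals are summable in `j`, so `H j p` tends to `0` for almost every `p`.
  let H (j : ℕ) (p : P) : ℝ≥0∞ :=
    ∑' x : T j, (B j x).indicator (fun _ => ENNReal.ofReal (2 * r j x) ^ (N - d)) p
  have hHm (j) : Measurable (H j) :=
    Measurable.tsum fun x => measurable_const.indicator measurableSet_closedBall
  set cE := volume (ball (0 : E) 1)
  set cP := volume (ball (0 : P) 1)
  have hcE0 : cE ≠ 0 := (measure_ball_pos _ _ one_pos).ne'
  have hcEt : cE ≠ ⊤ := measure_ball_lt_top.ne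
  have hcPt : cP ≠ ⊤ := measure_ball_lt_top.ne
  set A : ℝ≥0∞ := (C : ℝ≥0∞) ^ d * cP * 2 ^ (N - d) * cE⁻¹
  have hA : A ≠ ⊤ := by
    refine ENNReal.mul_ne_top (ENNReal.mul_ne_top (ENNReal.mul_ne_top ?_ hcPt) ?_)
      (ENNReal.inv_ne_top.2 hcE0)
    · exact ENNReal.pow_ne_top ENNReal.coe_ne_top
    · exact ENNReal.pow_ne_top (by simp)
  have hintg (j) : ∫⁻ p, H j p ≤ A * (2⁻¹ : ℝ≥0∞) ^ j := by
    have h1 : ∫⁻ p, H j p = ∑' x : T j, A * volume (closedBall (x : E) (r j x)) := by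
      rw [lintegral_tsum fun x =>
        (measurable_const.indicator measurableSet_closedBall).aemeasurable]
      refine tsum_congr fun x => ?_
      have hx := hrpos j x
      rw [lintegral_indicator measurableSet_closedBall, setLIntegral_const,
        Measure.addHaar_closedBall _ _ (by positivity), Measure.addHaar_closedBall _ _ hx.le,
        ENNReal.ofReal_pow (by positivity), ENNReal.ofReal_pow hx.le,
        ENNReal.ofReal_mul (by positivity), ENNReal.ofReal_mul (by positivity),
        ENNReal.ofReal_coe_nnreal, mul_pow, mul_pow]
      have hN : ENNReal.ofReal (r j x) ^ N
          = ENNReal.ofReal (r j x) ^ (N - d) * ENNReal.ofReal (r j x) ^ d := by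
        rw [← pow_add, Nat.sub_add_cancel hdim]
      have h2 : ENNReal.ofReal 2 = 2 := by simp
      have hc : cE⁻¹ * cE = 1 := ENNReal.inv_mul_cancel hcE0 hcEt
      rw [hN, h2]
      calc _ = ((C : ℝ≥0∞) ^ d * cP * 2 ^ (N - d)) * 1
            * (ENNReal.ofReal (r j x) ^ (N - d) * ENNReal.ofReal (r j x) ^ d) := by ring
        _ = _ := by rw [← hc]; simp only [A]; ring
    rw [h1, ENNReal.tsum_mul_left]
    gcongr
    simpa [hs] using hsum j
  have hfin : ∫⁻ p, ∑' j, H j p ≠ ⊤ := by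
    rw [lintegral_tsum fun j => (hHm j).aemeasurable]
    refine ne_top_of_le_ne_top ?_ (ENNReal.tsum_le_tsum hintg)
    rw [ENNReal.tsum_mul_left, ENNReal.tsum_geometric]
    exact ENNReal.mul_ne_top hA (by simp)
  have hediam (x : E) {q : ℝ} (hq : 0 ≤ q) :
      ediam (closedBall x q) ≤ 2 * ENNReal.ofReal q := by
    rw [← closedEBall_ofReal hq]
    exact ediam_closedEBall_le
  filter_upwards [ae_lt_top (Measurable.tsum hHm) hfin] with p hp
  have hlim : Tendsto (fun j => H j p) atTop (𝓝 0) :=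
    ENNReal.tendsto_atTop_zero_of_tsum_ne_top hp.ne
  refine le_antisymm ?_ zero_le
  have hle := Measure.hausdorffMeasure_le_liminf_tsum (X := E) (l := atTop) (β := ℕ)
    (ι := fun j => {x : T j // p ∈ B j x}) ((N - d : ℕ) : ℝ) (g ⁻¹' {p} ∩ s)
    (fun j => ENNReal.ofReal (2 * (1 / (j + 1)))) ?_ (fun j x => closedBall x.1 (r j x.1)) ?_ ?_
  · refine hle.trans ?_
    rw [← hlim.liminf_eq]
    refine liminf_le_liminf (Eventually.of_forall fun j => ?_)
    calc _ ≤ ∑' x : {x : T j // p ∈ B j x}, ENNReal.ofReal (2 * r j x) ^ (N - d) := by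
          refine ENNReal.tsum_le_tsum fun x => ?_
          rw [ENNReal.rpow_natCast]
          gcongr
          refine (hediam _ (hrpos j _).le).trans ?_
          rw [ENNReal.ofReal_mul (by positivity), ENNReal.ofReal_ofNat]
      _ = H j p := by
          have := tsum_subtype {x : T j | p ∈ B j x} fun x => ENNReal.ofReal (2 * r j x) ^ (N - d)
          refine this.trans (tsum_congr fun x => ?_)
          by_cases hx : p ∈ B j x
          · rw [indicator_of_mem hx, indicator_of_mem (show x ∈ {x : T j | p ∈ B j x} from hx)]
          · rw [indicator_of_notMem hx,
              indicator_of_notMem (show x ∉ {x : T j | p ∈ B j x} from hx)]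
  · have h1 : Tendsto (fun j : ℕ => (2 : ℝ) * (1 / (j + 1))) atTop (𝓝 (2 * 0)) :=
      tendsto_one_div_add_atTop_nhds_zero_nat.const_mul 2
    have := ENNReal.tendsto_ofReal h1
    simpa using this
  · refine Eventually.of_forall fun j x => ?_
    refine (hediam _ (hrpos j _).le).trans ?_
    rw [ENNReal.ofReal_mul (by positivity), ENNReal.ofReal_ofNat]
    gcongr
    exact (hr j x.1 x.1.2).2.le
  · refine Eventually.of_forall fun j t ht => ?_
    obtain ⟨x, hx, htx⟩ := mem_iUnion₂.1 (hsub j ht.2)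
    refine mem_iUnion.2 ⟨⟨⟨x, hx⟩, ?_⟩, htx⟩
    have h1 := hg.dist_le_mul t ht.2 x (hTs j hx)
    have h2 : g t = p := ht.1
    rw [h2] at h1
    exact h1.trans (by gcongr; exact htx)

theorem ae_euclideanHausdorffMeasure_fibre_eq_zero
    (hdim : Module.finrank ℝ P ≤ Module.finrank ℝ E) {g : E → P} (hg : ContDiff ℝ 1 g)
    {s : Set E} (hs : volume s = 0) :
    ∀ᵐ p : P, μHE[Module.finrank ℝ E - Module.finrank ℝ P] (g ⁻¹' {p} ∩ s) = 0 := by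
  have h (n : ℕ) : ∀ᵐ p : P, μH[((Module.finrank ℝ E - Module.finrank ℝ P : ℕ) : ℝ)]
      (g ⁻¹' {p} ∩ (s ∩ closedBall 0 n)) = 0 := by
    obtain ⟨C, hC⟩ := LocallyLipschitzOn.exists_lipschitzOnWith_of_compact
      (isCompact_closedBall (0 : E) n) hg.locallyLipschitz.locallyLipschitzOn
    exact LipschitzOnWith.ae_hausdorffMeasure_fibre_eq_zero hdim (hC.mono inter_subset_right)
      (measure_mono_null inter_subset_left hs)
  filter_upwards [ae_all_iff.2 h] with p hp
  have hU : g ⁻¹' {p} ∩ s = ⋃ n : ℕ, g ⁻¹' {p} ∩ (s ∩ closedBall 0 n) := by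
    rw [← inter_iUnion, ← inter_iUnion, iUnion_closedBall_nat, inter_univ]
  rw [Measure.euclideanHausdorffMeasure_def, Measure.smul_apply, hU,
    measure_iUnion_null hp, smul_zero]

theorem CoareaOn.iUnion {g : E → P} (hg : Continuous g) {A : ℕ → Set E} {φ : E → ℝ≥0∞}
    (hA : ∀ i, MeasurableSet (A i)) (hd : Pairwise (Function.onFun Disjoint A))
    (h : ∀ i, CoareaOn g (A i) φ) : CoareaOn g (⋃ i, A i) φ := by
  have hfib (p : P) :
      ∫⁻ t in g ⁻¹' {p} ∩ ⋃ i, A i, φ t ∂μHE[Module.finrank ℝ E - Module.finrank ℝ P]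
        = ∑' i, ∫⁻ t in g ⁻¹' {p} ∩ A i, φ t ∂μHE[Module.finrank ℝ E - Module.finrank ℝ P] := by
    rw [inter_iUnion]
    refine lintegral_iUnion (fun i => ?_) (fun i j hij => ?_) _
    · exact (isClosed_singleton.preimage hg).measurableSet.inter (hA i)
    · exact (hd hij).mono inter_subset_right inter_subset_right
  constructor
  · simp_rw [hfib]
    exact AEMeasurable.tsum fun i => (h i).1
  · simp_rw [hfib]
    rw [lintegral_tsum fun i => (h i).1, lintegral_iUnion hA hd]
    exact tsum_congr fun i => (h i).2

theorem coareaOn_of_null (hdim : Module.finrank ℝ P ≤ Module.finrank ℝ E) {g : E → P}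
    (hg : ContDiff ℝ 1 g) {s : Set E} (hs : volume s = 0) (φ : E → ℝ≥0∞) : CoareaOn g s φ := by
  have h : ∀ᵐ p : P, ∫⁻ t in g ⁻¹' {p} ∩ s, φ t
      ∂μHE[Module.finrank ℝ E - Module.finrank ℝ P] = 0 := by
    filter_upwards [ae_euclideanHausdorffMeasure_fibre_eq_zero hdim hg hs] with p hp
    exact setLIntegral_measure_zero _ _ hp
  refine ⟨aemeasurable_const.congr (h.mono fun p hp => hp.symm), ?_⟩
  rw [setLIntegral_measure_zero _ _ hs, lintegral_congr_ae h, lintegral_zero]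

/-- Countably many straightening neighbourhoods cover `s`; made disjoint, they reduce the claim to
the local formula. -/
theorem coareaOn_of_surjective {g : E → P} (hg : ContDiff ℝ 1 g) {s : Set E} (hs : MeasurableSet s)
    (hsurj : ∀ t ∈ s, Function.Surjective (fderiv ℝ g t)) {φ : E → ℝ≥0∞} (hφ : Measurable φ) :
    CoareaOn g s φ := by
  have hloc (t) (ht : t ∈ s) : ∃ W, IsOpen W ∧ t ∈ W ∧ ∀ A ⊆ W, MeasurableSet A →
      CoareaOn g A φ := by
    obtain ⟨W, S, Θ, htW, h⟩ := exists_straightens hg (hsurj t ht)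
    exact ⟨W, h.isOpen_target, htW, fun A hAW hA => h.coareaOn hg hAW hA hφ⟩
  choose! W hWo hW0 hW using hloc
  obtain ⟨T, hTs, hT, hcov⟩ := TopologicalSpace.countable_cover_nhdsWithin
    (s := s) (f := W) fun u hu => mem_nhdsWithin_of_mem_nhds ((hWo u hu).mem_nhds (hW0 u hu))
  rcases T.eq_empty_or_nonempty with rfl | hTne
  · have : s = ∅ := by simpa [subset_empty_iff] using hcov
    simp [this, CoareaOn]
  obtain ⟨a, rfl⟩ := hT.exists_eq_range hTne
  have has (i) : a i ∈ s := hTs (mem_range_self i)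
  have hAm (i) : MeasurableSet (s ∩ disjointed (fun i => W (a i)) i) :=
    hs.inter (MeasurableSet.disjointed (fun i => (hWo _ (has i)).measurableSet) i)
  have hAU : ⋃ i, s ∩ disjointed (fun i => W (a i)) i = s := by
    rw [← inter_iUnion, iUnion_disjointed, inter_eq_left]
    refine hcov.trans ?_
    rw [biUnion_range]
  rw [← hAU]
  refine CoareaOn.iUnion hg.continuous hAm (fun i j hij => ?_) fun i =>
    hW _ (has i) _ (inter_subset_right.trans (disjointed_subset _ i)) (hAm i)
  exact ((disjoint_disjointed (fun i => W (a i))) hij).mono inter_subset_right inter_subset_right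

/-- The coarea formula, for a `C^1` map that is a submersion almost everywhere on `s`. -/
theorem coareaOn_of_ae_surjective {g : E → P} (hg : ContDiff ℝ 1 g) {s : Set E}
    (hdim : Module.finrank ℝ P ≤ Module.finrank ℝ E) (hs : MeasurableSet s)
    (hsurj : ∀ᵐ t, t ∈ s → Function.Surjective (fderiv ℝ g t)) {φ : E → ℝ≥0∞} (hφ : Measurable φ) :
    CoareaOn g s φ := by
  let Ω : Set E := {t | Function.Surjective (fderiv ℝ g t)}
  have hΩ : IsOpen Ω := by
    have hiff (L : E →L[ℝ] P) : Function.Surjective L ↔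
        Module.finrank ℝ P ≤ Module.finrank ℝ (LinearMap.range L.toLinearMap) := by
      constructor
      · intro h
        rw [LinearMap.range_eq_top.2 h, finrank_top]
      · intro h
        exact LinearMap.range_eq_top.1 (Submodule.eq_top_of_finrank_eq
          (le_antisymm (Submodule.finrank_le _) h))
    refine isOpen_iff_mem_nhds.2 fun t ht => ?_
    have := eventually_le_finrank_range (hg.continuous_fderiv one_ne_zero).continuousAt
      ((hiff _).1 ht)
    exact this.mono fun t' ht' => (hiff _).2 ht'
  -- The submersion points, the remaining null set, and empty sets that fill the sequence.
  let A : ℕ → Set E := fun i => if i = 0 then s ∩ Ω else if i = 1 then s \ Ω else ∅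
  have hU : ⋃ i, A i = s := by
    ext t
    simp only [mem_iUnion]
    constructor
    · rintro ⟨i, hi⟩
      simp only [A] at hi
      split_ifs at hi
      · exact hi.1
      · exact hi.1
      · exact hi.elim
    · intro ht
      by_cases h : t ∈ Ω
      · exact ⟨0, by simp [A, ht, h]⟩
      · exact ⟨1, by simp [A, ht, h]⟩
  rw [← hU]
  refine CoareaOn.iUnion hg.continuous (fun i => ?_) (fun i j hij => ?_) fun i => ?_
  · simp only [A]
    split_ifs
    · exact hs.inter hΩ.measurableSet
    · exact hs.diff hΩ.measurableSet
    · exact .empty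
  · rw [Function.onFun, Set.disjoint_left]
    intro t hi hj
    simp only [A] at hi hj
    split_ifs at hi hj <;> simp_all
  · simp only [A]
    split_ifs
    · exact coareaOn_of_surjective hg (hs.inter hΩ.measurableSet) (fun t ht => ht.2) hφ
    · refine coareaOn_of_null hdim hg ?_ φ
      refine measure_mono_null ?_ (ae_iff.1 hsurj)
      intro t ht h
      exact ht.2 (h ht.1)
    · exact coareaOn_of_null hdim hg measure_empty φ

end Coarea

end RandomSplitting

end

/-! ### Volume of the orbit in charts. -/

noncomputable section

open Filter Metric
open scoped Topology ContDiff

namespace RandomSplitting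

section TangentJacobian

variable {E F P : Type*} [NormedAddCommGroup E] [InnerProductSpace ℝ E] [FiniteDimensional ℝ E]
  [NormedAddCommGroup F] [InnerProductSpace ℝ F] [FiniteDimensional ℝ F]
  [NormedAddCommGroup P] [InnerProductSpace ℝ P] [FiniteDimensional ℝ P]

theorem normDet_adjoint (h : Module.finrank ℝ P = Module.finrank ℝ F) (S : P →L[ℝ] F) :
    (ContinuousLinearMap.adjoint S).toLinearMap.normDet = S.toLinearMap.normDet := by
  let bP := stdOrthonormalBasis ℝ P
  let bF := (stdOrthonormalBasis ℝ F).reindex (finCongr h.symm)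
  rw [LinearMap.normDet_eq_norm_det_toMatrix S.toLinearMap bP bF,
    LinearMap.normDet_eq_norm_det_toMatrix (ContinuousLinearMap.adjoint S).toLinearMap bF bP]
  have : (ContinuousLinearMap.adjoint S).toLinearMap = LinearMap.adjoint S.toLinearMap :=
    (ContinuousLinearMap.adjoint_toLinearMap S).symm
  rw [this, LinearMap.toMatrix_adjoint, Matrix.det_conjTranspose]
  simp

/-- The Jacobian of a map into a subspace `T`, if the map factors through a parametrization of `T`. -/
theorem sqrt_det_projection_comp_adjoint {T : Submodule ℝ F} {A : E →L[ℝ] F} {B : P →L[ℝ] F}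
    {G : E →L[ℝ] P} (hA : A = B ∘L G) (hB : ∀ p, B p ∈ T)
    (hT : Module.finrank ℝ P = Module.finrank ℝ T) :
    √(((T.orthogonalProjectionOnto ∘L A) ∘L
        ContinuousLinearMap.adjoint (T.orthogonalProjectionOnto ∘L A)).det)
      = B.toLinearMap.normDet * (ContinuousLinearMap.adjoint G).toLinearMap.normDet := by
  let S : P →L[ℝ] T := T.orthogonalProjectionOnto ∘L B
  have hSB : S.toLinearMap.normDet = B.toLinearMap.normDet := by
    rw [← LinearMap.normDet_codRestrict (f := B.toLinearMap) hB]
    congr 1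
    ext p
    exact congrArg Subtype.val (T.orthogonalProjectionOnto_mem_subspace_eq_self ⟨B p, hB p⟩)
  have hTA : T.orthogonalProjectionOnto ∘L A = S ∘L G := by
    rw [hA]; rfl
  have h1 := normDet_eq_sqrt (ContinuousLinearMap.adjoint (S ∘L G))
  rw [ContinuousLinearMap.adjoint_adjoint] at h1
  rw [hTA, ← h1, ContinuousLinearMap.adjoint_comp, ContinuousLinearMap.toLinearMap_comp,
    LinearMap.normDet_comp_of_finrank_eq _ _ hT.symm, normDet_adjoint hT, hSB, mul_comm]

end TangentJacobian

section OrbitVolume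

variable {D n d : ℕ} {V : Fin n → EuclideanSpace ℝ (Fin D) → EuclideanSpace ℝ (Fin D)}
  {x₀ : EuclideanSpace ℝ (Fin D)}

section Chart

variable {π : EuclideanSpace ℝ (Fin D) →L[ℝ] EuclideanSpace ℝ (Fin d)}
  {O : Set (EuclideanSpace ℝ (Fin d))} {σ : EuclideanSpace ℝ (Fin d) → Orbit V x₀}

theorem IsChart.hasFDerivAt (h : IsChart π O σ) {p : EuclideanSpace ℝ (Fin d)} (hp : p ∈ O) :
    HasFDerivAt (fun p => (σ p).1) (fderiv ℝ (fun p => (σ p).1) p) p :=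
  ((h.contDiffOn.contDiffAt (h.isOpen.mem_nhds hp)).differentiableAt one_ne_zero).hasFDerivAt

theorem IsChart.comp_fderiv (h : IsChart π O σ) {p : EuclideanSpace ℝ (Fin d)} (hp : p ∈ O) :
    π ∘L fderiv ℝ (fun p => (σ p).1) p = .id ℝ _ := by
  have h1 := π.hasFDerivAt.comp p (h.hasFDerivAt hp)
  refine h1.unique ((hasFDerivAt_id p).congr_of_eventuallyEq ?_)
  filter_upwards [h.isOpen.mem_nhds hp] with q hq using h.leftInv q hq

theorem IsChart.injective_fderiv (h : IsChart π O σ) {p : EuclideanSpace ℝ (Fin d)} (hp : p ∈ O) :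
    Function.Injective (fderiv ℝ (fun p => (σ p).1) p) := fun v w hvw => by
  have := congrArg π hvw
  rwa [← ContinuousLinearMap.comp_apply, ← ContinuousLinearMap.comp_apply, h.comp_fderiv hp] at this

theorem IsChart.injOn (h : IsChart π O σ) : InjOn (fun p => (σ p).1) O := fun p hp q hq hpq => by
  rw [← h.leftInv p hp, ← h.leftInv q hq]
  exact congrArg π hpq

end Chart

/-- The orbit is covered by charts. -/
def HasCharts (V : Fin n → EuclideanSpace ℝ (Fin D) → EuclideanSpace ℝ (Fin D))
    (x₀ : EuclideanSpace ℝ (Fin D)) (d : ℕ) : Prop :=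
  ∀ y : Orbit V x₀, ∃ (π : EuclideanSpace ℝ (Fin D) →L[ℝ] EuclideanSpace ℝ (Fin d))
    (O : Set (EuclideanSpace ℝ (Fin d))) (σ : EuclideanSpace ℝ (Fin d) → Orbit V x₀),
    IsChart π O σ ∧ y ∈ σ '' O

/-- The orbit is a countable union of continuous images of the spaces `ℝ^{kn}`. Hence countably many
charts cover it. -/
theorem isLindelof_univ_orbit : IsLindelof (univ : Set (Orbit V x₀)) := by
  have : (univ : Set (Orbit V x₀)) = ⋃ k : ℕ, range
      (fun t : Fin (k * n) → ℝ => (⟨steps V k x₀ t, k, t, rfl⟩ : Orbit V x₀)) := by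
    refine (eq_univ_of_forall fun y => ?_).symm
    obtain ⟨y, k, t, rfl⟩ := y
    exact mem_iUnion.2 ⟨k, t, rfl⟩
  rw [this]
  refine isLindelof_iUnion fun k => ?_
  rw [← image_univ]
  exact isLindelof_univ.image (continuous_steps_base k)

variable (hc : ∀ j, IsComplete (V j)) (hV : ∀ j, AnalyticOnNhd ℝ (V j) univ)
include hc hV

/-- A time of rank `d` yields an immersed `d`-dimensional family at one point; flows transport it to
every point of the orbit. -/
theorem hasCharts (xs : Orbit V x₀) (hd : Module.finrank ℝ (tangentSpace xs) = d)
    (hL : LieBracketCondition xs) : HasCharts V x₀ d := by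
  obtain ⟨m, t, -, hr⟩ := exists_le_finrank_range_timeDeriv hc hV xs hL
  rw [hd] at hr
  obtain ⟨ι, π, hπ⟩ := exists_comp_comp_eq_id _ hr
  let G₁ : EuclideanSpace ℝ (Fin d) → Orbit V x₀ := fun u => xs.timeMap m 1 (t + ι u)
  have hG₁ : IsReach G₁ := (isReach_timeMap m 1 xs).comp (contDiff_const.add ι.contDiff)
  have hi : Function.Injective (fderiv ℝ (fun u => (G₁ u).1) 0) := by
    have h1 : HasFDerivAt (fun u => (G₁ u).1) (timeDeriv m 1 xs t ∘L ι) 0 := by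
      have h2 : HasFDerivAt (fun u => t + ι u) ι 0 := ι.hasFDerivAt.const_add t
      refine HasFDerivAt.comp (g := fun t => (xs.timeMap m 1 t).1) 0 ?_ h2
      simp only [map_zero, add_zero]
      exact ((contDiff_timeMap hc hV m 1 xs).differentiable (by simp) t).hasFDerivAt
    rw [h1.fderiv]
    intro v w hvw
    have := congrArg π hvw
    rwa [← ContinuousLinearMap.comp_apply, ← ContinuousLinearMap.comp_apply, hπ] at this
  intro y
  obtain ⟨G, hG, hGy, hGi⟩ := exists_reach_immersion hc hV hG₁ hi y
  have := exists_chart hc hV (fun z => (finrank_tangentSpace_eq hc hV z xs).trans hd) hG hGi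
  rwa [hGy] at this

/-- The orbit topology may be finer than the induced one, so it is not automatic that Borel sets of
the orbit have Borel images. Within each of countably many charts, the image is that of a Borel set
of `ℝ^d` under an injective continuous map. -/
theorem measurableEmbedding_val (h : HasCharts V x₀ d) :
    MeasurableEmbedding fun y : Orbit V x₀ => y.1 := by
  refine ⟨fun y z hyz => Orbit.ext hyz, (continuous_val hc hV).measurable, fun s hs => ?_⟩
  choose π O σ hσ hy using h
  obtain ⟨T, hT, -, hcov⟩ := isLindelof_univ_orbit.elim_nhds_subcover
    (fun y : Orbit V x₀ => σ y '' O y) fun y _ => (hσ y).isOpen_image.mem_nhds (hy y)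
  have hs' : s = ⋃ y ∈ T, s ∩ σ y '' O y := by
    rw [← inter_iUnion₂, inter_eq_left.2 ((subset_univ s).trans hcov)]
  rw [hs', image_iUnion₂]
  refine MeasurableSet.biUnion hT fun y _ => ?_
  have : (fun y : Orbit V x₀ => y.1) '' (s ∩ σ y '' O y)
      = (fun p => (σ y p).1) '' (O y ∩ σ y ⁻¹' s) := by
    rw [inter_comm s, ← image_inter_preimage, image_image]
  rw [this]
  refine MeasurableSet.image_of_continuousOn_injOn
    (ContinuousOn.measurableSet_inter_preimage (hσ y).continuousOn (hσ y).isOpen.measurableSet hs)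
    ((hσ y).contDiffOn.continuousOn.mono inter_subset_left)
    ((hσ y).injOn.mono inter_subset_left)

theorem orbitVolume_apply (h : HasCharts V x₀ d) {s : Set (Orbit V x₀)} :
    orbitVolume V x₀ d s = μHE[d] ((fun y : Orbit V x₀ => y.1) '' s) :=
  (measurableEmbedding_val hc hV h).comap_apply _ _

/-- In a chart, the volume of the orbit has the Jacobian of the parametrization as density. -/
theorem IsChart.map_orbitVolume (hcharts : HasCharts V x₀ d)
    {π : EuclideanSpace ℝ (Fin D) →L[ℝ] EuclideanSpace ℝ (Fin d)}
    {O : Set (EuclideanSpace ℝ (Fin d))} {σ : EuclideanSpace ℝ (Fin d) → Orbit V x₀}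
    (h : IsChart π O σ) :
    ((orbitVolume V x₀ d).restrict (σ '' O)).map (fun y => π y.1)
      = (volume.restrict O).withDensity fun p => jacobian (fderiv ℝ (fun p => (σ p).1) p) := by
  have hm : Measurable fun y : Orbit V x₀ => π y.1 :=
    (π.continuous.comp (continuous_val hc hV)).measurable
  ext B hB
  rw [Measure.map_apply hm hB, Measure.restrict_apply (hm hB), withDensity_apply _ hB,
    Measure.restrict_restrict hB, orbitVolume_apply hc hV hcharts]
  have : (fun y : Orbit V x₀ => y.1) '' ((fun y => π y.1) ⁻¹' B ∩ σ '' O)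
      = (fun p => (σ p).1) '' (B ∩ O) := by
    ext z
    constructor
    · rintro ⟨_, ⟨hB, p, hp, rfl⟩, rfl⟩
      refine ⟨p, ⟨?_, hp⟩, rfl⟩
      rw [← h.leftInv p hp]
      exact hB
    · rintro ⟨p, ⟨hB, hp⟩, rfl⟩
      refine ⟨σ p, ⟨?_, p, hp, rfl⟩, rfl⟩
      rw [mem_preimage, h.leftInv p hp]
      exact hB
  rw [this]
  have := euclideanHausdorffMeasure_image_eq_lintegral h.isOpen h.contDiffOn h.injOn
    (fun p hp => h.injective_fderiv hp) inter_subset_right (hB.inter h.isOpen.measurableSet)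
  rwa [finrank_euclideanSpace_fin] at this

end OrbitVolume

end RandomSplitting

end

/-! ### The coarea formula on the orbit. -/

noncomputable section

open Filter Metric
open scoped Topology ContDiff

namespace RandomSplitting

section OrbitCoarea

variable {D n d : ℕ} {V : Fin n → EuclideanSpace ℝ (Fin D) → EuclideanSpace ℝ (Fin D)}
  {x₀ : EuclideanSpace ℝ (Fin D)}

/-- The Jacobian `√(det M)` of `t ↦ Φ^m(x, h t)` as a map to the orbit. -/
def timeJacobian (m : ℕ) (h : ℝ) (x : Orbit V x₀) (t : EuclideanSpace ℝ (Fin (m * n))) : ℝ≥0∞ :=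
  ENNReal.ofReal √((gram m h x t).det)

variable (hc : ∀ j, IsComplete (V j)) (hV : ∀ j, AnalyticOnNhd ℝ (V j) univ)
  (hd : ∀ y : Orbit V x₀, Module.finrank ℝ (tangentSpace y) = d)
include hc hV hd

theorem isSubmersionAt_iff {m : ℕ} {h : ℝ} {x : Orbit V x₀} {t : EuclideanSpace ℝ (Fin (m * n))} :
    IsSubmersionAt m h x t ↔
      d ≤ Module.finrank ℝ (LinearMap.range (timeDeriv m h x t).toLinearMap) := by
  constructor
  · intro hs
    rw [hs.2, hd]
  · intro hr
    refine ⟨(contDiff_timeMap hc hV m h x).differentiable (by simp) t, ?_⟩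
    exact Submodule.eq_of_le_of_finrank_le (range_timeDeriv_le hc hV m h x t) (by rwa [hd])

theorem isOpen_setOf_isSubmersionAt (m : ℕ) (h : ℝ) (x : Orbit V x₀) :
    IsOpen {t | IsSubmersionAt m h x t} := by
  refine isOpen_iff_mem_nhds.2 fun t ht => ?_
  have hcont : Continuous (timeDeriv m h x) :=
    (contDiff_timeMap hc hV m h x).continuous_fderiv (by simp)
  have := eventually_le_finrank_range hcont.continuousAt ((isSubmersionAt_iff hc hV hd).1 ht)
  exact this.mono fun t' ht' => (isSubmersionAt_iff hc hV hd).2 ht'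

omit hd in
-- If `det (A A^*)` is nonzero, then `A A^*`, and with it `A`, is onto the tangent space.
theorem timeJacobian_eq_zero {m : ℕ} {h : ℝ} {x : Orbit V x₀} {t : EuclideanSpace ℝ (Fin (m * n))}
    (hs : ¬ IsSubmersionAt m h x t) : timeJacobian m h x t = 0 := by
  suffices (gram m h x t).det = 0 by rw [timeJacobian, this, Real.sqrt_zero, ENNReal.ofReal_zero]
  by_contra hne
  refine hs ⟨(contDiff_timeMap hc hV m h x).differentiable (by simp) t, ?_⟩
  refine le_antisymm (range_timeDeriv_le hc hV m h x t) fun v hv => ?_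
  have hunit : IsUnit (gram m h x t).toLinearMap :=
    LinearMap.isUnit_iff_isUnit_det _ |>.2 (isUnit_iff_ne_zero.2 hne)
  obtain ⟨w, hw⟩ := ((Module.End.isUnit_iff _).1 hunit).2 ⟨v, hv⟩
  let u := ContinuousLinearMap.adjoint (timeDerivTangent m h x t) w
  refine ⟨u, ?_⟩
  have h1 : timeDerivTangent m h x t u = ⟨v, hv⟩ := hw
  have h2 := (tangentSpace (x.timeMap m h t)).orthogonalProjectionOnto_mem_subspace_eq_self
    ⟨timeDeriv m h x t u, range_timeDeriv_le hc hV m h x t ⟨u, rfl⟩⟩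
  have h3 : timeDerivTangent m h x t u
      = ⟨timeDeriv m h x t u, range_timeDeriv_le hc hV m h x t ⟨u, rfl⟩⟩ := h2
  exact congrArg Subtype.val (h3.symm.trans h1)

section Factor

variable {π : EuclideanSpace ℝ (Fin D) →L[ℝ] EuclideanSpace ℝ (Fin d)}
  {O : Set (EuclideanSpace ℝ (Fin d))} {σ : EuclideanSpace ℝ (Fin d) → Orbit V x₀}
  {m : ℕ} {h : ℝ} {x : Orbit V x₀}

omit hd in
theorem IsChart.timeDeriv_eq (hσ : IsChart π O σ) {t : EuclideanSpace ℝ (Fin (m * n))}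
    (ht : ∀ᶠ t' in 𝓝 t, π (x.timeMap m h t').1 ∈ O ∧
      x.timeMap m h t' = σ (π (x.timeMap m h t').1)) :
    timeDeriv m h x t = fderiv ℝ (fun p => (σ p).1) (π (x.timeMap m h t).1)
      ∘L fderiv ℝ (fun t => π (x.timeMap m h t).1) t := by
  have hF := (contDiff_timeMap hc hV m h x).differentiable (by simp) t
  have hg : DifferentiableAt ℝ (fun t => π (x.timeMap m h t).1) t := π.differentiableAt.comp t hF
  have h1 := HasFDerivAt.comp (g := fun p => (σ p).1) t (hσ.hasFDerivAt ht.self_of_nhds.1)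
    hg.hasFDerivAt
  refine (h1.congr_of_eventuallyEq ?_).fderiv
  filter_upwards [ht] with t' ht'
  exact congrArg Orbit.val ht'.2

theorem IsChart.surjective_fderiv (hσ : IsChart π O σ) {t : EuclideanSpace ℝ (Fin (m * n))}
    (ht : ∀ᶠ t' in 𝓝 t, π (x.timeMap m h t').1 ∈ O ∧
      x.timeMap m h t' = σ (π (x.timeMap m h t').1)) (hs : IsSubmersionAt m h x t) :
    Function.Surjective (fderiv ℝ (fun t => π (x.timeMap m h t).1) t) := by
  have h1 := (isSubmersionAt_iff hc hV hd).1 hs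
  rw [hσ.timeDeriv_eq hc hV ht, ContinuousLinearMap.toLinearMap_comp, LinearMap.range_comp] at h1
  have h2 := h1.trans (Submodule.finrank_map_le _ _)
  refine LinearMap.range_eq_top.1 (Submodule.eq_top_of_finrank_eq
    (le_antisymm (Submodule.finrank_le _) ?_))
  rwa [finrank_euclideanSpace_fin]

/-- The factor from the chart is the density of the orbit volume in the chart; the other factor is
the coarea Jacobian of the coordinate map. This reduces the formula on the orbit to the Euclidean
one. -/
theorem IsChart.timeJacobian_eq (hσ : IsChart π O σ) {t : EuclideanSpace ℝ (Fin (m * n))}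
    (ht : ∀ᶠ t' in 𝓝 t, π (x.timeMap m h t').1 ∈ O ∧
      x.timeMap m h t' = σ (π (x.timeMap m h t').1)) (hs : IsSubmersionAt m h x t) :
    timeJacobian m h x t = jacobian (fderiv ℝ (fun p => (σ p).1) (π (x.timeMap m h t).1))
      * jacobian (ContinuousLinearMap.adjoint (fderiv ℝ (fun t => π (x.timeMap m h t).1) t)) := by
  have hder := hσ.timeDeriv_eq hc hV ht
  rw [jacobian, jacobian, ← ENNReal.ofReal_mul (LinearMap.normDet_nonneg _),
    ← sqrt_det_projection_comp_adjoint (T := tangentSpace (x.timeMap m h t)) hder ?_ ?_]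
  · rfl
  · intro p
    obtain ⟨v, rfl⟩ := hσ.surjective_fderiv hc hV hd ht hs p
    rw [← ContinuousLinearMap.comp_apply, ← hder]
    exact range_timeDeriv_le hc hV m h x t ⟨v, rfl⟩
  · rw [finrank_euclideanSpace_fin, hd]

/-- The coarea formula for `t ↦ Φ^m(x, h t)` on a set that is mapped into a single chart. -/
theorem IsChart.coarea (hcharts : HasCharts V x₀ d) (hdm : d ≤ m * n) (hσ : IsChart π O σ)
    {W : Set (EuclideanSpace ℝ (Fin (m * n)))} (hWo : IsOpen W)
    (hW : ∀ t ∈ W, π (x.timeMap m h t).1 ∈ O ∧ x.timeMap m h t = σ (π (x.timeMap m h t).1))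
    (hae : ∀ᵐ t, IsSubmersionAt m h x t) {s : Set (EuclideanSpace ℝ (Fin (m * n)))} (hsW : s ⊆ W)
    (hs : MeasurableSet s) {q : EuclideanSpace ℝ (Fin (m * n)) → ℝ≥0∞} (hq : Measurable q) :
    AEMeasurable (fun y => ∫⁻ t in x.timeMap m h ⁻¹' {y} ∩ s, q t / timeJacobian m h x t
      ∂μHE[m * n - d]) (orbitVolume V x₀ d) ∧
    ∫⁻ t in s, q t = ∫⁻ y, ∫⁻ t in x.timeMap m h ⁻¹' {y} ∩ s, q t / timeJacobian m h x t
      ∂μHE[m * n - d] ∂(orbitVolume V x₀ d) := by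
  set g := fun t => π (x.timeMap m h t).1 with hgdef
  set Jσ := fun p => jacobian (fderiv ℝ (fun p => (σ p).1) p) with hJσ
  set Jg := fun t => jacobian (ContinuousLinearMap.adjoint (fderiv ℝ g t)) with hJg
  set Ω := {t | IsSubmersionAt m h x t} with hΩ
  have hΩm : MeasurableSet Ω := (isOpen_setOf_isSubmersionAt hc hV hd m h x).measurableSet
  have hg : ContDiff ℝ 1 g :=
    (π.contDiff.comp (contDiff_timeMap hc hV m h x)).of_le (by simp)
  have hWev (t) (ht : t ∈ W) : ∀ᶠ t' in 𝓝 t, π (x.timeMap m h t').1 ∈ O ∧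
      x.timeMap m h t' = σ (π (x.timeMap m h t').1) := by
    filter_upwards [hWo.mem_nhds ht] with t' ht' using hW t' ht'
  have hJσm : Measurable Jσ := continuous_jacobian.measurable.comp (measurable_fderiv ℝ _)
  have hJgm : Measurable Jg := (continuous_jacobian.comp
    (ContinuousLinearMap.adjoint.continuous.comp (hg.continuous_fderiv one_ne_zero))).measurable
  have hJF (t) (ht : t ∈ W) :
      timeJacobian m h x t = Ω.indicator (fun t => Jσ (g t) * Jg t) t := by
    by_cases htΩ : t ∈ Ω
    · rw [indicator_of_mem htΩ]
      exact hσ.timeJacobian_eq hc hV hd (hWev t ht) htΩ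
    · rw [indicator_of_notMem htΩ]
      exact timeJacobian_eq_zero hc hV htΩ
  -- `timeJacobian` involves tangent spaces that vary with `t`, so its measurability is not evident.
  -- On `W` it equals the indicator in the denominator, which is measurable.
  let φ₁ : EuclideanSpace ℝ (Fin (m * n)) → ℝ≥0∞ :=
    fun t => q t / Ω.indicator (fun t => Jσ (g t) * Jg t) t
  have hφ₁ : Measurable φ₁ :=
    hq.div (((hJσm.comp hg.continuous.measurable).mul hJgm).indicator hΩm)
  have hφ₂ : Measurable fun t => Jσ (g t) * φ₁ t := (hJσm.comp hg.continuous.measurable).mul hφ₁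
  have hsurj : ∀ᵐ t, t ∈ s → Function.Surjective (fderiv ℝ g t) := by
    filter_upwards [hae] with t ht hts
    exact hσ.surjective_fderiv hc hV hd (hWev t (hsW hts)) ht
  have hdim : Module.finrank ℝ (EuclideanSpace ℝ (Fin d))
      ≤ Module.finrank ℝ (EuclideanSpace ℝ (Fin (m * n))) := by
    simpa using hdm
  -- Two integrands are needed: `φ₁` gives measurability of the fibre integral, and `Jσ ∘ g` times
  -- `φ₁` gives the identity, where `Jσ` is constant on fibres and becomes the volume density.
  obtain ⟨hΨm, -⟩ := coareaOn_of_ae_surjective hg hdim hs hsurj hφ₁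
  obtain ⟨-, hco⟩ := coareaOn_of_ae_surjective hg hdim hs hsurj hφ₂
  simp only [finrank_euclideanSpace_fin] at hΨm hco
  set Ψ : EuclideanSpace ℝ (Fin d) → ℝ≥0∞ :=
    fun p => ∫⁻ t in g ⁻¹' {p} ∩ s, φ₁ t ∂μHE[m * n - d] with hΨ
  have hfibm (p) : MeasurableSet (g ⁻¹' {p} ∩ s) :=
    (isClosed_singleton.preimage hg.continuous).measurableSet.inter hs
  have hΨ₂ (p) : ∫⁻ t in g ⁻¹' {p} ∩ s, Jσ (g t) * φ₁ t ∂μHE[m * n - d] = Jσ p * Ψ p := by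
    rw [hΨ, ← lintegral_const_mul _ hφ₁]
    refine setLIntegral_congr_fun (hfibm p) fun t ht => ?_
    rw [show g t = p from ht.1]
  -- Inside `s` the fibres of the map to the orbit are those of its coordinate map `g`, and they are
  -- empty over points outside the chart.
  have hψ : (fun y => ∫⁻ t in x.timeMap m h ⁻¹' {y} ∩ s, q t / timeJacobian m h x t
      ∂μHE[m * n - d]) = (σ '' O).indicator fun y => Ψ (π y.1) := by
    funext y
    by_cases hy : y ∈ σ '' O
    · rw [indicator_of_mem hy]
      have hset : x.timeMap m h ⁻¹' {y} ∩ s = g ⁻¹' {π y.1} ∩ s := by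
        ext t
        refine and_congr_left fun hts => ⟨fun ht => ?_, fun ht => ?_⟩
        · have : x.timeMap m h t = y := ht
          simp [hgdef, this]
        · obtain ⟨p, hp, rfl⟩ := hy
          have h1 : g t = π (σ p).1 := ht
          rw [hσ.leftInv p hp] at h1
          change x.timeMap m h t = σ p
          rw [(hW t (hsW hts)).2, ← h1]
      rw [hset]
      refine setLIntegral_congr_fun (hfibm _) fun t ht => ?_
      simp only [φ₁]
      rw [hJF t (hsW ht.2)]
    · rw [indicator_of_notMem hy]
      have hset : x.timeMap m h ⁻¹' {y} ∩ s = ∅ := by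
        refine eq_empty_of_forall_notMem fun t ht => hy ?_
        have h1 : x.timeMap m h t = y := ht.1
        have h2 := hW t (hsW ht.2)
        exact ⟨_, h2.1, by rw [← h2.2, h1]⟩
      rw [hset, Measure.restrict_empty, lintegral_zero_measure]
  have hA : MeasurableSet (σ '' O) := hσ.isOpen_image.measurableSet
  have hmap := hσ.map_orbitVolume hc hV hcharts
  have hκ : Measurable fun y : Orbit V x₀ => π y.1 :=
    (π.continuous.comp (continuous_val hc hV)).measurable
  have hΨm' : AEMeasurable Ψ
      (((orbitVolume V x₀ d).restrict (σ '' O)).map (fun y => π y.1)) := by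
    rw [hmap]
    exact hΨm.restrict.mono_ac (withDensity_absolutelyContinuous _ _)
  rw [hψ]
  refine ⟨(aemeasurable_indicator_iff hA).2 (hΨm'.comp_measurable hκ), ?_⟩
  rw [lintegral_indicator hA, ← lintegral_map' hΨm' hκ.aemeasurable, hmap,
    lintegral_withDensity_eq_lintegral_mul₀ hJσm.aemeasurable hΨm.restrict]
  simp only [Pi.mul_apply]
  simp_rw [hΨ₂] at hco
  have hO : ∫⁻ p in O, Jσ p * Ψ p = ∫⁻ p, Jσ p * Ψ p := by
    rw [← lintegral_indicator hσ.isOpen.measurableSet]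
    refine lintegral_congr fun p => ?_
    by_cases hp : p ∈ O
    · rw [indicator_of_mem hp]
    · rw [indicator_of_notMem hp]
      have hset : g ⁻¹' {p} ∩ s = ∅ := by
        refine eq_empty_of_forall_notMem fun t ht => hp ?_
        have h1 : g t = p := ht.1
        rw [← h1]
        exact (hW t (hsW ht.2)).1
      simp only [hΨ]
      rw [hset, Measure.restrict_empty, lintegral_zero_measure, mul_zero]
  rw [hO, ← hco]
  refine lintegral_congr_ae ((ae_restrict_iff' hs).2 ?_)
  filter_upwards [hae] with t htΩ hts
  have h1 := hWev t (hsW hts)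
  have hσ0 : Jσ (g t) ≠ 0 := jacobian_ne_zero (hσ.injective_fderiv h1.self_of_nhds.1)
  have hg0 : Jg t ≠ 0 := by
    refine jacobian_ne_zero ?_
    have hsu := hσ.surjective_fderiv hc hV hd h1 htΩ
    rw [injective_iff_map_eq_zero]
    intro p hp
    obtain ⟨v, hv⟩ := hsu p
    have : inner ℝ p (fderiv ℝ g t v) = 0 := by
      rw [← ContinuousLinearMap.adjoint_inner_left, hp, inner_zero_left]
    rw [hv] at this
    exact inner_self_eq_zero.1 this
  simp only [φ₁]
  rw [indicator_of_mem (show t ∈ Ω from htΩ), ← mul_assoc, mul_comm (Jg t)]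
  exact (ENNReal.mul_div_cancel (mul_ne_zero hσ0 hg0)
    (ENNReal.mul_ne_top (jacobian_ne_top _) (jacobian_ne_top _))).symm

end Factor

/-- The coarea formula for `t ↦ Φ^m(x, h t)`. -/
theorem coarea_timeMap (hcharts : HasCharts V x₀ d) {m : ℕ} {h : ℝ} {x : Orbit V x₀}
    (hdm : d ≤ m * n) (hae : ∀ᵐ t, IsSubmersionAt m h x t)
    {q : EuclideanSpace ℝ (Fin (m * n)) → ℝ≥0∞} (hq : Measurable q) :
    AEMeasurable (fun y => ∫⁻ t in x.timeMap m h ⁻¹' {y}, q t / timeJacobian m h x t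
      ∂μHE[m * n - d]) (orbitVolume V x₀ d) ∧
    ∫⁻ t, q t = ∫⁻ y, ∫⁻ t in x.timeMap m h ⁻¹' {y}, q t / timeJacobian m h x t
      ∂μHE[m * n - d] ∂(orbitVolume V x₀ d) := by
  have hloc (t : EuclideanSpace ℝ (Fin (m * n))) :
      ∃ W, IsOpen W ∧ t ∈ W ∧ ∀ s ⊆ W, MeasurableSet s →
        AEMeasurable (fun y => ∫⁻ t in x.timeMap m h ⁻¹' {y} ∩ s, q t / timeJacobian m h x t
          ∂μHE[m * n - d]) (orbitVolume V x₀ d) ∧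
        ∫⁻ t in s, q t = ∫⁻ y, ∫⁻ t in x.timeMap m h ⁻¹' {y} ∩ s, q t / timeJacobian m h x t
          ∂μHE[m * n - d] ∂(orbitVolume V x₀ d) := by
    obtain ⟨π, O, σ, hσ, ht⟩ := hcharts (x.timeMap m h t)
    obtain ⟨W, hWs, hWo, htW⟩ :=
      _root_.mem_nhds_iff.1 (hσ.eventually_factor (isReach_timeMap m h x) t ht)
    exact ⟨W, hWo, htW, fun s hsW hs =>
      hσ.coarea hc hV hd hcharts hdm hWo (fun t ht => hWs ht) hae hsW hs hq⟩
  choose W hWo hW0 hW using hloc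
  obtain ⟨T, hT, hcov⟩ := TopologicalSpace.countable_cover_nhds
    fun t => (hWo t).mem_nhds (hW0 t)
  have hTne : T.Nonempty := by
    by_contra hne
    rw [not_nonempty_iff_eq_empty.1 hne] at hcov
    have : (0 : EuclideanSpace ℝ (Fin (m * n))) ∈ (univ : Set _) := mem_univ _
    rw [← hcov] at this
    simp at this
  obtain ⟨a, rfl⟩ := hT.exists_eq_range hTne
  let A : ℕ → Set (EuclideanSpace ℝ (Fin (m * n))) := disjointed fun i => W (a i)
  have hAm (i) : MeasurableSet (A i) :=
    MeasurableSet.disjointed (fun i => (hWo _).measurableSet) i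
  have hAd : Pairwise (Function.onFun Disjoint A) := disjoint_disjointed _
  have hAU : ⋃ i, A i = univ := by
    rw [iUnion_disjointed, ← hcov, biUnion_range]
  have hfm (y : Orbit V x₀) : MeasurableSet (x.timeMap m h ⁻¹' {y}) := by
    have : x.timeMap m h ⁻¹' {y} = (fun t => (x.timeMap m h t).1) ⁻¹' {y.1} := by
      ext t
      exact ⟨fun ht => congrArg Orbit.val ht, fun ht => Orbit.ext ht⟩
    rw [this]
    exact (isClosed_singleton.preimage (contDiff_timeMap hc hV m h x).continuous).measurableSet
  have hfib (y : Orbit V x₀) :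
      ∫⁻ t in x.timeMap m h ⁻¹' {y}, q t / timeJacobian m h x t ∂μHE[m * n - d]
        = ∑' i, ∫⁻ t in x.timeMap m h ⁻¹' {y} ∩ A i, q t / timeJacobian m h x t
          ∂μHE[m * n - d] := by
    conv_lhs => rw [← inter_univ (x.timeMap m h ⁻¹' {y}), ← hAU, inter_iUnion]
    refine lintegral_iUnion (fun i => (hfm y).inter (hAm i)) (fun i j hij => ?_) _
    exact (hAd hij).mono inter_subset_right inter_subset_right
  have hAW (i) := hW (a i) (A i) (disjointed_subset _ i) (hAm i)
  simp_rw [hfib]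
  refine ⟨AEMeasurable.tsum fun i => (hAW i).1, ?_⟩
  rw [lintegral_tsum fun i => (hAW i).1, ← setLIntegral_univ, ← hAU, lintegral_iUnion hAm hAd]
  exact tsum_congr fun i => (hAW i).2

end OrbitCoarea

end RandomSplitting

end

/-! ### Uniform density bounds for families of submersions. -/

noncomputable section

open Filter Metric
open scoped Topology ContDiff

namespace RandomSplitting

section UniformBound

variable {E' E P : Type*} [NormedAddCommGroup E'] [NormedSpace ℝ E']
  [NormedAddCommGroup E] [InnerProductSpace ℝ E] [FiniteDimensional ℝ E]
  [NormedAddCommGroup P] [InnerProductSpace ℝ P] [FiniteDimensional ℝ P]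
  [MeasurableSpace E] [BorelSpace E] [MeasurableSpace P] [BorelSpace P]

/-- The image of Lebesgue measure under a submersion that depends on a parameter has, locally, a
density that is bounded uniformly in the parameter. -/
theorem exists_lintegral_comp_le {g : E' × E → P} (hg : ContDiff ℝ 1 g) {s₁ : E'} {t₀ : E}
    (hsurj : Function.Surjective (fderiv ℝ (fun t => g (s₁, t)) t₀)) :
    ∃ B, IsOpen B ∧ t₀ ∈ B ∧ ∃ C : ℝ≥0∞, C ≠ ⊤ ∧ ∀ᶠ s in 𝓝 s₁, ∀ φ : P → ℝ≥0∞, Measurable φ →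
      ∫⁻ t in B, φ (g (s, t)) ≤ C * ∫⁻ p, φ p := by
  have hg₁ : ContDiff ℝ 1 fun t => g (s₁, t) := hg.comp (contDiff_prodMk_right s₁)
  set G₀ := fderiv ℝ (fun t => g (s₁, t)) t₀ with hG₀
  let K := LinearMap.ker G₀.toLinearMap
  obtain ⟨M, hM⟩ := exists_equiv_prod_ker hsurj
  let c := (WithLp.prodContinuousLinearEquiv 2 ℝ P K).symm.toContinuousLinearMap
  -- The complement `K` is the kernel at the base point and serves all parameters near `s₁`, so `Ψ
  -- (s, ·)` straightens all these maps at once.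
  let Ψ : E' × E → WithLp 2 (P × K) := fun v => c (g v, K.orthogonalProjectionOnto v.2)
  have hΨ : ContDiff ℝ 1 Ψ := c.contDiff.comp
    (hg.prodMk ((ContinuousLinearMap.contDiff _).comp contDiff_snd))
  have hΨt (s : E') (t : E) :
      HasFDerivAt (fun t => Ψ (s, t)) (fderiv ℝ Ψ (s, t) ∘L .inr ℝ E' E) t :=
    HasFDerivAt.comp (g := Ψ) t (hΨ.differentiable one_ne_zero (s, t)).hasFDerivAt
      (hasFDerivAt_prodMk_right (𝕜 := ℝ) s t)
  have hM₀ : fderiv ℝ Ψ (s₁, t₀) ∘L .inr ℝ E' E = M.toContinuousLinearMap := by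
    refine (hΨt s₁ t₀).unique ?_
    have h1 : HasFDerivAt (fun t => Ψ (s₁, t)) (c ∘L (G₀.prod K.orthogonalProjectionOnto)) t₀ :=
      c.hasFDerivAt.comp t₀ ((hg₁.differentiable one_ne_zero t₀).hasFDerivAt.prodMk
        (ContinuousLinearMap.hasFDerivAt _))
    convert h1 using 1
    ext1 t
    exact hM t
  have hfin : Module.finrank ℝ (WithLp 2 (P × K)) = Module.finrank ℝ E :=
    M.symm.toLinearEquiv.finrank_eq
  -- An approximation error below `‖M⁻¹‖⁻¹` makes `Ψ (s, ·)` injective on one neighbourhood `B` for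
  -- all `s` near `s₁`.
  obtain ⟨ε, hε, hεM⟩ : ∃ ε : ℝ≥0, 0 < ε ∧
      (Subsingleton E ∨ ε < ‖(M.symm : WithLp 2 (P × K) →L[ℝ] E)‖₊⁻¹) := by
    rcases subsingleton_or_nontrivial E with h | h
    · exact ⟨1, one_pos, Or.inl h⟩
    · have hpos : 0 < ‖(M.symm : WithLp 2 (P × K) →L[ℝ] E)‖₊⁻¹ := inv_pos.2 M.nnnorm_symm_pos
      exact ⟨_, half_pos hpos, Or.inr (half_lt_self hpos)⟩
  obtain ⟨W₁, hW₁, happ⟩ := (hΨ.contDiffAt.hasStrictFDerivAt one_ne_zero :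
    HasStrictFDerivAt Ψ _ (s₁, t₀)).approximates_deriv_on_nhds (c := ε) (Or.inr hε)
  have hDc : Continuous fun v : E' × E => jacobian (fderiv ℝ Ψ v ∘L .inr ℝ E' E) :=
    continuous_jacobian.comp ((hΨ.continuous_fderiv one_ne_zero).clm_comp continuous_const)
  set J₀ := jacobian M.toContinuousLinearMap
  have hJ₀ : J₀ ≠ 0 := jacobian_ne_zero M.injective
  have hJ₀t : J₀ ≠ ⊤ := jacobian_ne_top _
  have hJ₀2 : J₀ / 2 ≠ 0 := (ENNReal.half_pos hJ₀).ne'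
  have hJev : ∀ᶠ v in 𝓝 (s₁, t₀), J₀ / 2 < jacobian (fderiv ℝ Ψ v ∘L .inr ℝ E' E) := by
    refine hDc.continuousAt.eventually_const_lt ?_
    change _ < jacobian (fderiv ℝ Ψ (s₁, t₀) ∘L .inr ℝ E' E)
    rw [hM₀]
    exact ENNReal.half_lt_self hJ₀ hJ₀t
  have hev := (show ∀ᶠ v in 𝓝 (s₁, t₀), v ∈ W₁ from hW₁).and hJev
  rw [nhds_prod_eq, eventually_prod_iff] at hev
  obtain ⟨pa, hpa, pb, hpb, hab⟩ := hev
  have hproj : ∀ᶠ t in 𝓝 t₀, K.orthogonalProjectionOnto t ∈ ball (K.orthogonalProjectionOnto t₀) 1 :=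
    K.orthogonalProjectionOnto.continuous.continuousAt.eventually (ball_mem_nhds _ one_pos)
  obtain ⟨B, hBs, hBo, hB0⟩ := _root_.mem_nhds_iff.1 (hpb.and hproj)
  set Q := ball (K.orthogonalProjectionOnto t₀) 1
  -- On `B` the Jacobian of `Ψ (s, ·)` is at least `J₀ / 2`, and the image lies in `P × Q` with `Q`
  -- a unit ball of `K`; the constant comes from these two facts.
  refine ⟨B, hBo, hB0, (J₀ / 2)⁻¹ * volume Q, ENNReal.mul_ne_top (ENNReal.inv_ne_top.2 hJ₀2)
    measure_ball_lt_top.ne, ?_⟩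
  filter_upwards [hpa] with s hs φ hφ
  have hΨs : ContDiff ℝ 1 fun t => Ψ (s, t) := hΨ.comp (contDiff_prodMk_right s)
  have hinj : InjOn (fun t => Ψ (s, t)) B := by
    have happs : ApproximatesLinearOn (fun t => Ψ (s, t)) (M : E →L[ℝ] WithLp 2 (P × K)) B ε := by
      intro t ht t' ht'
      have h1 := happ (s, t) (hab hs (hBs ht).1).1 (s, t') (hab hs (hBs ht').1).1
      have h2 : fderiv ℝ Ψ (s₁, t₀) ((s, t) - (s, t')) = M (t - t') := by
        rw [Prod.mk_sub_mk, sub_self]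
        exact congrArg (fun L => L (t - t')) hM₀
      rw [h2, Prod.mk_sub_mk, sub_self] at h1
      refine h1.trans (le_of_eq ?_)
      simp
    exact happs.injOn hεM
  have hderiv (t) : fderiv ℝ (fun t => Ψ (s, t)) t = fderiv ℝ Ψ (s, t) ∘L .inr ℝ E' E :=
    (hΨt s t).fderiv
  have hlow (t) (ht : t ∈ B) : J₀ / 2 ≤ jacobian (fderiv ℝ (fun t => Ψ (s, t)) t) := by
    rw [hderiv]
    exact (hab hs (hBs ht).1).2.le
  have hi (t) (ht : t ∈ B) : Function.Injective (fderiv ℝ (fun t => Ψ (s, t)) t) := by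
    refine ((LinearMap.normDet_ne_zero_tfae _).out 0 4).1 fun h0 => ?_
    have h1 := hlow t ht
    rw [jacobian, h0, ENNReal.ofReal_zero] at h1
    exact hJ₀2 (le_antisymm h1 zero_le)
  have hφ' : Measurable fun z : WithLp 2 (P × K) => φ z.fst :=
    hφ.comp (WithLp.fstL 2 ℝ P K).continuous.measurable
  have harea := lintegral_image_euclideanHausdorffMeasure hBo hΨs.contDiffOn hinj hi subset_rfl
    hBo.measurableSet hφ'
  rw [← hfin, InnerProductSpace.euclideanHausdorffMeasure_eq_volume] at harea
  have hQ : MeasurableSet {z : WithLp 2 (P × K) | z.snd ∈ Q} :=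
    (WithLp.sndL 2 ℝ P K).continuous.measurable measurableSet_ball
  calc ∫⁻ t in B, φ (g (s, t))
      = (J₀ / 2)⁻¹ * ∫⁻ t in B, J₀ / 2 * φ (g (s, t)) := by
        rw [lintegral_const_mul' _ _ (ENNReal.div_ne_top hJ₀t two_ne_zero), ← mul_assoc,
          ENNReal.inv_mul_cancel hJ₀2 (ENNReal.div_ne_top hJ₀t two_ne_zero), one_mul]
    _ ≤ (J₀ / 2)⁻¹ * ∫⁻ t in B, jacobian (fderiv ℝ (fun t => Ψ (s, t)) t) * φ (Ψ (s, t)).fst := by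
        refine mul_le_mul_right ?_ _
        refine setLIntegral_mono' hBo.measurableSet fun t ht => ?_
        exact mul_le_mul_left (hlow t ht) _
    _ = (J₀ / 2)⁻¹ * ∫⁻ z in (fun t => Ψ (s, t)) '' B, φ z.fst := by rw [harea]
    _ ≤ (J₀ / 2)⁻¹ * ∫⁻ z in {z : WithLp 2 (P × K) | z.snd ∈ Q}, φ z.fst := by
        gcongr
        rintro _ ⟨t, ht, rfl⟩
        exact (hBs ht).2
    _ = (J₀ / 2)⁻¹ * ((∫⁻ p, φ p) * volume Q) := by
        congr 1
        rw [← lintegral_indicator hQ, ← (WithLp.volume_preserving_toLp P K).lintegral_comp_emb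
          (MeasurableEquiv.toLp 2 (P × K)).measurableEmbedding]
        have h1 := lintegral_prod_mul (μ := (volume : Measure P)) (ν := (volume : Measure K))
          hφ.aemeasurable
          ((measurable_const (a := (1 : ℝ≥0∞))).indicator (measurableSet_ball (x :=
            K.orthogonalProjectionOnto t₀) (ε := 1))).aemeasurable
        rw [lintegral_indicator measurableSet_ball, setLIntegral_one] at h1
        rw [← h1]
        refine lintegral_congr fun v => ?_
        by_cases hv : v.2 ∈ Q
        · rw [indicator_of_mem hv, indicator_of_mem
            (show WithLp.toLp 2 v ∈ {z : WithLp 2 (P × K) | z.snd ∈ Q} from hv), mul_one]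
          rfl
        · rw [indicator_of_notMem hv, indicator_of_notMem
            (show WithLp.toLp 2 v ∉ {z : WithLp 2 (P × K) | z.snd ∈ Q} from hv), mul_zero]
    _ = _ := by ring

end UniformBound

end RandomSplitting

end

/-! ### The strong Feller property. -/

noncomputable section

open Filter Metric
open scoped Topology ContDiff

namespace RandomSplitting

theorem continuousAt_of_edist_approx {X : Type*} [TopologicalSpace X] {F : X → ℝ} {x : X}
    (h : ∀ ε : ℝ≥0∞, 0 < ε → ∃ G : X → ℝ, ContinuousAt G x ∧ ∀ᶠ y in 𝓝 x, ‖F y - G y‖ₑ < ε) :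
    ContinuousAt F x := by
  refine continuousAt_of_locally_uniform_approx_of_continuousAt fun u hu => ?_
  obtain ⟨ε, hε, hεu⟩ := mem_uniformity_edist.1 hu
  obtain ⟨G, hG, hFG⟩ := h ε hε
  exact ⟨_, hFG, G, hG, fun y hy => hεu (by rw [edist_eq_enorm_sub]; exact hy)⟩

section Euclidean

variable {E' E P : Type*} [NormedAddCommGroup E'] [NormedSpace ℝ E']
  [NormedAddCommGroup E] [InnerProductSpace ℝ E] [FiniteDimensional ℝ E]
  [NormedAddCommGroup P] [InnerProductSpace ℝ P] [FiniteDimensional ℝ P]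
  [MeasurableSpace E] [BorelSpace E] [MeasurableSpace P] [BorelSpace P]

/-- Replace `f` by a continuous function that is `L¹`-close. The hypothesis `hbound` makes the error
small uniformly in `s` near `s₁`, and for continuous `f` dominated convergence applies. -/
theorem continuousAt_setIntegral_comp {g : E' × E → P} (hg : Continuous g) {s₁ : E'} {B : Set E}
    (hBf : volume B ≠ ⊤) {C : ℝ≥0∞} (hC : C ≠ ⊤)
    (hbound : ∀ᶠ s in 𝓝 s₁, ∀ φ : P → ℝ≥0∞, Measurable φ →
      ∫⁻ t in B, φ (g (s, t)) ≤ C * ∫⁻ p, φ p)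
    {f : P → ℝ} (hf : Measurable f) (hfi : Integrable f) {q : E → ℝ} (hq : Measurable q) {M : ℝ≥0}
    (hqM : ∀ t, ‖q t‖ₑ ≤ M) :
    ContinuousAt (fun s => ∫ t in B, f (g (s, t)) * q t) s₁ := by
  refine continuousAt_of_edist_approx fun ε hε => ?_
  obtain ⟨δ, hδ, hδε⟩ := ENNReal.exists_nnreal_pos_mul_lt
    (ENNReal.mul_ne_top (ENNReal.coe_ne_top (r := M)) hC) hε.ne'
  obtain ⟨fc, hfcs, hfcd, hfcc, hfci⟩ := hfi.exists_hasCompactSupport_lintegral_sub_le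
    (ε := δ) (by exact_mod_cast hδ.ne')
  obtain ⟨R, hR⟩ := hfcc.bounded_above_of_compact_support hfcs
  have hgm (s : E') : Measurable fun t => g (s, t) :=
    (hg.comp (Continuous.prodMk_right s)).measurable
  have : IsFiniteMeasure (volume.restrict B) :=
    ⟨by rw [Measure.restrict_apply_univ]; exact hBf.lt_top⟩
  have hqR (t) : ‖q t‖ ≤ M := by
    have := hqM t
    rw [enorm_eq_nnnorm] at this
    exact_mod_cast this
  have hintg (s : E') : Integrable (fun t => fc (g (s, t)) * q t) (volume.restrict B) := by
    refine Integrable.of_bound (C := R * M)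
      ((hfcc.measurable.comp (hgm s)).mul hq).aestronglyMeasurable (ae_of_all _ fun t => ?_)
    rw [norm_mul]
    exact mul_le_mul (hR _) (hqR t) (norm_nonneg _) ((norm_nonneg _).trans (hR 0))
  refine ⟨fun s => ∫ t in B, fc (g (s, t)) * q t, ?_, ?_⟩
  · refine continuousAt_of_dominated (bound := fun _ => R * M)
      (Eventually.of_forall fun s => (hintg s).aestronglyMeasurable)
      (Eventually.of_forall fun s => ae_of_all _ fun t => ?_) (integrable_const _)
      (ae_of_all _ fun t => ?_)
    · rw [norm_mul]
      exact mul_le_mul (hR _) (hqR t) (norm_nonneg _) ((norm_nonneg _).trans (hR 0))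
    · exact ((hfcc.comp (hg.comp (Continuous.prodMk_left t))).mul continuous_const).continuousAt
  · filter_upwards [hbound] with s hs
    have hfm : Measurable fun t => f (g (s, t)) * q t := (hf.comp (hgm s)).mul hq
    have hfint : Integrable (fun t => f (g (s, t)) * q t) (volume.restrict B) := by
      refine ⟨hfm.aestronglyMeasurable, ?_⟩
      rw [hasFiniteIntegral_iff_enorm]
      calc ∫⁻ t in B, ‖f (g (s, t)) * q t‖ₑ ≤ ∫⁻ t in B, ‖f (g (s, t))‖ₑ * M := by
            refine lintegral_mono fun t => ?_
            rw [enorm_mul]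
            exact mul_le_mul_right (hqM t) _
        _ = (∫⁻ t in B, ‖f (g (s, t))‖ₑ) * M := lintegral_mul_const' _ _ ENNReal.coe_ne_top
        _ ≤ (C * ∫⁻ p, ‖f p‖ₑ) * M := mul_le_mul_left (hs _ hf.enorm) _
        _ < ⊤ := ENNReal.mul_lt_top (ENNReal.mul_lt_top hC.lt_top hfi.2) ENNReal.coe_lt_top
    rw [← integral_sub hfint (hintg s)]
    refine (enorm_integral_le_lintegral_enorm _).trans_lt ?_
    calc ∫⁻ t in B, ‖f (g (s, t)) * q t - fc (g (s, t)) * q t‖ₑ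
        ≤ ∫⁻ t in B, ‖f (g (s, t)) - fc (g (s, t))‖ₑ * M := by
          refine lintegral_mono fun t => ?_
          rw [← sub_mul, enorm_mul]
          exact mul_le_mul_right (hqM t) _
      _ = (∫⁻ t in B, ‖f (g (s, t)) - fc (g (s, t))‖ₑ) * M :=
          lintegral_mul_const' _ _ ENNReal.coe_ne_top
      _ ≤ (C * ∫⁻ p, ‖f p - fc p‖ₑ) * M :=
          mul_le_mul_left (hs (fun p => ‖f p - fc p‖ₑ) (hf.sub hfcc.measurable).enorm) _
      _ ≤ (C * δ) * M := by gcongr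
      _ = δ * (M * C) := by ring
      _ < ε := hδε

end Euclidean

section Orbit

variable {D n d : ℕ} {V : Fin n → EuclideanSpace ℝ (Fin D) → EuclideanSpace ℝ (Fin D)}
  {x₀ : EuclideanSpace ℝ (Fin D)} {E' : Type} [NormedAddCommGroup E'] [NormedSpace ℝ E']
  [FiniteDimensional ℝ E'] {A : E' → Orbit V x₀} {m : ℕ} {h : ℝ}

theorem IsReach.timeMap (hA : IsReach A) (m : ℕ) (h : ℝ) :
    IsReach fun v : E' × EuclideanSpace ℝ (Fin (m * n)) => (A v.1).timeMap m h v.2 :=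
  (hA.comp contDiff_fst).steps (contDiff_pi.2 fun k => contDiff_const.mul
    ((EuclideanSpace.proj (𝕜 := ℝ) k).contDiff.comp contDiff_snd))

variable (hc : ∀ j, IsComplete (V j)) (hV : ∀ j, AnalyticOnNhd ℝ (V j) univ)
  (hd : ∀ y : Orbit V x₀, Module.finrank ℝ (tangentSpace y) = d)
include hc hV hd

theorem IsReach.exists_nhds_continuousAt_setIntegral (hA : IsReach A)
    (hcharts : HasCharts V x₀ d) {s₁ : E'} {t₀ : EuclideanSpace ℝ (Fin (m * n))}
    (ht₀ : IsSubmersionAt m h (A s₁) t₀) {f : Orbit V x₀ → ℝ} (hf : IsBddMeasurable f)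
    {q : EuclideanSpace ℝ (Fin (m * n)) → ℝ} (hq : Measurable q) {M : ℝ≥0}
    (hqM : ∀ t, ‖q t‖ₑ ≤ M) :
    ∃ W, IsOpen W ∧ t₀ ∈ W ∧ ∀ B ⊆ W, MeasurableSet B →
      ContinuousAt (fun s => ∫ t in B, f ((A s).timeMap m h t) * q t) s₁ := by
  classical
  obtain ⟨hfm, R, hR⟩ := hf
  have hΓ := hA.timeMap m h
  obtain ⟨π, O, σ, hσ, hy⟩ := hcharts ((A s₁).timeMap m h t₀)
  have hfac := hσ.eventually_factor hΓ (s₁, t₀) hy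
  let g : E' × EuclideanSpace ℝ (Fin (m * n)) → EuclideanSpace ℝ (Fin d) :=
    fun v => π ((A v.1).timeMap m h v.2).1
  have hg : ContDiff ℝ 1 g := (π.contDiff.comp (hΓ.contDiff hc hV)).of_le (by simp)
  have hslice : ∀ᶠ t in 𝓝 t₀, π ((A s₁).timeMap m h t).1 ∈ O ∧
      (A s₁).timeMap m h t = σ (π ((A s₁).timeMap m h t).1) :=
    (Continuous.prodMk_right s₁).continuousAt.eventually hfac
  obtain ⟨W₁, hW₁o, hW₁0, C, hC, hbound⟩ :=
    exists_lintegral_comp_le hg (hσ.surjective_fderiv hc hV hd hslice ht₀)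
  have hball : ∀ᶠ v in 𝓝 (s₁, t₀), g v ∈ ball (g (s₁, t₀)) 1 :=
    hg.continuous.continuousAt.eventually (ball_mem_nhds _ one_pos)
  have hev := hfac.and hball
  rw [nhds_prod_eq, eventually_prod_iff] at hev
  obtain ⟨pa, hpa, pb, hpb, hab⟩ := hev
  obtain ⟨W, hWs, hWo, hW0⟩ := _root_.mem_nhds_iff.1
    (inter_mem (inter_mem hpb (hW₁o.mem_nhds hW₁0)) (ball_mem_nhds t₀ one_pos))
  refine ⟨W, hWo, hW0, fun B hBW hB => ?_⟩
  let O' := O ∩ ball (g (s₁, t₀)) 1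
  have hO'm : MeasurableSet O' := hσ.isOpen.measurableSet.inter measurableSet_ball
  -- The function `f` in the chart. Cutting off to a ball makes it integrable. The constant value
  -- off `O'` only serves measurability, since nothing is known of `σ` outside `O`.
  let f' : EuclideanSpace ℝ (Fin d) → ℝ :=
    O'.indicator fun p => f (O'.piecewise σ (fun _ => A s₁) p)
  have hf' : Measurable f' := by
    refine Measurable.indicator (hfm.comp ?_) hO'm
    exact (hσ.continuousOn.mono inter_subset_left).measurable_piecewise continuousOn_const hO'm
  have hf'i : Integrable f' := by
    have hfin : IsFiniteMeasure (volume.restrict O') :=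
      ⟨by
        rw [Measure.restrict_apply_univ]
        exact (measure_mono inter_subset_right).trans_lt measure_ball_lt_top⟩
    rw [integrable_indicator_iff hO'm]
    refine Integrable.of_bound (C := R) ?_ (ae_of_all _ fun p => hR _)
    exact (hfm.comp ((hσ.continuousOn.mono inter_subset_left).measurable_piecewise
      continuousOn_const hO'm)).aestronglyMeasurable
  have hBf : volume B ≠ ⊤ := by
    refine ne_top_of_le_ne_top (measure_ball_lt_top (x := t₀) (r := 1)).ne (measure_mono ?_)
    exact fun t ht => (hWs (hBW ht)).2
  have hbound' : ∀ᶠ s in 𝓝 s₁, ∀ φ : EuclideanSpace ℝ (Fin d) → ℝ≥0∞, Measurable φ →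
      ∫⁻ t in B, φ (g (s, t)) ≤ C * ∫⁻ p, φ p := by
    filter_upwards [hbound] with s hs φ hφ
    exact (lintegral_mono_set fun t ht => (hWs (hBW ht)).1.2).trans (hs φ hφ)
  have hcont := continuousAt_setIntegral_comp hg.continuous hBf hC hbound' hf' hf'i hq hqM
  refine hcont.congr ?_
  filter_upwards [hpa] with s hs
  refine setIntegral_congr_fun hB fun t ht => ?_
  have h1 := hab hs (hWs (hBW ht)).1.1
  have h2 : g (s, t) ∈ O' := ⟨h1.1.1, h1.2⟩
  have h3 : f' (g (s, t)) = f ((A s).timeMap m h t) := by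
    simp only [f']
    rw [indicator_of_mem h2, piecewise_eq_of_mem _ _ _ h2]
    exact congrArg f h1.1.2.symm
  simp only [h3]

/-- As `f` is bounded, replacing `q` by a compactly supported continuous function costs an error
uniform in `s`. The submersion times are then cut into countably many pieces on which continuity is
local. -/
theorem IsReach.continuousAt_integral_timeMap (hA : IsReach A) (hcharts : HasCharts V x₀ d)
    {s₁ : E'} (hae : ∀ᵐ t, IsSubmersionAt m h (A s₁) t) {f : Orbit V x₀ → ℝ}
    (hf : IsBddMeasurable f) {q : EuclideanSpace ℝ (Fin (m * n)) → ℝ} (hq : Integrable q) :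
    ContinuousAt (fun s => ∫ t, f ((A s).timeMap m h t) * q t) s₁ := by
  obtain ⟨R, hR⟩ := hf.2
  have hR0 : 0 ≤ R := (abs_nonneg _).trans (hR (A s₁))
  have hRe (y) : ‖f y‖ₑ ≤ ENNReal.ofReal R := by
    rw [← ofReal_norm]
    exact ENNReal.ofReal_le_ofReal (hR y)
  have hm (s) : Measurable fun t => f ((A s).timeMap m h t) :=
    hf.1.comp (isReach_timeMap m h (A s)).continuous.measurable
  have hintg (s) {q : EuclideanSpace ℝ (Fin (m * n)) → ℝ} (hq : Integrable q) :
      Integrable fun t => f ((A s).timeMap m h t) * q t :=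
    hq.bdd_mul (hm s).aestronglyMeasurable (ae_of_all _ fun t => hR _)
  refine continuousAt_of_edist_approx fun ε hε => ?_
  obtain ⟨δ, hδ, hδε⟩ := ENNReal.exists_nnreal_pos_mul_lt
    (ENNReal.ofReal_ne_top (r := R)) hε.ne'
  obtain ⟨qc, hqcs, hqcd, hqcc, hqci⟩ := hq.exists_hasCompactSupport_lintegral_sub_le
    (ε := δ) (by exact_mod_cast hδ.ne')
  refine ⟨fun s => ∫ t, f ((A s).timeMap m h t) * qc t, ?_, Eventually.of_forall fun s => ?_⟩
  · obtain ⟨M, hM⟩ := hqcc.bounded_above_of_compact_support hqcs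
    have hMe (t) : ‖qc t‖ₑ ≤ M.toNNReal := by
      rw [← ofReal_norm]
      exact ENNReal.ofReal_le_ofReal (hM t)
    choose! W hWo hW0 hW using fun (t : EuclideanSpace ℝ (Fin (m * n)))
      (ht : IsSubmersionAt m h (A s₁) t) => hA.exists_nhds_continuousAt_setIntegral hc hV hd
        hcharts ht hf hqcc.measurable hMe
    set Ω := {t | IsSubmersionAt m h (A s₁) t}
    have hΩo : IsOpen Ω := isOpen_setOf_isSubmersionAt hc hV hd m h (A s₁)
    obtain ⟨T, hTΩ, hT, hcov⟩ := TopologicalSpace.countable_cover_nhdsWithin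
      (s := Ω) (f := W) fun t ht => mem_nhdsWithin_of_mem_nhds ((hWo t ht).mem_nhds (hW0 t ht))
    have hΩne : Ω.Nonempty := hae.exists
    have hTne : T.Nonempty := by
      obtain ⟨t, ht⟩ := hΩne
      obtain ⟨t', ht', -⟩ := mem_iUnion₂.1 (hcov ht)
      exact ⟨t', ht'⟩
    obtain ⟨a, rfl⟩ := hT.exists_eq_range hTne
    have haΩ (i) : a i ∈ Ω := hTΩ (mem_range_self i)
    let B : ℕ → Set (EuclideanSpace ℝ (Fin (m * n))) :=
      fun i => Ω ∩ disjointed (fun i => W (a i)) i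
    have hBm (i) : MeasurableSet (B i) := hΩo.measurableSet.inter
      (MeasurableSet.disjointed (fun i => (hWo _ (haΩ i)).measurableSet) i)
    have hBd : Pairwise (Function.onFun Disjoint B) := fun i j hij =>
      (disjoint_disjointed (fun i => W (a i)) hij).mono inter_subset_right inter_subset_right
    have hBU : ⋃ i, B i = Ω := by
      rw [← inter_iUnion, iUnion_disjointed, inter_eq_left]
      refine hcov.trans ?_
      rw [biUnion_range]
    have hΩae : Ω =ᵐ[volume] univ := eventuallyEq_univ.2 hae
    have hsum (F : EuclideanSpace ℝ (Fin (m * n)) → ℝ) (hF : Integrable F) :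
        HasSum (fun i => ∫ t in B i, F t) (∫ t, F t) := by
      have := hasSum_integral_iUnion hBm hBd (f := F) (μ := volume) hF.integrableOn
      rwa [hBU, setIntegral_congr_set hΩae, setIntegral_univ] at this
    have hsum' (s : E') : ∫ t, f ((A s).timeMap m h t) * qc t
        = ∑' i, ∫ t in B i, f ((A s).timeMap m h t) * qc t :=
      (hsum _ (hintg s hqci)).tsum_eq.symm
    simp_rw [hsum']
    -- The pieces are chosen at `s₁` and do not depend on `s`, so the terms are dominated by one
    -- summable sequence.
    refine tendsto_tsum_of_dominated_convergence
      (bound := fun i => ∫ t in B i, R * ‖qc t‖) (hsum _ (hqci.norm.const_mul R)).summable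
      (fun i => ?_) (Eventually.of_forall fun s i => ?_)
    · exact hW _ (haΩ i) _ (inter_subset_right.trans (disjointed_subset _ i)) (hBm i)
    · refine norm_integral_le_of_norm_le (hqci.norm.const_mul R).integrableOn
        (ae_of_all _ fun t => ?_)
      rw [norm_mul]
      exact mul_le_mul_of_nonneg_right (hR _) (norm_nonneg _)
  · rw [← integral_sub (hintg s hq) (hintg s hqci)]
    refine (enorm_integral_le_lintegral_enorm _).trans_lt ?_
    calc ∫⁻ t, ‖f ((A s).timeMap m h t) * q t - f ((A s).timeMap m h t) * qc t‖ₑ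
        ≤ ∫⁻ t, ENNReal.ofReal R * ‖q t - qc t‖ₑ := by
          refine lintegral_mono fun t => ?_
          rw [← mul_sub, enorm_mul]
          exact mul_le_mul_left (hRe _) _
      _ = ENNReal.ofReal R * ∫⁻ t, ‖q t - qc t‖ₑ := lintegral_const_mul' _ _ ENNReal.ofReal_ne_top
      _ ≤ ENNReal.ofReal R * δ := by gcongr
      _ < ε := by rwa [mul_comm]

theorem continuousOn_integral_timeMap (hcharts : HasCharts V x₀ d) {U : Set (Orbit V x₀)}
    (hU : IsOpen U) (hae : ∀ x ∈ U, ∀ᵐ t, IsSubmersionAt m h x t) {f : Orbit V x₀ → ℝ}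
    (hf : IsBddMeasurable f) {q : EuclideanSpace ℝ (Fin (m * n)) → ℝ} (hq : Integrable q) :
    ContinuousOn (fun x : Orbit V x₀ => ∫ t, f (x.timeMap m h t) * q t) U := by
  refine (continuousOn_open_iff hU).2 fun N hN => isOpen_orbit_iff.2 fun k =>
    isOpen_iff_mem_nhds.2 fun s hs => ?_
  have h1 := (isReach_base (V := V) (x₀ := x₀) k).continuousAt_integral_timeMap hc hV hd
    hcharts (hae _ hs.1) hf hq
  exact inter_mem ((continuous_steps_base k).continuousAt.preimage_mem_nhds (hU.mem_nhds hs.1))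
    (h1.preimage_mem_nhds (hN.mem_nhds hs.2))

end Orbit

end RandomSplitting

end

/-! ### Iterates of the transition operator and the law of the end point. -/

noncomputable section

open Filter Metric
open scoped Topology ContDiff

namespace RandomSplitting

section TimesLaw

theorem lintegral_fin_prod : ∀ (N : ℕ) (f : Fin N → ℝ → ℝ≥0∞), (∀ i, Measurable (f i)) →
    ∫⁻ t : Fin N → ℝ, ∏ i, f i (t i) = ∏ i, ∫⁻ s, f i s
  | 0, f, _ => by simp [volume_pi]
  | N + 1, f, hf => by
    have he := (volume_preserving_piFinSuccAbove (fun _ : Fin (N + 1) => ℝ) 0).symm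
    rw [← he.lintegral_comp_emb (MeasurableEquiv.measurableEmbedding _), Fin.prod_univ_succ,
      ← lintegral_fin_prod N (fun i => f i.succ) fun i => hf _]
    have h1 := lintegral_prod_mul (μ := (volume : Measure ℝ)) (ν := (volume : Measure (Fin N → ℝ)))
      (hf 0).aemeasurable (g := fun t => ∏ i, f i.succ (t i))
      (Finset.measurable_prod _ fun i _ => (hf i.succ).comp (measurable_pi_apply i)).aemeasurable
    refine Eq.trans (lintegral_congr fun v => ?_) h1
    rw [Fin.prod_univ_succ]
    rfl

theorem timesLaw_eq_withDensity (N : ℕ) {ρ : ℝ → ℝ≥0} (hρ : IsProbDensity ρ) :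
    timesLaw N ρ = volume.withDensity fun t => ((∏ k, ρ (t k) : ℝ≥0) : ℝ≥0∞) := by
  have : IsProbabilityMeasure (volume.withDensity fun s => (ρ s : ℝ≥0∞)) :=
    ⟨by rw [withDensity_apply _ .univ, setLIntegral_univ, hρ.2]⟩
  refine Measure.pi_eq fun s hs => ?_
  rw [withDensity_apply _ (.univ_pi hs), ← lintegral_indicator (.univ_pi hs)]
  have h1 (i) : volume.withDensity (fun s => (ρ s : ℝ≥0∞)) (s i)
      = ∫⁻ r, (s i).indicator (fun r => (ρ r : ℝ≥0∞)) r := by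
    rw [withDensity_apply _ (hs i), lintegral_indicator (hs i)]
  simp_rw [h1]
  rw [← lintegral_fin_prod N _ fun i => hρ.1.coe_nnreal_ennreal.indicator (hs i)]
  refine lintegral_congr fun t => ?_
  by_cases ht : t ∈ univ.pi s
  · rw [indicator_of_mem ht, ENNReal.ofNNReal_finsetProd]
    exact Finset.prod_congr rfl fun i _ => (indicator_of_mem (ht i (mem_univ i))
      fun r => (ρ r : ℝ≥0∞)).symm
  · rw [indicator_of_notMem ht]
    obtain ⟨i, hi⟩ : ∃ i, t i ∉ s i := by
      by_contra hcon
      push Not at hcon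
      exact ht fun i _ => hcon i
    exact (Finset.prod_eq_zero (Finset.mem_univ i) (indicator_of_notMem hi _)).symm

theorem isProbabilityMeasure_timesLaw (N : ℕ) {ρ : ℝ → ℝ≥0} (hρ : IsProbDensity ρ) :
    IsProbabilityMeasure (timesLaw N ρ) := by
  have : IsProbabilityMeasure (volume.withDensity fun s => (ρ s : ℝ≥0∞)) :=
    ⟨by rw [withDensity_apply _ .univ, setLIntegral_univ, hρ.2]⟩
  unfold timesLaw
  infer_instance

theorem integral_timesLaw {N : ℕ} {ρ : ℝ → ℝ≥0} (hρ : IsProbDensity ρ) (G : (Fin N → ℝ) → ℝ) :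
    ∫ s, G s ∂timesLaw N ρ
      = ∫ t : EuclideanSpace ℝ (Fin N), G t.ofLp * ((∏ k, ρ (t k) : ℝ≥0) : ℝ) := by
  have hm : Measurable fun t : Fin N → ℝ => ∏ k, ρ (t k) :=
    Finset.measurable_prod _ fun k _ => hρ.1.comp (measurable_pi_apply k)
  rw [timesLaw_eq_withDensity N hρ, integral_withDensity_eq_integral_smul hm,
    ← (PiLp.volume_preserving_ofLp (Fin N)).integral_comp
      (MeasurableEquiv.toLp 2 (Fin N → ℝ)).symm.measurableEmbedding]
  refine integral_congr_ae (ae_of_all _ fun t => ?_)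
  simp only [NNReal.smul_def, smul_eq_mul]
  exact mul_comm _ _

theorem lintegral_prod_density {N : ℕ} {ρ : ℝ → ℝ≥0} (hρ : IsProbDensity ρ) :
    ∫⁻ t : EuclideanSpace ℝ (Fin N), ∏ k, (ρ (t k) : ℝ≥0∞) = 1 := by
  have h := lintegral_fin_prod N (fun _ s => (ρ s : ℝ≥0∞)) fun _ => hρ.1.coe_nnreal_ennreal
  rw [← (PiLp.volume_preserving_ofLp (Fin N)).lintegral_comp_emb
    (MeasurableEquiv.toLp 2 (Fin N → ℝ)).symm.measurableEmbedding] at h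
  simpa [hρ.2] using h

/-- The times of `m + 1` steps split into those of the first step and those of the other ones. -/
def consTimesEquiv (m n : ℕ) : Fin n ⊕ Fin (m * n) ≃ Fin ((m + 1) * n) :=
  finSumFinEquiv.trans (finCongr (by ring))

theorem consTimesEquiv_inl (m : ℕ) {n : ℕ} (j : Fin n) :
    consTimesEquiv m n (.inl j) = finProdFinEquiv (0, j) := by
  ext
  simp [consTimesEquiv, finProdFinEquiv]

theorem consTimesEquiv_inr {m n : ℕ} (i : Fin m) (j : Fin n) :
    consTimesEquiv m n (.inr (finProdFinEquiv (i, j))) = finProdFinEquiv (i.succ, j) := by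
  ext
  simp [consTimesEquiv, finProdFinEquiv]
  ring

/-- The law of the times of `m + 1` steps is the product of the laws for `1` and `m` steps. -/
theorem integral_timesLaw_succ {m n : ℕ} {ρ : ℝ → ℝ≥0} (hρ : IsProbDensity ρ)
    {G : (Fin ((m + 1) * n) → ℝ) → ℝ} (hG : Measurable G) {C : ℝ} (hC : ∀ t, |G t| ≤ C) :
    ∫ t, G t ∂timesLaw ((m + 1) * n) ρ = ∫ s, ∫ t, G (fun k =>
      Sum.elim s t ((consTimesEquiv m n).symm k)) ∂timesLaw (m * n) ρ ∂timesLaw n ρ := by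
  have : IsProbabilityMeasure (volume.withDensity fun s => (ρ s : ℝ≥0∞)) :=
    ⟨by rw [withDensity_apply _ .univ, setLIntegral_univ, hρ.2]⟩
  have := isProbabilityMeasure_timesLaw n hρ
  have := isProbabilityMeasure_timesLaw (m * n) hρ
  let μ : Measure ℝ := volume.withDensity fun s => (ρ s : ℝ≥0∞)
  have h1 := measurePreserving_piCongrLeft (fun _ : Fin ((m + 1) * n) => μ) (consTimesEquiv m n)
  have h2 := measurePreserving_sumPiEquivProdPi_symm (fun _ : Fin n ⊕ Fin (m * n) => μ)
  have h3 := h1.comp h2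
  have hemb : MeasurableEmbedding
      (MeasurableEquiv.piCongrLeft (fun _ : Fin ((m + 1) * n) => ℝ) (consTimesEquiv m n) ∘
        (MeasurableEquiv.sumPiEquivProdPi fun _ : Fin n ⊕ Fin (m * n) => ℝ).symm) :=
    (MeasurableEquiv.measurableEmbedding _).comp (MeasurableEquiv.measurableEmbedding _)
  have h4 := h3.integral_comp hemb G
  have hval (v : (Fin n → ℝ) × (Fin (m * n) → ℝ)) :
      (MeasurableEquiv.piCongrLeft (fun _ : Fin ((m + 1) * n) => ℝ) (consTimesEquiv m n) ∘
        (MeasurableEquiv.sumPiEquivProdPi fun _ : Fin n ⊕ Fin (m * n) => ℝ).symm) v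
      = fun k => Sum.elim v.1 v.2 ((consTimesEquiv m n).symm k) := by
    funext k
    obtain ⟨i, rfl⟩ := (consTimesEquiv m n).surjective k
    rw [Equiv.symm_apply_apply]
    have := Equiv.piCongrLeft_apply_apply (fun _ : Fin ((m + 1) * n) => ℝ) (consTimesEquiv m n)
      ((MeasurableEquiv.sumPiEquivProdPi fun _ : Fin n ⊕ Fin (m * n) => ℝ).symm v) i
    refine this.trans ?_
    cases i <;> rfl
  simp_rw [hval] at h4
  change ∫ t, G t ∂Measure.pi (fun _ : Fin ((m + 1) * n) => μ) = _
  rw [← h4]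
  refine integral_prod _ (Integrable.of_bound (C := C) ?_ (ae_of_all _ fun v => hC _))
  have : Measurable fun v : (Fin n → ℝ) × (Fin (m * n) → ℝ) => fun k =>
      Sum.elim v.1 v.2 ((consTimesEquiv m n).symm k) := by
    rw [← funext hval]
    exact hemb.measurable
  exact (hG.comp this).aestronglyMeasurable

end TimesLaw

section Transition

variable {D n d : ℕ} {V : Fin n → EuclideanSpace ℝ (Fin D) → EuclideanSpace ℝ (Fin D)}
  {x₀ : EuclideanSpace ℝ (Fin D)}

theorem Orbit.steps_cons (m : ℕ) (x : Orbit V x₀) (s : Fin n → ℝ) (t : Fin (m * n) → ℝ) :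
    x.steps (m + 1) (fun k => Sum.elim s t ((consTimesEquiv m n).symm k)) = (x.step s).steps m t := by
  refine Orbit.ext ?_
  change RandomSplitting.steps V (m + 1) x.1
    (fun k => Sum.elim s t ((consTimesEquiv m n).symm k)) =
      RandomSplitting.steps V m (RandomSplitting.step V x.1 s) t
  unfold RandomSplitting.steps
  rw [List.finRange_succ, List.foldl_cons, List.foldl_map]
  simp only [← consTimesEquiv_inl, ← consTimesEquiv_inr, Equiv.symm_apply_apply, Sum.elim_inl,
    Sum.elim_inr]

theorem continuous_steps (m : ℕ) (h : ℝ) (x : Orbit V x₀) :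
    Continuous fun t : Fin (m * n) → ℝ => x.steps m fun k => h * t k :=
  ((isReach_const x).steps (contDiff_pi.2 fun k => contDiff_const.mul
    (contDiff_apply ℝ ℝ k))).continuous

/-- The outermost operator in an iterate averages over the first step of the walk, so the times are
split off at the front. -/
theorem transition_iterate {ρ : ℝ → ℝ≥0} (hρ : IsProbDensity ρ) (h : ℝ) {f : Orbit V x₀ → ℝ}
    (hf : IsBddMeasurable f) (m : ℕ) (x : Orbit V x₀) :
    (transition ρ h)^[m] f x = ∫ t, f (x.steps m fun k => h * t k) ∂timesLaw (m * n) ρ := by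
  induction m generalizing x with
  | zero =>
    have := isProbabilityMeasure_timesLaw (0 * n) hρ
    have h0 (t : Fin (0 * n) → ℝ) : x.steps 0 t = x := rfl
    simp [h0]
  | succ m ih =>
    obtain ⟨hfm, C, hC⟩ := hf
    rw [Function.iterate_succ_apply', integral_timesLaw_succ hρ
      (G := fun t => f (x.steps (m + 1) fun k => h * t k)) (hfm.comp (continuous_steps (m + 1) h x).measurable) fun t => hC _]
    unfold transition at ih ⊢
    refine integral_congr_ae (ae_of_all _ fun s => ?_)
    simp only
    rw [ih]
    refine integral_congr_ae (ae_of_all _ fun t => ?_)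
    simp only
    rw [← Orbit.steps_cons]
    congr 2
    funext k
    rcases (consTimesEquiv m n).symm k <;> rfl

theorem transition_iterate_eq_integral {ρ : ℝ → ℝ≥0} (hρ : IsProbDensity ρ) (h : ℝ)
    {f : Orbit V x₀ → ℝ} (hf : IsBddMeasurable f) (m : ℕ) (x : Orbit V x₀) :
    (transition ρ h)^[m] f x = ∫ t : EuclideanSpace ℝ (Fin (m * n)),
      f (x.timeMap m h t) * ((∏ k, ρ (t k) : ℝ≥0) : ℝ) := by
  rw [transition_iterate hρ h hf, integral_timesLaw hρ]
  rfl

theorem measurable_prod_density {N : ℕ} {ρ : ℝ → ℝ≥0} (hρ : IsProbDensity ρ) :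
    Measurable fun t : EuclideanSpace ℝ (Fin N) => ∏ k, ρ (t k) :=
  Finset.measurable_prod _ fun k _ =>
    hρ.1.comp (EuclideanSpace.proj (𝕜 := ℝ) k).continuous.measurable

theorem integrable_prod_density {N : ℕ} {ρ : ℝ → ℝ≥0} (hρ : IsProbDensity ρ) :
    Integrable fun t : EuclideanSpace ℝ (Fin N) => ((∏ k, ρ (t k) : ℝ≥0) : ℝ) := by
  refine ⟨(measurable_prod_density hρ).coe_nnreal_real.aestronglyMeasurable, ?_⟩
  rw [hasFiniteIntegral_iff_enorm]
  have : ∫⁻ t : EuclideanSpace ℝ (Fin N), ‖((∏ k, ρ (t k) : ℝ≥0) : ℝ)‖ₑ = 1 := by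
    rw [← lintegral_prod_density (N := N) hρ]
    refine lintegral_congr fun t => ?_
    rw [← ENNReal.ofNNReal_finsetProd]
    simp [enorm_eq_nnnorm]
  rw [this]
  exact ENNReal.one_lt_top

theorem norm_transition_iterate_le {ρ : ℝ → ℝ≥0} (hρ : IsProbDensity ρ) (h : ℝ)
    {f : Orbit V x₀ → ℝ} (hf : IsBddMeasurable f) {C : ℝ} (hC : ∀ y, |f y| ≤ C) (m : ℕ)
    (x : Orbit V x₀) : |(transition ρ h)^[m] f x| ≤ C := by
  have := isProbabilityMeasure_timesLaw (m * n) hρ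
  rw [transition_iterate hρ h hf]
  have := norm_integral_le_of_norm_le_const (μ := timesLaw (m * n) ρ)
    (f := fun t => f (x.steps m fun k => h * t k)) (ae_of_all _ fun t => hC _)
  simpa using this

variable (hc : ∀ j, IsComplete (V j)) (hV : ∀ j, AnalyticOnNhd ℝ (V j) univ)
include hc hV

/-- For fixed `t` the derivative depends continuously on the base point along each family that
defines the orbit topology, and rank is lower semicontinuous. -/
theorem isOpen_setOf_exists_le_finrank (m d : ℕ) : IsOpen {x : Orbit V x₀ |
    ∃ t, d ≤ Module.finrank ℝ (LinearMap.range (timeDeriv m 1 x t).toLinearMap)} := by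
  refine isOpen_orbit_iff.2 fun k => isOpen_iff_mem_nhds.2 fun s ⟨t, ht⟩ => ?_
  let A := fun s : Fin (k * n) → ℝ => (⟨steps V k x₀ s, k, s, rfl⟩ : Orbit V x₀)
  have hΓ := ((isReach_base (V := V) (x₀ := x₀) k).timeMap m 1).contDiff hc hV
  set Γ : (Fin (k * n) → ℝ) × EuclideanSpace ℝ (Fin (m * n)) → EuclideanSpace ℝ (Fin D) :=
    fun v => ((A v.1).timeMap m 1 v.2).1
  have hder (s : Fin (k * n) → ℝ) :
      timeDeriv m 1 (A s) t = fderiv ℝ Γ (s, t) ∘L .inr ℝ (Fin (k * n) → ℝ) _ :=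
    (HasFDerivAt.comp (g := Γ) t (hΓ.differentiable (by simp) (s, t)).hasFDerivAt
      (hasFDerivAt_prodMk_right (𝕜 := ℝ) s t)).fderiv
  have hcont : Continuous fun s => timeDeriv m 1 (A s) t := by
    simp_rw [hder]
    exact ((hΓ.continuous_fderiv (by simp)).comp (Continuous.prodMk_left t)).clm_comp
      continuous_const
  exact (eventually_le_finrank_range hcont.continuousAt ht).mono fun s' hs' => ⟨t, hs'⟩

/-- The derivative for step size `h` at `t / h` is `h` times the one for step size `1` at `t`. So
full rank at one time for step size `1` gives full rank somewhere for each `h`, hence almost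
everywhere by analyticity. -/
theorem ae_isSubmersionAt (hd : ∀ y : Orbit V x₀, Module.finrank ℝ (tangentSpace y) = d) {m : ℕ}
    {x : Orbit V x₀}
    (hx : ∃ t, d ≤ Module.finrank ℝ (LinearMap.range (timeDeriv m 1 x t).toLinearMap)) {h : ℝ}
    (hh : 0 < h) : ∀ᵐ t, IsSubmersionAt m h x t := by
  obtain ⟨t, ht⟩ := hx
  have hder : timeDeriv m h x (h⁻¹ • t) = h • timeDeriv m 1 x t := by
    have h1 : (fun u => (x.timeMap m h u).1) = fun u => (x.timeMap m 1 (h • u)).1 := by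
      funext u
      simp [Orbit.timeMap]
    have h2 : HasFDerivAt (fun u : EuclideanSpace ℝ (Fin (m * n)) => h • u)
        (h • ContinuousLinearMap.id ℝ _) (h⁻¹ • t) := (hasFDerivAt_id _).const_smul h
    have h3 : HasFDerivAt (fun u => (x.timeMap m 1 u).1) (timeDeriv m 1 x t) (h • h⁻¹ • t) := by
      rw [smul_inv_smul₀ hh.ne']
      exact ((contDiff_timeMap hc hV m 1 x).differentiable (by simp) t).hasFDerivAt
    have h4 : HasFDerivAt (fun u => (x.timeMap m 1 (h • u)).1)
        (timeDeriv m 1 x t ∘L (h • ContinuousLinearMap.id ℝ _)) (h⁻¹ • t) :=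
      HasFDerivAt.comp (g := fun u => (x.timeMap m 1 u).1) _ h3 h2
    rw [timeDeriv, h1, h4.fderiv]
    ext v
    simp
  have hr : d ≤ Module.finrank ℝ (LinearMap.range
      (fderiv ℝ (fun u => (x.timeMap m h u).1) (h⁻¹ • t)).toLinearMap) := by
    change d ≤ Module.finrank ℝ (LinearMap.range (timeDeriv m h x (h⁻¹ • t)).toLinearMap)
    rw [hder, ContinuousLinearMap.toLinearMap_smul, LinearMap.range_smul _ _ hh.ne']
    exact ht
  filter_upwards [ae_le_finrank_range_fderiv (contDiff_timeMap hc hV m h x) hr] with u hu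
  exact (isSubmersionAt_iff hc hV hd).2 hu

variable (hd : ∀ y : Orbit V x₀, Module.finrank ℝ (tangentSpace y) = d)
include hd

/-- The law of `Φ^m(x, h τ)` has the fibre integral as its density. -/
theorem map_timeMap_eq_withDensity (hcharts : HasCharts V x₀ d) {m : ℕ} {h : ℝ} {x : Orbit V x₀}
    (hdm : d ≤ m * n) (hae : ∀ᵐ t, IsSubmersionAt m h x t) {ρ : ℝ → ℝ≥0} (hρ : IsProbDensity ρ) :
    (volume.withDensity fun t => ((∏ k, ρ (t k) : ℝ≥0) : ℝ≥0∞)).map (x.timeMap m h)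
      = (orbitVolume V x₀ d).withDensity (coareaIntegral d m ρ h x) := by
  have hQ : Measurable fun t : EuclideanSpace ℝ (Fin (m * n)) =>
      ((∏ k, ρ (t k) : ℝ≥0) : ℝ≥0∞) := (measurable_prod_density hρ).coe_nnreal_ennreal
  have hF : Measurable (x.timeMap m h) := (isReach_timeMap m h x).continuous.measurable
  ext B hB
  -- The coarea formula is applied to the density cut off to the preimage of `B`; on the fibre over
  -- `y` this cutoff is constant.
  rw [Measure.map_apply hF hB, withDensity_apply _ (hF hB), withDensity_apply _ hB,
    ← lintegral_indicator (hF hB), ← lintegral_indicator hB,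
    (coarea_timeMap hc hV hd hcharts hdm hae (hQ.indicator (hF hB))).2]
  refine lintegral_congr fun y => ?_
  have hfm : MeasurableSet (x.timeMap m h ⁻¹' {y}) := by
    have : x.timeMap m h ⁻¹' {y} = (fun t => (x.timeMap m h t).1) ⁻¹' {y.1} := by
      ext t
      exact ⟨fun ht => congrArg Orbit.val ht, fun ht => Orbit.ext ht⟩
    rw [this]
    exact (isClosed_singleton.preimage (contDiff_timeMap hc hV m h x).continuous).measurableSet
  by_cases hy : y ∈ B
  · rw [indicator_of_mem hy]
    refine setLIntegral_congr_fun hfm fun t ht => ?_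
    have ht' : t ∈ x.timeMap m h ⁻¹' B := by
      rw [mem_preimage, show x.timeMap m h t = y from ht]
      exact hy
    simp only [indicator_of_mem ht', ENNReal.ofNNReal_finsetProd]
    rfl
  · rw [indicator_of_notMem hy]
    refine (setLIntegral_congr_fun hfm fun t ht => ?_).trans lintegral_zero
    have ht' : t ∉ x.timeMap m h ⁻¹' B := by
      rw [mem_preimage, show x.timeMap m h t = y from ht]
      exact hy
    simp only [indicator_of_notMem ht', ENNReal.zero_div]

theorem aemeasurable_coareaIntegral (hcharts : HasCharts V x₀ d) {m : ℕ} {h : ℝ} {x : Orbit V x₀}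
    (hdm : d ≤ m * n) (hae : ∀ᵐ t, IsSubmersionAt m h x t) {ρ : ℝ → ℝ≥0} (hρ : IsProbDensity ρ) :
    AEMeasurable (coareaIntegral d m ρ h x) (orbitVolume V x₀ d) ∧
      ∫⁻ y, coareaIntegral d m ρ h x y ∂(orbitVolume V x₀ d) = 1 := by
  have hQ : Measurable fun t : EuclideanSpace ℝ (Fin (m * n)) => ∏ k, (ρ (t k) : ℝ≥0∞) := by
    simp_rw [← ENNReal.ofNNReal_finsetProd]
    exact (measurable_prod_density hρ).coe_nnreal_ennreal
  obtain ⟨h1, h2⟩ := coarea_timeMap hc hV hd hcharts hdm hae hQ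
  rw [lintegral_prod_density hρ] at h2
  exact ⟨h1, h2.symm⟩

end Transition

end RandomSplitting

end

/-! ### The main theorem. -/

theorem mainTheorem4 {D n : ℕ}
    (V : Fin n → EuclideanSpace ℝ (Fin D) → EuclideanSpace ℝ (Fin D))
    (hV : ∀ j, AnalyticOnNhd ℝ (V j) Set.univ)
    (hc : ∀ j, RandomSplitting.IsComplete (V j))
    (x₀ : EuclideanSpace ℝ (Fin D)) (xs : RandomSplitting.Orbit V x₀)
    (d : ℕ) (hd : Module.finrank ℝ (RandomSplitting.tangentSpace xs) = d)
    (hL : RandomSplitting.LieBracketCondition xs) :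
    ∃ (m : ℕ) (U : Set (RandomSplitting.Orbit V x₀)),
      0 < m ∧ d ≤ m * n ∧ IsOpen U ∧ xs ∈ U ∧
      (∀ x ∈ U, ∀ h : ℝ, 0 < h →
        ∀ᵐ t : EuclideanSpace ℝ (Fin (m * n)), RandomSplitting.IsSubmersionAt m h x t) ∧
      ∀ ρ : ℝ → ℝ≥0, RandomSplitting.IsProbDensity ρ → ∀ h : ℝ, 0 < h →
        RandomSplitting.StrongFellerOn
          (RandomSplitting.transition (V := V) (x₀ := x₀) ρ h)^[m] U ∧
        ∀ x ∈ U,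
          (∀ᵐ y ∂(RandomSplitting.orbitVolume V x₀ d),
            (RandomSplitting.transitionDensity d m ρ h x y : ℝ≥0∞)
              = RandomSplitting.coareaIntegral d m ρ h x y) ∧
          MeasureTheory.Integrable
            (fun y => (RandomSplitting.transitionDensity d m ρ h x y : ℝ))
            (RandomSplitting.orbitVolume V x₀ d) ∧
          ∀ f : RandomSplitting.Orbit V x₀ → ℝ, RandomSplitting.IsBddMeasurable f →
            (RandomSplitting.transition ρ h)^[m] f x
              = ∫ y, f y * (RandomSplitting.transitionDensity d m ρ h x y : ℝ)
                  ∂(RandomSplitting.orbitVolume V x₀ d) := by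
  open RandomSplitting in
  have hcharts : HasCharts V x₀ d := hasCharts hc hV xs hd hL
  have hd' (y : Orbit V x₀) : Module.finrank ℝ (tangentSpace y) = d :=
    (finrank_tangentSpace_eq hc hV y xs).trans hd
  obtain ⟨m, t₁, hm, hr⟩ := exists_le_finrank_range_timeDeriv hc hV xs hL
  rw [hd] at hr
  have hdm : d ≤ m * n := by
    refine (hr.trans (LinearMap.finrank_range_le _)).trans ?_
    rw [finrank_euclideanSpace_fin]
  -- Full rank at a single time for step size `1` defines `U`, so neither `U` nor `m` depends on `h`
  -- or `ρ`.
  set U : Set (Orbit V x₀) :=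
    {x | ∃ t, d ≤ Module.finrank ℝ (LinearMap.range (timeDeriv m 1 x t).toLinearMap)}
  have hU : IsOpen U := isOpen_setOf_exists_le_finrank hc hV m d
  have hsub (x) (hx : x ∈ U) (h : ℝ) (hh : 0 < h) : ∀ᵐ t, IsSubmersionAt m h x t :=
    ae_isSubmersionAt hc hV hd' hx hh
  refine ⟨m, U, hm, hdm, hU, ⟨t₁, hr⟩, hsub, fun ρ hρ h hh => ⟨fun f hf => ⟨?_, ?_⟩, ?_⟩⟩
  · refine (continuousOn_integral_timeMap hc hV hd' hcharts hU (fun x hx => hsub x hx h hh) hf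
      (integrable_prod_density hρ)).congr fun x _ => ?_
    exact transition_iterate_eq_integral hρ h hf m x
  · obtain ⟨C, hC⟩ := hf.2
    exact ⟨C, fun x _ => norm_transition_iterate_le hρ h hf hC m x⟩
  · intro x hx
    have hae := hsub x hx h hh
    obtain ⟨hm1, hm2⟩ := aemeasurable_coareaIntegral hc hV hd' hcharts hdm hae hρ
    -- The fibre integral has total mass `1`, so it is finite almost everywhere; the default value
    -- `0` of the density is used only on a null set.
    have hfin : ∀ᵐ y ∂(orbitVolume V x₀ d), coareaIntegral d m ρ h x y < ⊤ :=
      ae_lt_top' hm1 (by rw [hm2]; exact ENNReal.one_ne_top)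
    refine ⟨?_, ?_, fun f hf => ?_⟩
    · filter_upwards [hfin] with y hy
      exact ENNReal.coe_toNNReal hy.ne
    · exact integrable_toReal_of_lintegral_ne_top hm1 (by rw [hm2]; exact ENNReal.one_ne_top)
    · have hF : Measurable (x.timeMap m h) := (isReach_timeMap m h x).continuous.measurable
      have hmap := map_timeMap_eq_withDensity hc hV hd' hcharts hdm hae hρ
      have h1 : ∫ y, f y ∂(volume.withDensity fun t : EuclideanSpace ℝ (Fin (m * n)) =>
          ((∏ k, ρ (t k) : ℝ≥0) : ℝ≥0∞)).map (x.timeMap m h)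
          = ∫ t, f (x.timeMap m h t) * ((∏ k, ρ (t k) : ℝ≥0) : ℝ) := by
        rw [integral_map hF.aemeasurable hf.1.aestronglyMeasurable,
          integral_withDensity_eq_integral_smul (measurable_prod_density hρ)]
        refine integral_congr_ae (Filter.Eventually.of_forall fun t => ?_)
        simp only [NNReal.smul_def, smul_eq_mul]
        exact mul_comm _ _
      rw [transition_iterate_eq_integral hρ h hf m x, ← h1, hmap,
        integral_withDensity_eq_integral_toReal_smul₀ hm1 hfin]
      refine integral_congr_ae (Filter.Eventually.of_forall fun y => ?_)
      simp only [smul_eq_mul]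
      exact mul_comm _ _
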